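/- **Setting.** Let $G=(V,E,(r_e)_{e\in E})$ be a finite connected graph with positive edge weights, $V=\{1,\dots,n\}$, $n\ge 2$. Let $s=b/a$ with coprime positive integers $a,b$, let $m\ge2$, and put $\chi(k)=ak+b$, $K=a(m-1)+bn$. For $k\le N$ let $\beta_N(k)=\binom Nk\,\mathrm B(k+s,N-k+s)/\mathrm B(s,s)$ (the beta-binomial law with parameters $N,s,s$). Let $p^*\in(0,1/3)$ be such that $\sum_{N/3\le k\le 2N/3}\beta_N(k)\ge p^*$ for all $2\le N\le m$, and $\beta_2(0)+\beta_2(2)\ge 2p^*$. Let $\hat M_{i,j}(G)$ be the meeting time of two independent walks $X,Y$ started from $i,j$, each jumping along every edge $e$ incident to its current vertex at the rings of its own Poisson process of rate $r_e/2$ on $e$: it is the first time at which $X,Y$ are on neighbouring vertices and the edge between them rings for one of the walks ($0$ if $i=j$). **Modified chameleon process during a round.** Every vertex $v$ carries $B(v)$ black and $\chi(B(v))$ non-black (red, white or pink) particles, $\sum_vB(v)=m-1$; write $R,P,W$ for the numbers of red, pink and white ones and $|R|=\sum_vR(v)$, etc. At the start of the round $|R|\wedge|W|$ red particles get the labels $1,2,\dots$,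 vertex by vertex in increasing order, and so do as many white ones; equal labels form a pair. The edges ring at the times of a Poisson process of rate $\sum_er_e$, each ring being on edge $e$ with probability proportional to $r_e$. When $e=\{v,w\}$, $v<w$, rings, all non-black particles on $e$ are pooled and the configuration is updated as follows, with fresh randomness. With $N=B(v)+B(w)$, the new black numbers are $B'(v)=k$ with probability $\beta_N(k)$ and $B'(w)=N-k$ (nothing changes off $e$); this is implemented from a uniform variable $U^b$ by listing the outcomes $k$ by increasing $|k-N/2|$, ties in favour of smaller $k$, and all other randomness comes from an independent uniform variable $U^c$. Put $R_e=R(v)+R(w)$, $P_e=P(v)+P(w)$, $$\ell(v)=(R_e-\chi(B'(w)))\vee0,\quad u(v)=\chi(B'(v))\wedge R_e,\quad \ell^P(v)=(P_e-\chi(B'(w))+u(w))\vee0,\quad u^P(v)=(\chi(B'(v))-u(v))\wedge P_e,$$ $\ell(w),u(w)$ symmetrically, and let $\theta$ solve $$\theta\big[\ell(v)+\tfrac12\ell^P(v)\big]+(1-\theta)\big[u(v)+\tfrac12u^P(v)\big]=\big(R(v)+\tfrac12P(v)\big)\mathrm P(v,v)+\big(R(w)+\tfrac12P(w)\big)\mathrm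 P(w,v),$$ where, for $x\in\{v,w\}$, $\mathrm P(x,v)=\frac{B'(v)+1}{N+1}\,\beta_{N+1}(B'(v)+1)/\beta_N(B'(v))$ (if the two brackets agree, $\theta$ is irrelevant). A red particle on $e$ is called paired if its paired white particle is on $e$ too. 1. $\ell(v)+\ell(w)$ red particles are chosen from the pile, uniformly among the non-paired ones as far as these suffice and then uniformly among the paired ones; a uniformly chosen $\ell(v)$ of them go to $v$ and the others to $w$. 2. Independently, with probability $2[\theta\wedge(1-\theta)]$ do 3a, otherwise 3b. 3. (a) All paired red particles left in the pile turn pink and go to $v$, their paired white particles turn pink and go to $w$ (these particles lose their labels), and every other red particle left goes to $v$ or $w$ independently with probability $\frac12$. (b) All red particles left go to $v$ if $\theta<\frac12$, and to $w$ otherwise. 4. Of the $P_e$ old pink particles, with probability $\theta$ one puts $\ell^P(v)$, and otherwise $u^P(v)$, onto $v$, and the rest onto $w$; should this lead to more than $\chi(B'(v))$ or $\chi(B'(w))$ non-black particles on $v$ or $w$, the number put onto $v$ is changed by the least amount that avoids this. 5. The remaining white particles are placed uniformly so that $v$ and $w$ carry $\chi(B'(v))$ and $\chi(B'(w))$ non-black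 particles. **Proposition.** Suppose that the modified chameleon process starts a round of length $T$ with red configuration $R$, white configuration $W$ and black configuration $B$ (all other non-black particles being pink) such that $|R|\le|W|$. Let $|R^{\mathrm C}_{T-}|$ be the number of red particles just before the end of the round. If $T\ge 2\max_{i,j}\mathbb E\hat M_{i,j}(G)$, then $$\mathbb E\big[|R^{\mathrm C}_{T-}|\big]\le(1-c)\,|R|,\qquad c=\frac{(p^*)^2}{4a}.$$ -/

import Mathlib

open MeasureTheory
open scoped ENNReal unitInterval

noncomputable section

namespace Chameleon

/-! ### Weighted graphs and their edge rings -/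

/-- A finite connected graph with positive edge weights. -/
structure WeightedGraph (V : Type*) where
  graph : SimpleGraph V
  connected : graph.Connected
  rate : graph.edgeSet → ℝ
  rate_pos : ∀ e, 0 < rate e

variable {V : Type*} [Fintype V] [LinearOrder V]

/-- The edges of a weighted graph. -/
abbrev WeightedGraph.Edge (G : WeightedGraph V) : Type _ := G.graph.edgeSet

instance (G : WeightedGraph V) : Fintype G.Edge := Fintype.ofFinite _

instance (G : WeightedGraph V) : MeasurableSpace G.Edge := ⊤

/-- The smaller end-vertex of an edge. -/
def v₁ {G : WeightedGraph V} (e : G.Edge) : V := Sym2.inf e.1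

/-- The larger end-vertex of an edge. -/
def v₂ {G : WeightedGraph V} (e : G.Edge) : V := Sym2.sup e.1

/-- The rate `∑ₑ rₑ` at which edges ring. -/
def WeightedGraph.totalRate (G : WeightedGraph V) : ℝ := ∑ e : G.Edge, G.rate e

/-- The graph obtained by halving all edge weights. -/
def WeightedGraph.half (G : WeightedGraph V) : WeightedGraph V where
  graph := G.graph
  connected := G.connected
  rate e := G.rate e / 2
  rate_pos e := half_pos (G.rate_pos e)

/-- The law of a ringing edge: edge `e` has probability `rₑ / ∑ r`. -/
def WeightedGraph.edgeLaw (G : WeightedGraph V) : Measure G.Edge :=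
  ∑ e : G.Edge, ENNReal.ofReal (G.rate e / G.totalRate) • Measure.dirac e

/-- The law of one ring: the waiting time since the previous ring, exponential with rate `∑ r`,
and, independently, the edge that rings. -/
def WeightedGraph.ringLaw (G : WeightedGraph V) : Measure (ℝ × G.Edge) :=
  (ProbabilityTheory.expMeasure G.totalRate).prod G.edgeLaw

/-- With waiting times `gap 0, gap 1, …`, the time `τ_k` of the `k`-th ring (and `τ_0 = 0`). -/
def ringTime (gap : ℕ → ℝ) (k : ℕ) : ℝ := ∑ l ∈ Finset.range k, gap l

/-- The number of rings strictly before time `t`. -/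
def ringsBefore (gap : ℕ → ℝ) (t : ℝ) : ℕ := sInf {k : ℕ | t ≤ ringTime gap (k + 1)}

/-! ### Independent random walks and their meeting time -/

/-- The position after `k` rings of the walk started from `i` that crosses every edge incident
to its current vertex when that edge rings. -/
def walkPos {G : WeightedGraph V} (i : V) (ω : ℕ → ℝ × G.Edge) : ℕ → V
  | 0 => i
  | k + 1 =>
    let e := (ω k).2
    if walkPos i ω k = v₁ e then v₂ e
    else if walkPos i ω k = v₂ e then v₁ e
    else walkPos i ω k

/-- The position of the walk just before time `t`. -/
def walkBefore {G : WeightedGraph V} (i : V) (ω : ℕ → ℝ × G.Edge) (t : ℝ) : V :=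
  walkPos i ω (ringsBefore (fun l => (ω l).1) t)

/-- Some ring of the first walk (driven by `ω`) occurs at time `t`, on the edge joining
the positions of the two walks just before time `t`. -/
def MeetsAt {G : WeightedGraph V} (i j : V) (ω ω' : ℕ → ℝ × G.Edge) (t : ℝ) : Prop :=
  ∃ k : ℕ, t = ringTime (fun l => (ω l).1) (k + 1) ∧
    ((ω k).2 : Sym2 V) = s(walkPos i ω k, walkBefore j ω' t)

open Classical in
/-- The meeting time of the walks started from `i` and `j` and driven by `ω` and `ω'`: the first
time that they are on neighbouring vertices and the edge between them rings for one of them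
(and `0` if they start together). -/
def meetTime {G : WeightedGraph V} (i j : V) (ω ω' : ℕ → ℝ × G.Edge) : ℝ≥0∞ :=
  if i = j then 0
  else sInf (ENNReal.ofReal '' {t : ℝ | MeetsAt i j ω ω' t ∨ MeetsAt j i ω' ω t})

/-- The expected meeting time of two independent random walks on `G` from `i` and `j`, each with
its own independent sequence of edge rings. -/
def WeightedGraph.expectedMeetTime (G : WeightedGraph V) (i j : V) : ℝ≥0∞ :=
  ∫⁻ p, meetTime i j p.1 p.2
    ∂((Measure.infinitePi fun _ : ℕ => G.ringLaw).prod (Measure.infinitePi fun _ : ℕ => G.ringLaw))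

/-! ### The beta-binomial splitting process and its marked version -/

/-- The probability that a beta-binomial variable with parameters `N, s, s` equals `k ≤ N`. -/
def betaBin (s : ℝ) (N k : ℕ) : ℝ :=
  (N.choose k : ℝ) * ProbabilityTheory.beta (k + s) ((N - k : ℕ) + s) / ProbabilityTheory.beta s s

/-- `p` is a probability in `(0, 1/3)` such that an update of an edge that holds `N` particles,
`2 ≤ N ≤ m`, places between `N/3` and `2N/3` of them on an end-vertex with probability at least
`p`, and puts both particles on the same vertex with probability at least `2p` if `N = 2`. -/
structure IsEvenSplitBound (s : ℝ) (m : ℕ) (p : ℝ) : Prop where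
  pos : 0 < p
  lt_third : p < 1 / 3
  near_even : ∀ N : ℕ, 2 ≤ N → N ≤ m →
    p ≤ ∑ k ∈ (Finset.range (N + 1)).filter (fun k => N ≤ 3 * k ∧ 3 * k ≤ 2 * N), betaBin s N k
  same_vertex : 2 * p ≤ betaBin s 2 0 + betaBin s 2 2

open Classical in
/-- The probability that the splitting process moves from `ξ` to `ξ'` when the edge `e` rings. -/
def bbProb (s : ℝ) {G : WeightedGraph V} (e : G.Edge) (ξ ξ' : V → ℕ) : ℝ :=
  if (∀ z, z ≠ v₁ e → z ≠ v₂ e → ξ' z = ξ z) ∧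
      ξ' (v₁ e) + ξ' (v₂ e) = ξ (v₁ e) + ξ (v₂ e) then
    betaBin s (ξ (v₁ e) + ξ (v₂ e)) (ξ' (v₁ e))
  else 0

/-- `ξ` with one more particle on `v`. -/
def addOne (ξ : V → ℕ) (v : V) : V → ℕ := Function.update ξ v (ξ v + 1)

/-- For `x, y ∈ e`: the probability that the marked particle moves from `x` to `y` when `e` rings
and the non-marked particles move from `ξ` to `ξ'`. -/
def markProb (s : ℝ) {G : WeightedGraph V} (e : G.Edge) (ξ ξ' : V → ℕ) (x y : V) : ℝ :=
  ((ξ' y : ℝ) + 1) / ((ξ (v₁ e) : ℝ) + ξ (v₂ e) + 1) *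
    (bbProb s e (addOne ξ x) (addOne ξ' y) / bbProb s e ξ ξ')

/-- The order in which the outcomes `0, …, N` for the smaller end-vertex are listed: by distance
from `N/2`, ties resolved in favour of fewer particles. -/
def Earlier (N i j : ℕ) : Prop :=
  |2 * (i : ℤ) - N| < |2 * (j : ℤ) - N| ∨ (|2 * (i : ℤ) - N| = |2 * (j : ℤ) - N| ∧ i < j)

open Classical in
/-- The total probability of the outcomes listed before `k`. -/
def cumBefore (s : ℝ) (N k : ℕ) : ℝ :=
  ∑ i ∈ (Finset.range (N + 1)).filter (fun i => Earlier N i k), betaBin s N i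

open Classical in
/-- The number of the `N` non-marked particles of the ringing edge that the uniform variable `u`
sends to the smaller end-vertex (the default value is used for `u = 0` only). -/
def splitCount (s : ℝ) (N : ℕ) (u : ℝ) : ℕ :=
  if h : ∃ k, k ≤ N ∧ cumBefore s N k < u ∧ u ≤ cumBefore s N k + betaBin s N k then Nat.find h
  else 0

/-- The configuration of non-marked particles after `e` rings. -/
def mabb (s : ℝ) {G : WeightedGraph V} (u : ℝ) (e : G.Edge) (ξ : V → ℕ) : V → ℕ :=
  let N := ξ (v₁ e) + ξ (v₂ e)
  let k := splitCount s N u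
  Function.update (Function.update ξ (v₁ e) k) (v₂ e) (N - k)

/-! ### Configurations of the chameleon process -/

/-- The colour function. -/
def chi (a b k : ℕ) : ℕ := a * k + b

/-- A configuration: numbers of black, red and pink particles, and the positions of the labelled
red and of the labelled white particles, the possible labels being `0, …, K - 1`. -/
@[ext] structure State (V : Type*) (K : ℕ) where
  B : V → ℕ
  R : V → ℕ
  P : V → ℕ
  LR : Fin K → Option V
  LW : Fin K → Option V

instance {K : ℕ} : MeasurableSpace (State V K) := ⊤

/-- The number of white particles on `v`. -/
def State.W {K : ℕ} (a b : ℕ) (x : State V K) (v : V) : ℕ := chi a b (x.B v) - x.R v - x.P v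

open Classical in
/-- The vertex of the particle with (zero-based) rank `j` when the particles of `S` are listed
vertex by vertex in increasing order. -/
def vertexOfRank (S : V → ℕ) (j : ℕ) : Option V :=
  if h : (Finset.univ.filter fun v => j < ∑ z ∈ Finset.univ.filter (· ≤ v), S z).Nonempty then
    some (Finset.min' _ h)
  else none

/-- The labels given at the start of a round to the particles of configuration `S`, when `N` of
them are to be labelled. -/
def initialLabels (K N : ℕ) (S : V → ℕ) : Fin K → Option V :=
  fun j => if (j : ℕ) < N then vertexOfRank S j else none

/-- The configuration at the start of a round with black, red and white particles `B`, `R`, `W`: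
all other non-black particles are pink, and `min |R| |W|` red and as many white particles carry
labels, equal labels making a pair. -/
def startState (a b K : ℕ) (B R W : V → ℕ) : State V K where
  B := B
  R := R
  P v := chi a b (B v) - R v - W v
  LR := initialLabels K (min (∑ v, R v) (∑ v, W v)) R
  LW := initialLabels K (min (∑ v, R v) (∑ v, W v)) W

/-! ### One step of the modified chameleon process -/

/-- A particle of a given colour in the pooled pile: either a labelled one, given by its label,
or an unlabelled one. -/
abbrev Token (K : ℕ) : Type := Fin K ⊕ ℕ

/-- A coin that shows `true` with probability `p ∈ [0, 1]`. -/
def coin (p : ℝ) : PMF Bool :=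
  PMF.ofFintype (fun c => cond c (min (ENNReal.ofReal p) 1) (1 - min (ENNReal.ofReal p) 1))
    (by simp)

/-- A uniformly chosen subset of `S` with `k` elements (all of `S` if `S` has fewer). -/
def uniformSubset {K : ℕ} (S : Finset (Token K)) (k : ℕ) : PMF (Finset (Token K)) :=
  PMF.uniformOfFinset (S.powersetCard (min k S.card))
    (Finset.powersetCard_nonempty.2 (min_le_right _ _))

/-- Every element of `S` is retained independently with probability `1/2`. -/
def halfSubset {K : ℕ} (S : Finset (Token K)) : PMF (Finset (Token K)) :=
  PMF.uniformOfFinset S.powerset ⟨∅, Finset.empty_mem_powerset S⟩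

section Step

variable {K : ℕ} {G : WeightedGraph V} (a b : ℕ) (e : G.Edge) (x : State V K) (B' : V → ℕ)

/-- The label configuration `L` has a particle of label `i` on the edge `e`. -/
def OnEdge (L : Fin K → Option V) (i : Fin K) : Prop := L i = some (v₁ e) ∨ L i = some (v₂ e)

/-- The number of particles of `S` on the edge `e`. -/
def onEdge (S : V → ℕ) : ℕ := S (v₁ e) + S (v₂ e)

/-- The bounds `ℓ`, for the end-vertex `v` of `e` whose other end-vertex is `w`, on the number of
red particles on `v` after the update. -/
def lowR (w : V) : ℕ := onEdge e x.R - chi a b (B' w)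

/-- The bounds `u`. -/
def upR (v : V) : ℕ := min (chi a b (B' v)) (onEdge e x.R)

/-- The bounds `ℓ^P`, for the end-vertex whose other end-vertex is `w`. -/
def lowP (w : V) : ℕ := onEdge e x.P + upR a b e x B' w - chi a b (B' w)

/-- The bounds `u^P`. -/
def upP (v : V) : ℕ := min (chi a b (B' v) - upR a b e x B' v) (onEdge e x.P)

/-- The ink that the first end-vertex should have on average after the update. -/
def meanInk : ℝ :=
  ((x.R (v₁ e) : ℝ) + (x.P (v₁ e) : ℝ) / 2) * markProb ((b : ℝ) / a) e x.B B' (v₁ e) (v₁ e) +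
  ((x.R (v₂ e) : ℝ) + (x.P (v₂ e) : ℝ) / 2) * markProb ((b : ℝ) / a) e x.B B' (v₂ e) (v₁ e)

/-- The solution `θ` of `θ (ℓ + ℓ^P / 2) + (1 - θ) (u + u^P / 2) = m*` at the first end-vertex.
(If the lower and upper bounds agree, then the value of `θ` plays no role.) -/
def theta : ℝ :=
  ((upR a b e x B' (v₁ e) : ℝ) + (upP a b e x B' (v₁ e) : ℝ) / 2 - meanInk a b e x B') /
  ((upR a b e x B' (v₁ e) : ℝ) + (upP a b e x B' (v₁ e) : ℝ) / 2 -
    ((lowR a b e x B' (v₂ e) : ℝ) + (lowP a b e x B' (v₂ e) : ℝ) / 2))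

open Classical in
/-- The pooled particles of a colour with label configuration `L` and particle configuration `S`. -/
def pool (L : Fin K → Option V) (S : V → ℕ) : Finset (Token K) :=
  let lab : Finset (Fin K) := Finset.univ.filter (OnEdge e L)
  lab.disjSum (Finset.range (onEdge e S - lab.card))

open Classical in
/-- The paired red particles: those whose paired white particle is on the ringing edge as well. -/
def pairedReds : Finset (Token K) :=
  (Finset.univ.filter fun i => OnEdge e x.LR i ∧ OnEdge e x.LW i).disjSum ∅

/-- The other red particles of the ringing edge. -/
def nonPairedReds : Finset (Token K) := pool e x.LR x.R \ pairedReds e x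

open Classical in
/-- The new label configuration of a colour, given the set of pinkened labels and the set of the
pooled particles of that colour that are put onto the first end-vertex. -/
def newLabels (L : Fin K → Option V) (pinkened : Finset (Fin K)) (onFst : Finset (Token K)) :
    Fin K → Option V :=
  fun i =>
    if i ∈ pinkened then none
    else if OnEdge e L i then (if Sum.inl i ∈ onFst then some (v₁ e) else some (v₂ e))
    else L i

/-- The configuration `S` with `f` and `g` particles on the end-vertices of `e`. -/
def setEnds (S : V → ℕ) (f g : ℕ) : V → ℕ :=
  Function.update (Function.update S (v₁ e) f) (v₂ e) g

open Classical in
/-- The law of the new configuration when `e` rings in configuration `x` and the black particles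
move to `B'`, in the process in which all available paired red particles are pinkened. -/
def stepLaw : PMF (State V K) :=
  let v := v₁ e
  let w := v₂ e
  let θ := theta a b e x B'
  let needed := lowR a b e x B' w + lowR a b e x B' v
  -- Step 1: the red particles for the lower bounds; non-paired ones are used first
  (uniformSubset (nonPairedReds e x) needed).bind fun A₁ =>
  (uniformSubset (pairedReds e x) (needed - (nonPairedReds e x).card)).bind fun A₂ =>
  (uniformSubset (A₁ ∪ A₂) (lowR a b e x B' w)).bind fun lowOnV =>
  -- Step 2: the choice between Step 3a and Step 3b
  (coin (2 * min θ (1 - θ))).bind fun fork =>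
  let rest : Finset (Token K) := (pairedReds e x ∪ nonPairedReds e x) \ (A₁ ∪ A₂)
  -- Step 3a: the remaining paired red particles are pinkened, together with their partners
  let pinkened : Finset (Fin K) :=
    Finset.univ.filter fun i => fork = true ∧ Sum.inl i ∈ rest ∩ pairedReds e x
  let k := pinkened.card
  -- Steps 3a and 3b: the remaining red particles that go to `v`
  (if fork = true then halfSubset (rest \ pairedReds e x)
    else if θ < 1 / 2 then PMF.pure rest else PMF.pure ∅).bind fun restOnV =>
  let redV := (lowOnV ∪ restOnV).card
  let redW := onEdge e x.R - k - redV
  -- Step 4: the old pink particles, as far as there is room for them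
  (coin θ).bind fun c =>
  let target := if c = true then lowP a b e x B' w else upP a b e x B' v
  let oldV := max (onEdge e x.P + (redW + k) - chi a b (B' w))
    (min target (chi a b (B' v) - (redV + k)))
  -- Step 5: the white particles
  let whites : Finset (Token K) :=
    pool e x.LW (x.W a b) \ pinkened.disjSum ∅
  (uniformSubset whites (chi a b (B' v) - (redV + k) - oldV)).map fun whiteOnV =>
    { B := B'
      R := setEnds e x.R redV redW
      P := setEnds e x.P (k + oldV) (k + (onEdge e x.P - oldV))
      LR := newLabels e x.LR pinkened (lowOnV ∪ restOnV)
      LW := newLabels e x.LW pinkened whiteOnV }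

end Step

/-! ### The modified chameleon process during a round -/

/-- `C` is an update function of the modified chameleon process: if `e` rings in configuration
`x`, then `u` determines the movement of the black particles, and the second variable, uniform
on `[0, 1]`, is the source of all other randomness of the step. -/
structure IsModifiedUpdate {K : ℕ} (G : WeightedGraph V) (a b : ℕ)
    (C : I → I → G.Edge → State V K → State V K) : Prop where
  measurable : ∀ e x, Measurable fun q : I × I => C q.1 q.2 e x
  law : ∀ u e x, Measure.map (fun u' => C u u' e x) volume =
    (stepLaw a b e x (mabb ((b : ℝ) / a) u e x.B)).toMeasure

/-- The random elements of the graphical construction: for each ring, its waiting time and its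
edge, and two uniform variables. -/
abbrev Driving (G : WeightedGraph V) : Type _ := ℕ → (ℝ × G.Edge) × (I × I)

/-- The law of the random elements of the graphical construction. -/
def drivingLaw (G : WeightedGraph V) : Measure (Driving G) :=
  Measure.infinitePi fun _ : ℕ => G.ringLaw.prod (volume : Measure (I × I))

/-- The configuration after `k` rings. -/
def afterRings {K : ℕ} {G : WeightedGraph V} (C : I → I → G.Edge → State V K → State V K)
    (x : State V K) (ω : Driving G) : ℕ → State V K
  | 0 => x
  | k + 1 => C (ω k).2.1 (ω k).2.2 (ω k).1.2 (afterRings C x ω k)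

/-- The configuration just before time `T`, if the round starts at time `0` in configuration `x`. -/
def stateBefore {K : ℕ} {G : WeightedGraph V} (C : I → I → G.Edge → State V K → State V K)
    (x : State V K) (T : ℝ) (ω : Driving G) : State V K :=
  afterRings C x ω (ringsBefore (fun l => (ω l).1.1) T)

end Chameleon

end

/-! Since `|R| ≤ |W|`, every red particle is labelled at the start, and every red particle that is
left later still has its label. The number of red particles is therefore the number of surviving
pairs, and it suffices that each single pair survives the round with probability at most `1 - δ/2`,
where `δ = p²/(2a)`.

Symmetry. The beta-binomial law is symmetric, and the update commutes with the exchange of the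
end-vertices of the ringing edge: `θ` becomes `1 - θ`, and every randomly chosen subset becomes its
complement (`stepLaw_swap`). So expectations after a ring do not change under the exchange
(`stepMean_swap`). Hence, as long as the two particles of a pair are not both on the ringing edge,
one of them that is there goes to either end-vertex with probability 1/2, and the pair moves like
two independent walks with halved edge rates (`stepMean_pair`).

Pinkening. Suppose that both particles are on the ringing edge. Let `c₁`, `c₂` be the new numbers of
non-black particles on its ends, and `t ≤ min c₁ c₂ / (c₁ + c₂)`. The red particle is not needed for
the lower bounds with probability at least `2t`, and Step 3a is then chosen with probability `2
min(θ, 1 - θ) ≥ 2t` (`le_pexp_stepLaw_none`). With at least two black particles on the edge, a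
nearly even split has probability at least `p` and allows `t = 1/3`; with fewer, `t = p` always
works. Either way the pair turns pink with probability at least `δ` (`le_stepMean_none`).

Time. Let `σ` be the first time that a ringing edge carries both particles. Conditioning on the
first ring shows that the expected meeting times at halved rates are supersolutions of the equation
for `E σ` (`le_expectedMeetTime`, `le_pairTime`). By Markov's inequality and `T ≥ 2 E σ`, the pair
survives with probability at most `(1 - δ) + δ P(σ ≥ T) ≤ 1 - δ + δ/2`. The proof does not construct
`σ`: `mul_meanUpTo_alive_le` obtains the inequality, multiplied by `T`, by induction over the number
of rings, and Fatou's lemma removes the bound on that number. -/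

noncomputable section

set_option linter.unusedSectionVars false

namespace Chameleon

/-! ### Sequences of independent elements: splitting off the first one -/

/-- The sequence with first element `a` and then the elements of `s`. -/
def consSeq {X : Type*} (a : X) (s : ℕ → X) : ℕ → X
  | 0 => a
  | n + 1 => s n

@[simp] theorem consSeq_zero {X : Type*} (a : X) (s : ℕ → X) : consSeq a s 0 = a := rfl

@[simp] theorem consSeq_succ {X : Type*} (a : X) (s : ℕ → X) (n : ℕ) :
    consSeq a s (n + 1) = s n := rfl

theorem measurable_consSeq {X : Type*} [MeasurableSpace X] :
    Measurable fun p : X × (ℕ → X) => consSeq p.1 p.2 := by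
  refine measurable_pi_lambda _ fun n => ?_
  cases n with
  | zero => exact measurable_fst
  | succ n => exact (measurable_pi_apply n).comp measurable_snd

/-- A product measure on sequences is determined by its values on finite boxes. The index set of a
box need not be an initial segment, so it is filled up with full factors, which do not change the
product. -/
theorem map_consSeq {X : Type*} [MeasurableSpace X] (ν : Measure X) [IsProbabilityMeasure ν] :
    (ν.prod (Measure.infinitePi fun _ : ℕ => ν)).map (fun p => consSeq p.1 p.2) =
      Measure.infinitePi fun _ : ℕ => ν := by
  refine Measure.eq_infinitePi _ fun s t ht => ?_
  rw [Measure.map_apply measurable_consSeq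
    (MeasurableSet.pi s.countable_toSet fun i _ => ht i)]
  set r : Finset ℕ := Finset.range (s.sup id) with hr
  have hs : ∀ n, n + 1 ∈ s → n ∈ r := fun n hn =>
    Finset.mem_range.2 (Nat.lt_of_succ_le (Finset.le_sup (f := id) hn))
  classical
  set t' : ℕ → Set X := fun n => if n ∈ s then t n else Set.univ with ht'
  have hm : ∀ i, MeasurableSet (t' i) := fun i => by
    by_cases h : i ∈ s <;> simp [ht', h, ht i]
  have hset : (fun p : X × (ℕ → X) => consSeq p.1 p.2) ⁻¹' (Set.pi s t) =
      t' 0 ×ˢ Set.pi r fun n => t' (n + 1) := by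
    ext ⟨a, q⟩
    simp only [Set.mem_preimage, Set.mem_pi, SetLike.mem_coe, Set.mem_prod, ht']
    constructor
    · intro h
      refine ⟨?_, fun n _ => ?_⟩
      · split_ifs with h0
        · exact h 0 h0
        · trivial
      · split_ifs with h0
        · exact h (n + 1) h0
        · trivial
    · rintro ⟨h0, h1⟩ n hn
      cases n with
      | zero => simpa [hn] using h0
      | succ n => simpa [hn] using h1 n (hs n hn)
  rw [hset, Measure.prod_prod, Measure.infinitePi_pi _ fun i _ => hm (i + 1)]
  have : ∏ i ∈ s, ν (t i) = ∏ i ∈ Finset.range (s.sup id + 1), ν (t' i) := by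
    rw [← Finset.prod_subset (s₁ := s) (f := fun i => ν (t' i))]
    · exact Finset.prod_congr rfl fun i hi => by simp [ht', hi]
    · exact fun i hi => Finset.mem_range.2 (Nat.lt_succ_of_le (Finset.le_sup (f := id) hi))
    · intro i _ hi
      simp [ht', hi]
  rw [this, Finset.prod_range_succ']
  rw [mul_comm]

theorem lintegral_consSeq {X : Type*} [MeasurableSpace X] (ν : Measure X)
    [IsProbabilityMeasure ν] {f : (ℕ → X) → ℝ≥0∞} (hf : Measurable f) :
    ∫⁻ ω, f ω ∂(Measure.infinitePi fun _ : ℕ => ν) =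
      ∫⁻ a, ∫⁻ s, f (consSeq a s) ∂(Measure.infinitePi fun _ : ℕ => ν) ∂ν := by
  conv_lhs => rw [← map_consSeq ν]
  rw [lintegral_map hf measurable_consSeq,
    lintegral_prod (fun p : X × (ℕ → X) => f (consSeq p.1 p.2))
      (hf.comp measurable_consSeq).aemeasurable]

/-! ### Ring times and the number of rings before a given time -/

theorem ringTime_succ (g : ℕ → ℝ) (k : ℕ) :
    ringTime g (k + 1) = g 0 + ringTime (fun l => g (l + 1)) k := by
  simp [ringTime, Finset.sum_range_succ', add_comm]

theorem measurable_ringTime {X : Type*} [MeasurableSpace X] {φ : X → ℝ} (hφ : Measurable φ)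
    (k : ℕ) : Measurable fun ω : ℕ → X => ringTime (fun l => φ (ω l)) k :=
  Finset.measurable_sum _ fun l _ => hφ.comp (measurable_pi_apply l)

/-- The waiting times are such that ring times increase strictly and to infinity. -/
def GoodGaps (g : ℕ → ℝ) : Prop := (∀ k, 0 < g k) ∧ ∀ t, ∃ k, t ≤ ringTime g (k + 1)

theorem GoodGaps.tail {g : ℕ → ℝ} (h : GoodGaps g) : GoodGaps fun l => g (l + 1) := by
  refine ⟨fun k => h.1 _, fun t => ?_⟩
  obtain ⟨k, hk⟩ := h.2 (t + g 0)
  refine ⟨k, ?_⟩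
  rw [ringTime_succ] at hk
  have : ringTime (fun l => g (l + 1)) (k + 1) =
      ringTime (fun l => g (l + 1)) k + g (k + 1) := Finset.sum_range_succ _ _
  have := h.1 (k + 1)
  linarith

theorem ringsBefore_eq_zero {g : ℕ → ℝ} {t : ℝ} (h : t ≤ g 0) : ringsBefore g t = 0 := by
  refine Nat.sInf_eq_zero.2 (Or.inl ?_)
  simpa [ringTime] using h

theorem ringsBefore_succ {g : ℕ → ℝ} (hg : GoodGaps g) {t : ℝ} (h : g 0 < t) :
    ringsBefore g t = ringsBefore (fun l => g (l + 1)) (t - g 0) + 1 := by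
  have hset : {k : ℕ | t - g 0 ≤ ringTime (fun l => g (l + 1)) (k + 1)} =
      {k : ℕ | k + 1 ∈ {k : ℕ | t ≤ ringTime g (k + 1)}} := by
    ext k
    simp only [Set.mem_ofPred_eq]
    rw [ringTime_succ g]
    constructor <;> intro h <;> linarith
  -- The infimum of the empty set is `0` in `ℕ`, so both reasons for a zero infimum have to be
  -- excluded; `GoodGaps` excludes emptiness.
  have h1 : 1 ≤ sInf {k : ℕ | t ≤ ringTime g (k + 1)} := by
    refine Nat.one_le_iff_ne_zero.2 fun h0 => ?_
    rcases Nat.sInf_eq_zero.1 h0 with h0 | h0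
    · simp [ringTime] at h0
      linarith
    · obtain ⟨k, hk⟩ := hg.2 t
      exact (h0 ▸ hk : k ∈ (∅ : Set ℕ)).elim
  unfold ringsBefore
  rw [hset]
  exact (Nat.sInf_add h1).symm

/-- With `S n` the `n`-th ring time, independence gives `E exp(-S n) = ρ ^ n`, where `ρ < 1` because
the gaps are positive. So `⨅ n, exp(-S n)` has expectation zero and vanishes almost surely, that is,
`S n` is unbounded. -/
theorem ae_goodGaps {X : Type*} [MeasurableSpace X] (ν : Measure X) [IsProbabilityMeasure ν]
    {φ : X → ℝ} (hφ : Measurable φ) (hpos : ∀ᵐ x ∂ν, 0 < φ x) :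
    ∀ᵐ ω ∂(Measure.infinitePi fun _ : ℕ => ν), GoodGaps fun l => φ (ω l) := by
  have h1 : ∀ᵐ ω ∂(Measure.infinitePi fun _ : ℕ => ν), ∀ k, 0 < φ (ω k) :=
    ae_all_iff.2 fun k =>
      (measurePreserving_eval_infinitePi (fun _ : ℕ => ν) k).quasiMeasurePreserving.ae hpos
  set ρ := ∫⁻ x, ENNReal.ofReal (Real.exp (-φ x)) ∂ν with hρ
  have hmφ : Measurable fun x => ENNReal.ofReal (Real.exp (-φ x)) := by fun_prop
  have hρ1 : ρ < 1 := by
    have : ρ < ∫⁻ _, 1 ∂ν := by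
      refine lintegral_strict_mono (IsProbabilityMeasure.ne_zero ν) aemeasurable_const ?_ ?_
      · have : ρ ≤ ∫⁻ _, 1 ∂ν := lintegral_mono_ae (by
          filter_upwards [hpos] with x hx
          rw [← ENNReal.ofReal_one]
          exact ENNReal.ofReal_le_ofReal (Real.exp_le_one_iff.2 (by linarith)))
        refine ne_of_lt (lt_of_le_of_lt this ?_)
        simp
      · filter_upwards [hpos] with x hx
        rw [← ENNReal.ofReal_one]
        exact (ENNReal.ofReal_lt_ofReal_iff one_pos).2 (by rw [Real.exp_lt_one_iff]; linarith)
    simpa using this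
  have hF : ∀ n, ∫⁻ ω, ENNReal.ofReal (Real.exp (-ringTime (fun l => φ (ω l)) n))
      ∂(Measure.infinitePi fun _ : ℕ => ν) = ρ ^ n := by
    have hmeas : ∀ n, Measurable fun ω : ℕ → X =>
        ENNReal.ofReal (Real.exp (-ringTime (fun l => φ (ω l)) n)) := fun n =>
      (Real.measurable_exp.comp (measurable_ringTime hφ n).neg).ennreal_ofReal
    intro n
    induction n with
    | zero => simp [ringTime]
    | succ n ih =>
      rw [lintegral_consSeq ν (hmeas _)]
      have : ∀ a : X, ∫⁻ s, ENNReal.ofReal (Real.exp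
          (-ringTime (fun l => φ (consSeq a s l)) (n + 1)))
          ∂(Measure.infinitePi fun _ : ℕ => ν) =
          ENNReal.ofReal (Real.exp (-φ a)) * ρ ^ n := fun a => by
        rw [← ih, ← lintegral_const_mul _ (hmeas n)]
        refine lintegral_congr fun s => ?_
        rw [ringTime_succ, ← ENNReal.ofReal_mul (Real.exp_pos _).le, ← Real.exp_add, neg_add]
        rfl
      simp_rw [this]
      rw [lintegral_mul_const _ hmφ, pow_succ, mul_comm]
  have hG : ∫⁻ ω, ⨅ n, ENNReal.ofReal (Real.exp (-ringTime (fun l => φ (ω l)) n))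
      ∂(Measure.infinitePi fun _ : ℕ => ν) = 0 := by
    refine le_antisymm ?_ zero_le
    refine ge_of_tendsto' (ENNReal.tendsto_pow_atTop_nhds_zero_of_lt_one hρ1) fun n => ?_
    rw [← hF n]
    exact lintegral_mono fun ω => iInf_le _ n
  have hmeas : Measurable fun ω : ℕ → X =>
      ⨅ n, ENNReal.ofReal (Real.exp (-ringTime (fun l => φ (ω l)) n)) :=
    Measurable.iInf fun n =>
      (Real.measurable_exp.comp (measurable_ringTime hφ n).neg).ennreal_ofReal
  have h2 := (lintegral_eq_zero_iff hmeas).1 hG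
  filter_upwards [h1, h2] with ω hω1 hω2
  refine ⟨hω1, fun t => ?_⟩
  have hlt : (⨅ n, ENNReal.ofReal (Real.exp (-ringTime (fun l => φ (ω l)) n))) <
      ENNReal.ofReal (Real.exp (-t)) := by
    rw [hω2]
    exact ENNReal.ofReal_pos.2 (Real.exp_pos _)
  obtain ⟨n, hn⟩ := iInf_lt_iff.1 hlt
  rw [ENNReal.ofReal_lt_ofReal_iff (Real.exp_pos _), Real.exp_lt_exp] at hn
  refine ⟨n, ?_⟩
  have : ringTime (fun l => φ (ω l)) (n + 1) = ringTime (fun l => φ (ω l)) n + φ (ω n) :=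
    Finset.sum_range_succ _ _
  have := hω1 n
  linarith

/-! ### Exponential waiting times -/

theorem expMeasure_eq (r : ℝ) : ProbabilityTheory.expMeasure r =
    volume.withDensity (ProbabilityTheory.exponentialPDF r) := rfl

theorem measurable_exponentialPDF (r : ℝ) : Measurable (ProbabilityTheory.exponentialPDF r) :=
  (ProbabilityTheory.measurable_exponentialPDFReal r).ennreal_ofReal

theorem lintegral_expMeasure (r : ℝ) {f : ℝ → ℝ≥0∞} (hf : Measurable f) :
    ∫⁻ x, f x ∂(ProbabilityTheory.expMeasure r) =
      ∫⁻ x, ProbabilityTheory.exponentialPDF r x * f x := by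
  rw [expMeasure_eq, lintegral_withDensity_eq_lintegral_mul _ (measurable_exponentialPDF r) hf]
  rfl

theorem expMeasure_ae_pos (r : ℝ) : ∀ᵐ x ∂(ProbabilityTheory.expMeasure r), 0 < x := by
  rw [expMeasure_eq, ae_withDensity_iff (measurable_exponentialPDF r)]
  filter_upwards [Measure.ae_ne volume (0 : ℝ)] with x hx h
  by_contra hlt
  exact h (ProbabilityTheory.exponentialPDF_of_neg (lt_of_le_of_ne (not_lt.1 hlt) hx))

/-- The memoryless property: the smaller one of two independent exponential variables, and
the remaining waiting time for the other one. -/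
theorem lintegral_expMeasure_lt {r : ℝ} (hr : 0 < r) {f : ℝ → ℝ → ℝ≥0∞}
    (hf : Measurable (Function.uncurry f)) :
    ∫⁻ x, ∫⁻ y, (if x < y then f x (y - x) else 0) ∂(ProbabilityTheory.expMeasure r)
        ∂(ProbabilityTheory.expMeasure r) =
      2⁻¹ * ∫⁻ x, ∫⁻ d, f x d ∂(ProbabilityTheory.expMeasure r)
        ∂(ProbabilityTheory.expMeasure (2 * r)) := by
  have := ProbabilityTheory.isProbabilityMeasure_expMeasure hr
  have hf' : Measurable fun p : ℝ × ℝ => if p.1 < p.2 then f p.1 (p.2 - p.1) else 0 :=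
    Measurable.ite (measurableSet_lt measurable_fst measurable_snd)
      (hf.comp (measurable_fst.prodMk (measurable_snd.sub measurable_fst))) measurable_const
  have hI : Measurable fun x => ∫⁻ d, f x d ∂(ProbabilityTheory.expMeasure r) :=
    Measurable.lintegral_prod_right' hf
  have hJ : Measurable fun x => ∫⁻ y, (if x < y then f x (y - x) else 0)
      ∂(ProbabilityTheory.expMeasure r) := Measurable.lintegral_prod_right' hf'
  rw [lintegral_expMeasure r hJ, lintegral_expMeasure (2 * r) hI,
    ← lintegral_const_mul _ (by exact (measurable_exponentialPDF _).mul hI)]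
  refine lintegral_congr fun x => ?_
  rcases lt_or_ge x 0 with hx | hx
  · rw [ProbabilityTheory.exponentialPDF_of_neg hx, ProbabilityTheory.exponentialPDF_of_neg hx]
    simp
  have hfx : Measurable (f x) := hf.of_uncurry_left
  -- Substituting `y = x + d` splits the density as `exp(-r y) = exp(-r x) exp(-r d)`.
  have hin : ∫⁻ y, (if x < y then f x (y - x) else 0) ∂(ProbabilityTheory.expMeasure r) =
      ENNReal.ofReal (Real.exp (-(r * x))) * ∫⁻ d, f x d ∂(ProbabilityTheory.expMeasure r) := by
    rw [lintegral_expMeasure r hfx, lintegral_expMeasure r (f := fun y => if x < y then f x (y - x) else 0)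
        (hf'.comp measurable_prodMk_left),
      ← lintegral_const_mul _ (by exact (measurable_exponentialPDF _).mul hfx),
      ← lintegral_sub_right_eq_self (fun d => ENNReal.ofReal (Real.exp (-(r * x))) *
        (ProbabilityTheory.exponentialPDF r d * f x d)) x]
    refine lintegral_congr_ae ?_
    filter_upwards [Measure.ae_ne volume x] with y hy
    rcases lt_or_gt_of_ne hy with h | h
    · rw [if_neg (not_lt.2 h.le),
        ProbabilityTheory.exponentialPDF_of_neg (x := y - x) (by linarith)]
      simp
    · rw [if_pos h, ProbabilityTheory.exponentialPDF_of_nonneg (x := y) (by linarith),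
        ProbabilityTheory.exponentialPDF_of_nonneg (x := y - x) (by linarith), ← mul_assoc,
        ← ENNReal.ofReal_mul (Real.exp_pos _).le]
      congr 2
      rw [mul_left_comm, ← Real.exp_add]
      ring_nf
  rw [hin, ProbabilityTheory.exponentialPDF_of_nonneg hx,
    ProbabilityTheory.exponentialPDF_of_nonneg hx, ← mul_assoc, ← mul_assoc]
  congr 1
  -- What remains is `r exp(-r x) · exp(-r x) = 1/2 · (2r) exp(-2r x)`, the source of both the rate
  -- `2 * r` and the factor `2⁻¹`.
  rw [← ENNReal.ofReal_mul (by positivity)]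
  have h2 : (2⁻¹ : ℝ≥0∞) = ENNReal.ofReal 2⁻¹ := by
    rw [ENNReal.ofReal_inv_of_pos two_pos]; simp
  rw [h2, ← ENNReal.ofReal_mul (by positivity)]
  congr 1
  rw [mul_assoc r, ← Real.exp_add]
  ring_nf

/-! ### Expectations with respect to discrete laws -/

/-- The expectation of `f` under the discrete law `p`. -/
def pexp {α : Type*} (p : PMF α) (f : α → ℝ≥0∞) : ℝ≥0∞ := ∑' x, p x * f x

theorem pexp_bind {α β : Type*} (p : PMF α) (q : α → PMF β) (f : β → ℝ≥0∞) :
    pexp (p.bind q) f = pexp p fun x => pexp (q x) f := by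
  unfold pexp
  simp only [PMF.bind_apply, ← ENNReal.tsum_mul_right, ← ENNReal.tsum_mul_left]
  rw [ENNReal.tsum_comm]
  simp only [mul_assoc]

theorem pexp_pure {α : Type*} (x : α) (f : α → ℝ≥0∞) : pexp (PMF.pure x) f = f x := by
  unfold pexp
  rw [tsum_eq_single x]
  · simp
  · intro y hy
    simp [PMF.pure_apply, hy]

theorem pexp_map {α β : Type*} (p : PMF α) (g : α → β) (f : β → ℝ≥0∞) :
    pexp (p.map g) f = pexp p (f ∘ g) := by
  rw [← PMF.bind_pure_comp, pexp_bind]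
  simp only [Function.comp_apply, pexp_pure]
  rfl

theorem pexp_mono {α : Type*} {p : PMF α} {f g : α → ℝ≥0∞}
    (h : ∀ x ∈ p.support, f x ≤ g x) : pexp p f ≤ pexp p g := by
  refine ENNReal.tsum_le_tsum fun x => ?_
  by_cases hx : p x = 0
  · simp [hx]
  · gcongr
    exact h x hx

theorem pexp_congr {α : Type*} {p : PMF α} {f g : α → ℝ≥0∞}
    (h : ∀ x ∈ p.support, f x = g x) : pexp p f = pexp p g :=
  le_antisymm (pexp_mono fun x hx => (h x hx).le) (pexp_mono fun x hx => (h x hx).ge)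

theorem pexp_const {α : Type*} (p : PMF α) (c : ℝ≥0∞) : pexp p (fun _ => c) = c := by
  unfold pexp
  rw [ENNReal.tsum_mul_right, p.tsum_coe, one_mul]

theorem pexp_add {α : Type*} (p : PMF α) (f g : α → ℝ≥0∞) :
    pexp p (fun x => f x + g x) = pexp p f + pexp p g := by
  unfold pexp
  simp only [mul_add]
  exact ENNReal.tsum_add

theorem lintegral_toMeasure {α : Type*} [MeasurableSpace α] [MeasurableSingletonClass α]
    [Countable α] (p : PMF α) (f : α → ℝ≥0∞) : ∫⁻ x, f x ∂p.toMeasure = pexp p f := by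
  rw [lintegral_countable']
  unfold pexp
  refine tsum_congr fun x => ?_
  rw [PMF.toMeasure_apply_singleton _ _ (measurableSet_singleton x), mul_comm]

/-- Comparison of two draws through a map between their first stages. -/
theorem bind_map_congr {α α' β : Type*} {p : PMF α} {q : PMF α'} {g : α → α'} (h : q = p.map g)
    {F : α → PMF β} {F' : α' → PMF β} (hF : ∀ x ∈ p.support, F' (g x) = F x) :
    q.bind F' = p.bind F := by
  rw [h, PMF.bind_map]
  ext y
  rw [PMF.bind_apply, PMF.bind_apply]
  refine tsum_congr fun x => ?_
  by_cases hx : p x = 0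
  · simp [hx]
  · rw [Function.comp_apply, hF x hx]

end Chameleon

namespace Chameleon

/-! ### The beta-binomial law -/

theorem beta_comm (x y : ℝ) : ProbabilityTheory.beta x y = ProbabilityTheory.beta y x := by
  unfold ProbabilityTheory.beta
  rw [mul_comm, add_comm]

theorem beta_succ_left {x y : ℝ} (hx : 0 < x) (hy : 0 < y) :
    ProbabilityTheory.beta (x + 1) y = x / (x + y) * ProbabilityTheory.beta x y := by
  unfold ProbabilityTheory.beta
  rw [Real.Gamma_add_one hx.ne', show x + 1 + y = x + y + 1 by ring,
    Real.Gamma_add_one (by positivity)]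
  have := (Real.Gamma_pos_of_pos (add_pos hx hy)).ne'
  field_simp

theorem beta_succ_right {x y : ℝ} (hx : 0 < x) (hy : 0 < y) :
    ProbabilityTheory.beta x (y + 1) = y / (x + y) * ProbabilityTheory.beta x y := by
  rw [beta_comm, beta_succ_left hy hx, beta_comm y x, add_comm y x]

/-- Pascal's rule splits the sum for `N + 1` into those for `N` with parameters `(x, y + 1)` and `(x
+ 1, y)`, and `B(x, y + 1) + B(x + 1, y) = B(x, y)`. -/
theorem sum_choose_mul_beta (N : ℕ) {x y : ℝ} (hx : 0 < x) (hy : 0 < y) :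
    ∑ k ∈ Finset.range (N + 1),
      (N.choose k : ℝ) * ProbabilityTheory.beta (k + x) ((N - k : ℕ) + y) =
      ProbabilityTheory.beta x y := by
  induction N generalizing x y with
  | zero => simp
  | succ N ih =>
    rw [Finset.sum_choose_succ_mul (fun k l => ProbabilityTheory.beta ((k : ℝ) + x) ((l : ℝ) + y))]
    have h1 := ih hx (show 0 < y + 1 by positivity)
    have h2 := ih (show 0 < x + 1 by positivity) hy
    have e1 : ∀ k ∈ Finset.range (N + 1), (N.choose k : ℝ) *
        ProbabilityTheory.beta (k + x) ((N + 1 - k : ℕ) + y) = (N.choose k : ℝ) *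
        ProbabilityTheory.beta (k + x) ((N - k : ℕ) + (y + 1)) := fun k hk => by
      have : k ≤ N := Nat.lt_succ_iff.1 (Finset.mem_range.1 hk)
      rw [Nat.succ_sub this]
      push_cast
      ring_nf
    have e2 : ∀ k ∈ Finset.range (N + 1), (N.choose k : ℝ) *
        ProbabilityTheory.beta ((k + 1 : ℕ) + x) ((N - k : ℕ) + y) = (N.choose k : ℝ) *
        ProbabilityTheory.beta (k + (x + 1)) ((N - k : ℕ) + y) := fun k _ => by
      push_cast
      ring_nf
    rw [Finset.sum_congr rfl e1, Finset.sum_congr rfl e2, h1, h2, beta_succ_left hx hy,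
      beta_succ_right hx hy]
    have : x + y ≠ 0 := by positivity
    field_simp
    ring

theorem betaBin_pos {s : ℝ} (hs : 0 < s) {N k : ℕ} (hk : k ≤ N) : 0 < betaBin s N k := by
  unfold betaBin
  have h1 : (0 : ℝ) < N.choose k := by exact_mod_cast Nat.choose_pos hk
  have h2 := ProbabilityTheory.beta_pos (α := k + s) (β := (N - k : ℕ) + s)
    (by positivity) (by positivity)
  have h3 := ProbabilityTheory.beta_pos hs hs
  positivity

theorem sum_betaBin {s : ℝ} (hs : 0 < s) (N : ℕ) :
    ∑ k ∈ Finset.range (N + 1), betaBin s N k = 1 := by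
  unfold betaBin
  rw [← Finset.sum_div, sum_choose_mul_beta N hs hs]
  exact div_self (ProbabilityTheory.beta_pos hs hs).ne'

theorem betaBin_symm (s : ℝ) {N k : ℕ} (hk : k ≤ N) : betaBin s N (N - k) = betaBin s N k := by
  unfold betaBin
  rw [Nat.choose_symm hk, Nat.sub_sub_self hk, beta_comm]

/-- The probability that the marked particle is the one on the vertex with `k + 1` particles. -/
theorem betaBin_succ_div {s : ℝ} (hs : 0 < s) {N k : ℕ} (hk : k ≤ N) :
    ((k : ℝ) + 1) / ((N : ℝ) + 1) * (betaBin s (N + 1) (k + 1) / betaBin s N k) =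
      (k + s) / (N + 2 * s) := by
  obtain ⟨l, rfl⟩ := Nat.exists_eq_add_of_le hk
  have hB := ProbabilityTheory.beta_pos (α := k + s) (β := l + s) (by positivity) (by positivity)
  have hs' := ProbabilityTheory.beta_pos hs hs
  have hc : (0 : ℝ) < (k + l).choose k := by exact_mod_cast Nat.choose_pos hk
  have hcs : ((k + l + 1 : ℕ) : ℝ) * (k + l).choose k =
      (k + l + 1).choose (k + 1) * ((k + 1 : ℕ) : ℝ) := by
    exact_mod_cast Nat.add_one_mul_choose_eq (k + l) k
  unfold betaBin
  rw [show k + l + 1 - (k + 1) = l by omega, show k + l - k = l by omega,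
    show ((k + 1 : ℕ) : ℝ) + s = k + s + 1 by push_cast; ring,
    beta_succ_left (by positivity) (by positivity)]
  push_cast at hcs ⊢
  have h1 : (k : ℝ) + s + (l + s) ≠ 0 := by positivity
  have h2 : (k : ℝ) + l + 2 * s ≠ 0 := by positivity
  have h3 : (k : ℝ) + l + 1 ≠ 0 := by positivity
  field_simp
  linear_combination -(k + l + (s + s)) * hcs

theorem betaBin_two_one {s : ℝ} (hs : 0 < s) : betaBin s 2 1 = s / (1 + 2 * s) := by
  have hs' := ProbabilityTheory.beta_pos hs hs
  unfold betaBin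
  rw [show 2 - 1 = 1 from rfl, show Nat.choose 2 1 = 2 from rfl]
  rw [show ((1 : ℕ) : ℝ) + s = s + 1 by push_cast; ring,
    beta_succ_left hs (by positivity), beta_succ_right hs hs]
  push_cast
  field_simp
  ring

/-! ### The split produced by a uniform variable -/

theorem Earlier.trans {N i j k : ℕ} (h : Earlier N i j) (h' : Earlier N j k) :
    Earlier N i k := by
  unfold Earlier at *
  omega

theorem earlier_irrefl (N i : ℕ) : ¬ Earlier N i i := by
  unfold Earlier
  omega

theorem earlier_trichotomy {N i j : ℕ} (h : i ≠ j) : Earlier N i j ∨ Earlier N j i := by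
  unfold Earlier
  omega

/-- The left side sums over an initial segment of the order `Earlier`, end included. Every bound on
cumulative probabilities comes from an inclusion of such a segment in some `S`. -/
theorem cumBefore_add_le_sum {s : ℝ} (hs : 0 < s) {N k : ℕ} (hk : k ≤ N) {S : Finset ℕ}
    (hS : S ⊆ Finset.range (N + 1)) (hkS : k ∈ S) (h : ∀ i ≤ N, Earlier N i k → i ∈ S) :
    cumBefore s N k + betaBin s N k ≤ ∑ i ∈ S, betaBin s N i := by
  classical
  unfold cumBefore
  rw [add_comm, ← Finset.sum_insert (by simp [earlier_irrefl])]
  refine Finset.sum_le_sum_of_subset_of_nonneg ?_ fun i hi _ =>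
    (betaBin_pos hs (Nat.lt_succ_iff.1 (Finset.mem_range.1 (hS hi)))).le
  intro i hi
  rcases Finset.mem_insert.1 hi with rfl | hi
  · exact hkS
  · obtain ⟨h1, h2⟩ := Finset.mem_filter.1 hi
    exact h i (Nat.lt_succ_iff.1 (Finset.mem_range.1 h1)) h2

theorem cumBefore_add_le_one {s : ℝ} (hs : 0 < s) {N k : ℕ} (hk : k ≤ N) :
    cumBefore s N k + betaBin s N k ≤ 1 := by
  rw [← sum_betaBin hs N]
  exact cumBefore_add_le_sum hs hk (Finset.Subset.refl _)
    (Finset.mem_range.2 (Nat.lt_succ_of_le hk))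
    fun i hi _ => Finset.mem_range.2 (Nat.lt_succ_of_le hi)

theorem cumBefore_nonneg {s : ℝ} (hs : 0 < s) (N k : ℕ) : 0 ≤ cumBefore s N k := by
  classical
  exact Finset.sum_nonneg fun _ hi =>
    (betaBin_pos hs (Nat.lt_succ_iff.1 (Finset.mem_range.1 (Finset.mem_filter.1 hi).1))).le

theorem cumBefore_add_le {s : ℝ} (hs : 0 < s) {N k l : ℕ} (hk : k ≤ N) (h : Earlier N k l) :
    cumBefore s N k + betaBin s N k ≤ cumBefore s N l := by
  classical
  refine cumBefore_add_le_sum hs hk (Finset.filter_subset _ _) ?_ fun i hi hik => ?_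
  · exact Finset.mem_filter.2 ⟨Finset.mem_range.2 (Nat.lt_succ_of_le hk), h⟩
  · exact Finset.mem_filter.2 ⟨Finset.mem_range.2 (Nat.lt_succ_of_le hi), hik.trans h⟩

theorem splitCount_le (s : ℝ) (N : ℕ) (u : ℝ) : splitCount s N u ≤ N := by
  classical
  unfold splitCount
  split_ifs with h
  · exact (Nat.find_spec h).1
  · exact Nat.zero_le _

/-- The values of the uniform variable for which `k` particles go to the first end-vertex. -/
def splitInterval (s : ℝ) (N k : ℕ) : Set I :=
  Subtype.val ⁻¹' Set.Ioc (cumBefore s N k) (cumBefore s N k + betaBin s N k)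

theorem splitInterval_disjoint {s : ℝ} (hs : 0 < s) {N k l : ℕ} (hk : k ≤ N) (hl : l ≤ N)
    (hkl : k ≠ l) : Disjoint (splitInterval s N k) (splitInterval s N l) := by
  refine Set.disjoint_left.2 fun u hu hu' => ?_
  simp only [splitInterval, Set.mem_preimage, Set.mem_Ioc] at hu hu'
  rcases earlier_trichotomy (N := N) hkl with h | h
  · have := cumBefore_add_le hs hk h
    linarith
  · have := cumBefore_add_le hs hl h
    linarith

theorem splitCount_eq {s : ℝ} (hs : 0 < s) {N k : ℕ} (hk : k ≤ N) {u : I}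
    (hu : u ∈ splitInterval s N k) : splitCount s N u = k := by
  classical
  have h : ∃ k, k ≤ N ∧ cumBefore s N k < u ∧ u ≤ cumBefore s N k + betaBin s N k :=
    ⟨k, hk, hu.1, hu.2⟩
  unfold splitCount
  rw [dif_pos h]
  have hf := Nat.find_spec h
  by_contra hne
  exact Set.disjoint_left.1 (splitInterval_disjoint hs hf.1 hk hne) hf.2 hu

theorem volume_splitInterval {s : ℝ} (hs : 0 < s) {N k : ℕ} (hk : k ≤ N) :
    volume (splitInterval s N k) = ENNReal.ofReal (betaBin s N k) := by
  have h0 := cumBefore_nonneg hs N k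
  have h1 := cumBefore_add_le_one hs hk
  rw [unitInterval.volume_apply]
  unfold splitInterval
  rw [Subtype.image_preimage_coe, Set.inter_eq_right.2, Real.volume_Ioc]
  · ring_nf
  · exact fun u hu => ⟨h0.trans hu.1.le, hu.2.trans h1⟩

/-- The intervals that belong to the different outcomes are disjoint and their lengths add up to
one, so they cover the unit interval up to a null set. The listing order matters only through its
being a strict total order. -/
theorem lintegral_splitCount {s : ℝ} (hs : 0 < s) (N : ℕ) (f : ℕ → ℝ≥0∞) :
    ∫⁻ u : I, f (splitCount s N u) =
      ∑ k ∈ Finset.range (N + 1), ENNReal.ofReal (betaBin s N k) * f k := by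
  have hmem : ∀ k ∈ Finset.range (N + 1), k ≤ N := fun k hk =>
    Nat.lt_succ_iff.1 (Finset.mem_range.1 hk)
  have hm : ∀ k, MeasurableSet (splitInterval s N k) := fun k =>
    measurable_subtype_coe measurableSet_Ioc
  have hd : Set.PairwiseDisjoint (Finset.range (N + 1) : Set ℕ) (splitInterval s N) :=
    fun k hk l hl hkl => splitInterval_disjoint hs (hmem k hk) (hmem l hl) hkl
  have htot : volume (⋃ k ∈ Finset.range (N + 1), splitInterval s N k) = 1 := by
    rw [measure_biUnion_finset hd fun k _ => hm k,
      Finset.sum_congr rfl fun k hk => volume_splitInterval hs (hmem k hk),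
      ← ENNReal.ofReal_sum_of_nonneg fun k hk => (betaBin_pos hs (hmem k hk)).le,
      sum_betaBin hs, ENNReal.ofReal_one]
  have hae : ∀ᵐ u : I, u ∈ ⋃ k ∈ Finset.range (N + 1), splitInterval s N k := by
    rw [← prob_compl_eq_zero_iff (Finset.measurableSet_biUnion _ fun k _ => hm k)] at htot
    exact htot
  rw [← setLIntegral_univ, setLIntegral_congr (t := ⋃ k ∈ Finset.range (N + 1),
    splitInterval s N k) (Filter.eventuallyEq_univ.2 hae).symm,
    lintegral_biUnion_finset hd fun k _ => hm k]
  refine Finset.sum_congr rfl fun k hk => ?_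
  rw [setLIntegral_congr_fun (hm k) (g := fun _ => f k)
    fun u hu => by simp only [splitCount_eq hs (hmem k hk) hu], setLIntegral_const,
    volume_splitInterval hs (hmem k hk), mul_comm]

/-- The uniform variable `u` and the split with both end-vertices exchanged. -/
theorem lintegral_splitCount_symm {s : ℝ} (hs : 0 < s) (N : ℕ) (f : ℕ → ℝ≥0∞) :
    ∫⁻ u : I, f (N - splitCount s N u) = ∫⁻ u : I, f (splitCount s N u) := by
  rw [lintegral_splitCount hs N fun k => f (N - k), lintegral_splitCount hs N f,
    ← Finset.sum_range_reflect]
  refine Finset.sum_congr rfl fun k hk => ?_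
  have hk : k ≤ N := Nat.lt_succ_iff.1 (Finset.mem_range.1 hk)
  rw [show N + 1 - 1 - k = N - k by omega, betaBin_symm s hk, Nat.sub_sub_self hk]

end Chameleon

namespace Chameleon

/-! ### Uniform subsets and coins -/

theorem uniformOfFinset_map {α β : Type*} [DecidableEq β] {s : Finset α} (hs : s.Nonempty)
    {t : Finset β} (ht : t.Nonempty) (f : α → β) (hf : Set.InjOn f s) (hst : s.image f = t) :
    PMF.uniformOfFinset t ht = (PMF.uniformOfFinset s hs).map f := by
  classical
  subst hst
  ext y
  rw [PMF.map_apply]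
  by_cases hy : y ∈ s.image f
  · obtain ⟨x, hx, rfl⟩ := Finset.mem_image.1 hy
    rw [PMF.uniformOfFinset_apply_of_mem _ hy, tsum_eq_single x]
    · rw [if_pos rfl, PMF.uniformOfFinset_apply_of_mem _ hx, Finset.card_image_of_injOn hf]
    · intro z hz
      split_ifs with h
      · refine PMF.uniformOfFinset_apply_of_notMem _ fun hzs => hz (hf hzs hx h.symm)
      · rfl
  · rw [PMF.uniformOfFinset_apply_of_notMem _ hy, eq_comm, ENNReal.tsum_eq_zero]
    intro z
    split_ifs with h
    · refine PMF.uniformOfFinset_apply_of_notMem _ fun hzs => hy ?_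
      exact Finset.mem_image.2 ⟨z, hzs, h.symm⟩
    · rfl

theorem mem_support_uniformSubset {K : ℕ} {S A : Finset (Token K)} {k : ℕ} :
    A ∈ (uniformSubset S k).support ↔ A ⊆ S ∧ A.card = min k S.card := by
  unfold uniformSubset
  rw [PMF.mem_support_uniformOfFinset_iff, Finset.mem_powersetCard]

theorem mem_support_halfSubset {K : ℕ} {S A : Finset (Token K)} :
    A ∈ (halfSubset S).support ↔ A ⊆ S := by
  have h : A ∈ (halfSubset S).support ↔ A ∈ S.powerset :=
    PMF.mem_support_uniformOfFinset_iff (Finset.powerset_nonempty S) A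
  rw [h, Finset.mem_powerset]

/-- Complementation is a bijection between the `j`-subsets and the `k`-subsets. Exchanging the
end-vertices turns each draw for one of them into the complementary draw. -/
theorem uniformSubset_compl {K : ℕ} {S : Finset (Token K)} {j k : ℕ} (h : S.card = j + k) :
    uniformSubset S k = (uniformSubset S j).map (S \ ·) := by
  unfold uniformSubset
  refine uniformOfFinset_map _ _ _ ?_ ?_
  · intro A hA A' hA' hAA
    have h1 := (Finset.mem_powersetCard.1 hA).1
    have h2 := (Finset.mem_powersetCard.1 hA').1
    rw [← Finset.sdiff_sdiff_eq_self h1, ← Finset.sdiff_sdiff_eq_self h2]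
    exact congrArg (S \ ·) hAA
  · ext A
    simp only [Finset.mem_image, Finset.mem_powersetCard]
    constructor
    · rintro ⟨A', ⟨h1, h2⟩, rfl⟩
      refine ⟨Finset.sdiff_subset, ?_⟩
      rw [Finset.card_sdiff_of_subset h1]
      omega
    · rintro ⟨h1, h2⟩
      refine ⟨S \ A, ⟨Finset.sdiff_subset, ?_⟩, Finset.sdiff_sdiff_eq_self h1⟩
      rw [Finset.card_sdiff_of_subset h1]
      omega

theorem halfSubset_compl {K : ℕ} (S : Finset (Token K)) :
    halfSubset S = (halfSubset S).map (S \ ·) := by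
  unfold halfSubset
  refine uniformOfFinset_map _ _ _ ?_ ?_
  · intro A hA A' hA' hAA
    have h1 := Finset.mem_powerset.1 hA
    have h2 := Finset.mem_powerset.1 hA'
    rw [← Finset.sdiff_sdiff_eq_self h1, ← Finset.sdiff_sdiff_eq_self h2]
    exact congrArg (S \ ·) hAA
  · ext A
    simp only [Finset.mem_image, Finset.mem_powerset]
    constructor
    · rintro ⟨A', h1, rfl⟩
      exact Finset.sdiff_subset
    · exact fun h1 => ⟨S \ A, Finset.sdiff_subset, Finset.sdiff_sdiff_eq_self h1⟩

/-- The probability that an element of `S` is not chosen. -/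
theorem pexp_uniformSubset_notMem {K : ℕ} {S : Finset (Token K)} {k : ℕ} (hk : k ≤ S.card)
    {t : Token K} (ht : t ∈ S) :
    pexp (uniformSubset S k) (fun A => if t ∈ A then 0 else 1) =
      ENNReal.ofReal (((S.card : ℝ) - k) / S.card) := by
  classical
  have hpos : 0 < S.card := Finset.card_pos.2 ⟨t, ht⟩
  have hne : (S.powersetCard (min k S.card)).Nonempty :=
    Finset.powersetCard_nonempty.2 (min_le_right _ _)
  have h1 : pexp (uniformSubset S k) (fun A => if t ∈ A then 0 else 1) =
      ∑ A ∈ (S.erase t).powersetCard k, ((S.card.choose k : ℕ) : ℝ≥0∞)⁻¹ := by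
    unfold pexp
    rw [tsum_eq_sum (s := (S.erase t).powersetCard k)]
    · refine Finset.sum_congr rfl fun A hA => ?_
      obtain ⟨hA1, hA2⟩ := Finset.mem_powersetCard.1 hA
      have htA : t ∉ A := fun h => (Finset.mem_erase.1 (hA1 h)).1 rfl
      simp only [if_neg htA, mul_one]
      unfold uniformSubset
      rw [PMF.uniformOfFinset_apply_of_mem, Finset.card_powersetCard, min_eq_left hk]
      exact Finset.mem_powersetCard.2
        ⟨hA1.trans (Finset.erase_subset _ _), by rw [hA2, min_eq_left hk]⟩
    · intro A hA
      by_cases htA : t ∈ A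
      · simp [htA]
      · simp only [if_neg htA, mul_one]
        unfold uniformSubset
        refine PMF.uniformOfFinset_apply_of_notMem _ fun h => hA ?_
        obtain ⟨hA1, hA2⟩ := Finset.mem_powersetCard.1 h
        rw [min_eq_left hk] at hA2
        exact Finset.mem_powersetCard.2 ⟨Finset.subset_erase.2 ⟨hA1, htA⟩, hA2⟩
  obtain ⟨n, hn⟩ := Nat.exists_eq_succ_of_ne_zero hpos.ne'
  rw [h1, Finset.sum_const, Finset.card_powersetCard, Finset.card_erase_of_mem ht, nsmul_eq_mul,
    hn, Nat.succ_eq_add_one, Nat.add_sub_cancel]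
  have hc : (0 : ℝ) < ((n + 1).choose k : ℝ) := by
    exact_mod_cast Nat.choose_pos (by omega)
  -- The probability is `C(n, k) / C(n + 1, k)`, and this identity evaluates the quotient.
  have hid : ((n.choose k : ℕ) : ℝ) * ((n + 1 : ℕ) : ℝ) =
      ((n + 1).choose k : ℝ) * (((n + 1 : ℕ) : ℝ) - k) := by
    rw [← Nat.cast_sub (by omega)]
    exact_mod_cast Nat.choose_mul_succ_eq n k
  rw [← ENNReal.ofReal_natCast, ← ENNReal.ofReal_natCast, ← ENNReal.ofReal_inv_of_pos hc,
    ← ENNReal.ofReal_mul (by positivity)]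
  congr 1
  have : ((n + 1 : ℕ) : ℝ) ≠ 0 := by positivity
  field_simp
  linarith

theorem coin_apply_true (p : ℝ) : coin p true = min (ENNReal.ofReal p) 1 := rfl

theorem coin_apply_false (p : ℝ) : coin p false = 1 - min (ENNReal.ofReal p) 1 := rfl

/-- Both biases are truncated to `[0, 1]`, so this holds for every real `p`, and no bounds on `θ`
are needed where it is used. -/
theorem coin_one_sub (p : ℝ) : coin (1 - p) = (coin p).map not := by
  have key : min (ENNReal.ofReal (1 - p)) 1 = 1 - min (ENNReal.ofReal p) 1 := by
    rcases le_total p 0 with h | h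
    · rw [ENNReal.ofReal_of_nonpos h, min_eq_right]
      · simp
      · rw [← ENNReal.ofReal_one]; exact ENNReal.ofReal_le_ofReal (by linarith)
    rcases le_total p 1 with h1 | h1
    · rw [min_eq_left, min_eq_left, ENNReal.ofReal_sub _ h, ENNReal.ofReal_one]
      · rw [← ENNReal.ofReal_one]; exact ENNReal.ofReal_le_ofReal (by linarith)
      · rw [← ENNReal.ofReal_one]; exact ENNReal.ofReal_le_ofReal (by linarith)
    · rw [ENNReal.ofReal_of_nonpos (by linarith), min_eq_right (a := ENNReal.ofReal p)]
      · simp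
      · rw [← ENNReal.ofReal_one]; exact ENNReal.ofReal_le_ofReal (by linarith)
  ext c
  rw [PMF.map_apply, tsum_fintype, Fintype.sum_bool]
  cases c
  · simp only [coin_apply_true, coin_apply_false, key]
    simp [ENNReal.sub_sub_cancel]
  · simp only [coin_apply_true, coin_apply_false, key]
    simp

/-! ### The end-vertices of an edge -/

section Ends

variable {V : Type*} [Fintype V] [LinearOrder V] {G : WeightedGraph V} (e : G.Edge)

theorem edge_eq : (e : Sym2 V) = s(v₁ e, v₂ e) := by
  obtain ⟨e, he⟩ := e
  induction e with | _ x y =>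
  simp only [v₁, v₂, Sym2.inf_mk, Sym2.sup_mk]
  rcases le_total x y with h | h
  · rw [inf_eq_left.2 h, sup_eq_right.2 h]
  · rw [inf_eq_right.2 h, sup_eq_left.2 h, Sym2.eq_swap]

theorem v₁_ne_v₂ : v₁ e ≠ v₂ e := by
  intro h
  have h1 := e.2
  rw [edge_eq e, SimpleGraph.mem_edgeSet] at h1
  exact h1.ne h

/-- The exchange of the end-vertices of an edge. -/
def swapV : V ≃ V := Equiv.swap (v₁ e) (v₂ e)

@[simp] theorem swapV_v₁ : swapV e (v₁ e) = v₂ e := Equiv.swap_apply_left _ _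

@[simp] theorem swapV_v₂ : swapV e (v₂ e) = v₁ e := Equiv.swap_apply_right _ _

theorem swapV_of_ne {z : V} (h1 : z ≠ v₁ e) (h2 : z ≠ v₂ e) : swapV e z = z :=
  Equiv.swap_apply_of_ne_of_ne h1 h2

theorem setEnds_v₁ (S : V → ℕ) (f g : ℕ) : setEnds e S f g (v₁ e) = f := by
  unfold setEnds
  rw [Function.update_of_ne (v₁_ne_v₂ e), Function.update_self]

theorem setEnds_v₂ (S : V → ℕ) (f g : ℕ) : setEnds e S f g (v₂ e) = g := by
  unfold setEnds
  rw [Function.update_self]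

theorem setEnds_of_ne (S : V → ℕ) (f g : ℕ) {z : V} (h1 : z ≠ v₁ e) (h2 : z ≠ v₂ e) :
    setEnds e S f g z = S z := by
  unfold setEnds
  rw [Function.update_of_ne h2, Function.update_of_ne h1]

theorem setEnds_comp_swapV (S : V → ℕ) (f g : ℕ) :
    setEnds e S f g ∘ swapV e = setEnds e S g f := by
  funext z
  rw [Function.comp_apply]
  by_cases h1 : z = v₁ e
  · subst h1; rw [swapV_v₁, setEnds_v₁, setEnds_v₂]
  by_cases h2 : z = v₂ e
  · subst h2; rw [swapV_v₂, setEnds_v₁, setEnds_v₂]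
  · rw [swapV_of_ne e h1 h2, setEnds_of_ne e _ _ _ h1 h2, setEnds_of_ne e _ _ _ h1 h2]

theorem sum_setEnds (S : V → ℕ) {f g : ℕ} (h : f + g = S (v₁ e) + S (v₂ e)) :
    ∑ z, setEnds e S f g z = ∑ z, S z := by
  have hsplit : ∀ F : V → ℕ, ∑ z, F z = F (v₁ e) + (F (v₂ e) +
      ∑ z ∈ (Finset.univ.erase (v₁ e)).erase (v₂ e), F z) := fun F => by
    rw [Finset.add_sum_erase _ F (Finset.mem_erase.2 ⟨(v₁_ne_v₂ e).symm, Finset.mem_univ _⟩),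
      Finset.add_sum_erase _ F (Finset.mem_univ _)]
  rw [hsplit, hsplit S, setEnds_v₁, setEnds_v₂, ← add_assoc, ← add_assoc, h]
  congr 1
  refine Finset.sum_congr rfl fun z hz => ?_
  simp only [Finset.mem_erase, Finset.mem_univ, and_true] at hz
  exact setEnds_of_ne e _ _ _ hz.2 hz.1

/-- `B'` arises from `B` through a movement of particles along `e`. -/
structure MovedAlong (B B' : V → ℕ) : Prop where
  sum : B' (v₁ e) + B' (v₂ e) = B (v₁ e) + B (v₂ e)
  off : ∀ z, z ≠ v₁ e → z ≠ v₂ e → B' z = B z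

theorem mabb_eq (s u : ℝ) (B : V → ℕ) : mabb s u e B =
    setEnds e B (splitCount s (B (v₁ e) + B (v₂ e)) u)
      (B (v₁ e) + B (v₂ e) - splitCount s (B (v₁ e) + B (v₂ e)) u) := rfl

theorem movedAlong_setEnds (B : V → ℕ) {k : ℕ} (hk : k ≤ B (v₁ e) + B (v₂ e)) :
    MovedAlong e B (setEnds e B k (B (v₁ e) + B (v₂ e) - k)) := by
  refine ⟨?_, fun z h1 h2 => setEnds_of_ne e _ _ _ h1 h2⟩
  rw [setEnds_v₁, setEnds_v₂]
  omega

theorem MovedAlong.swap {B B' : V → ℕ} (h : MovedAlong e B B') :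
    MovedAlong e B (B' ∘ swapV e) := by
  refine ⟨?_, fun z h1 h2 => ?_⟩
  · simp only [Function.comp_apply, swapV_v₁, swapV_v₂]
    rw [add_comm, h.sum]
  · rw [Function.comp_apply, swapV_of_ne e h1 h2, h.off z h1 h2]

theorem MovedAlong.sum_eq {B B' : V → ℕ} (h : MovedAlong e B B') : ∑ z, B' z = ∑ z, B z := by
  have : B' = setEnds e B (B' (v₁ e)) (B' (v₂ e)) := by
    funext z
    by_cases h1 : z = v₁ e
    · subst h1; rw [setEnds_v₁]
    by_cases h2 : z = v₂ e
    · subst h2; rw [setEnds_v₂]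
    · rw [setEnds_of_ne e _ _ _ h1 h2, h.off z h1 h2]
  rw [this, sum_setEnds e B h.sum]

theorem addOne_off (B : V → ℕ) {y z : V} (h : z ≠ y) : addOne B y z = B z :=
  Function.update_of_ne h _ _

theorem addOne_self (B : V → ℕ) (y : V) : addOne B y y = B y + 1 :=
  Function.update_self _ _ _

/-- The answer does not depend on the vertex `x` where the marked particle starts. With `s = b/a` it
is the quotient of `χ(B' v₁)` and `χ(B' v₁) + χ(B' v₂)`, so each end-vertex expects ink in
proportion to its capacity. -/
theorem markProb_eq {s : ℝ} (hs : 0 < s) {B B' : V → ℕ} (h : MovedAlong e B B') {x : V}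
    (hx : x = v₁ e ∨ x = v₂ e) :
    markProb s e B B' x (v₁ e) =
      (B' (v₁ e) + s) / ((B (v₁ e) : ℝ) + B (v₂ e) + 2 * s) := by
  have hne := v₁_ne_v₂ e
  have h1 : bbProb s e B B' = betaBin s (B (v₁ e) + B (v₂ e)) (B' (v₁ e)) := by
    unfold bbProb
    rw [if_pos ⟨h.off, h.sum⟩]
  have hsum : addOne B x (v₁ e) + addOne B x (v₂ e) = B (v₁ e) + B (v₂ e) + 1 := by
    rcases hx with rfl | rfl
    · rw [addOne_self, addOne_off _ hne.symm]; ring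
    · rw [addOne_self, addOne_off _ hne]; ring
  have h2 : bbProb s e (addOne B x) (addOne B' (v₁ e)) =
      betaBin s (B (v₁ e) + B (v₂ e) + 1) (B' (v₁ e) + 1) := by
    unfold bbProb
    rw [if_pos, hsum, addOne_self]
    refine ⟨fun z hz1 hz2 => ?_, ?_⟩
    · rw [addOne_off _ hz1, addOne_off, h.off z hz1 hz2]
      rcases hx with rfl | rfl <;> assumption
    · rw [hsum, addOne_self, addOne_off _ hne.symm, ← h.sum]; ring
  unfold markProb
  have := betaBin_succ_div hs (N := B (v₁ e) + B (v₂ e)) (k := B' (v₁ e))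
    (by rw [← h.sum]; omega)
  rw [h1, h2]
  push_cast at this
  exact this

end Ends

end Chameleon

namespace Chameleon

/-! ### Valid configurations -/

section Valid

variable {V : Type*} [Fintype V] [LinearOrder V] {K : ℕ}

open Classical in
/-- The number of labels on `z`. -/
def labelCount (L : Fin K → Option V) (z : V) : ℕ := (Finset.univ.filter fun i => L i = some z).card

/-- The configurations that occur in a round with `m - 1` black particles in which every red
particle is labelled. -/
structure State.Valid (a b m : ℕ) (x : State V K) : Prop where
  sumB : ∑ z, x.B z = m - 1
  le : ∀ z, x.R z + x.P z ≤ chi a b (x.B z)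
  red : ∀ z, labelCount x.LR z = x.R z
  white : ∀ z, labelCount x.LW z ≤ x.W a b z
  none_iff : ∀ i, x.LR i = none ↔ x.LW i = none

variable {G : WeightedGraph V} (e : G.Edge)

open Classical in
theorem card_filter_onEdge (L : Fin K → Option V) :
    (Finset.univ.filter (OnEdge e L)).card = labelCount L (v₁ e) + labelCount L (v₂ e) := by
  unfold labelCount
  rw [← Finset.card_union_of_disjoint]
  · congr 1
    ext i
    simp only [Finset.mem_union, Finset.mem_filter, ← and_or_left]
    rfl
  · refine Finset.disjoint_filter.2 fun i _ h1 h2 => v₁_ne_v₂ e ?_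
    exact Option.some_injective _ (h1.symm.trans h2)

theorem card_pool {L : Fin K → Option V} {S : V → ℕ}
    (h : ∀ z, labelCount L z ≤ S z) : (pool e L S).card = onEdge e S := by
  classical
  have h1 := h (v₁ e)
  have h2 := h (v₂ e)
  unfold pool
  rw [Finset.card_disjSum, Finset.card_range, card_filter_onEdge]
  unfold onEdge
  omega

theorem inl_mem_pool {L : Fin K → Option V} {S : V → ℕ} {i : Fin K} :
    Sum.inl i ∈ pool e L S ↔ OnEdge e L i := by
  classical
  unfold pool
  rw [Finset.inl_mem_disjSum, Finset.mem_filter]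
  simp

variable {a b m : ℕ} {x : State V K} {B' : V → ℕ}

theorem inl_mem_pairedReds {i : Fin K} :
    Sum.inl i ∈ pairedReds e x ↔ OnEdge e x.LR i ∧ OnEdge e x.LW i := by
  classical
  unfold pairedReds
  rw [Finset.inl_mem_disjSum, Finset.mem_filter]
  simp

theorem pairedReds_subset : pairedReds e x ⊆ pool e x.LR x.R := by
  classical
  intro t ht
  cases t with
  | inl i => exact (inl_mem_pool e).2 ((inl_mem_pairedReds e).1 ht).1
  | inr j => simp [pairedReds] at ht

/-- All red particles of the ringing edge. -/
def redPool (e : G.Edge) (x : State V K) : Finset (Token K) := pairedReds e x ∪ nonPairedReds e x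

theorem redPool_eq : redPool e x = pool e x.LR x.R :=
  Finset.union_sdiff_of_subset (pairedReds_subset e)

theorem State.Valid.card_redPool (hx : x.Valid a b m) :
    (redPool e x).card = onEdge e x.R := by
  rw [redPool_eq, card_pool e fun z => (hx.red z).le]

theorem card_pairedReds_add :
    (pairedReds e x).card + (nonPairedReds e x).card = (redPool e x).card := by
  rw [redPool_eq, nonPairedReds, Finset.card_sdiff_of_subset (pairedReds_subset e)]
  have := Finset.card_le_card (pairedReds_subset e (x := x))
  omega

theorem State.Valid.onEdge_W (hx : x.Valid a b m) (h : MovedAlong e x.B B') :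
    onEdge e (x.W a b) + onEdge e x.R + onEdge e x.P =
      chi a b (B' (v₁ e)) + chi a b (B' (v₂ e)) := by
  have h1 := hx.le (v₁ e)
  have h2 := hx.le (v₂ e)
  have h3 : chi a b (B' (v₁ e)) + chi a b (B' (v₂ e)) =
      chi a b (x.B (v₁ e)) + chi a b (x.B (v₂ e)) := by
    unfold chi
    have := congrArg (a * ·) h.sum
    simp only [mul_add] at this
    omega
  unfold onEdge State.W
  omega

/-! ### The value of `θ` -/

/-- In the variables `r` (red) and `q` (red plus pink) the bounds for both colours take the same
form, so that `θ` becomes a quotient of sums of one expression at `r` and at `q`. Both the exchange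
of `c₁` and `c₂` and the estimate of `θ` can be read off from it. -/
theorem theta_eq (ha : 0 < a) (hb : 0 < b) (h : MovedAlong e x.B B') {c₁ c₂ r q : ℝ}
    (h₁ : c₁ = chi a b (B' (v₁ e))) (h₂ : c₂ = chi a b (B' (v₂ e)))
    (hr : r = onEdge e x.R) (hq : q = onEdge e x.R + onEdge e x.P) :
    theta a b e x B' = (min c₁ r + min c₁ q - (r + q) * (c₁ / (c₁ + c₂))) /
      ((min c₁ r + min c₂ r - r) + (min c₁ q + min c₂ q - q)) := by
  have ha' : (0 : ℝ) < a := by exact_mod_cast ha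
  have hb' : (0 : ℝ) < b := by exact_mod_cast hb
  have hmean : meanInk a b e x B' = (r + q) / 2 * (c₁ / (c₁ + c₂)) := by
    unfold meanInk
    rw [markProb_eq e (div_pos hb' ha') h (Or.inl rfl),
      markProb_eq e (div_pos hb' ha') h (Or.inr rfl)]
    have hs : ((x.B (v₁ e) : ℝ) + x.B (v₂ e)) = B' (v₁ e) + B' (v₂ e) := by
      exact_mod_cast h.sum.symm
    rw [hs, h₁, h₂, hr, hq]
    unfold chi onEdge
    push_cast
    have : (B' (v₁ e) : ℝ) + B' (v₂ e) + 2 * (b / a) ≠ 0 := by positivity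
    have : (a : ℝ) * B' (v₁ e) + b + (a * B' (v₂ e) + b) ≠ 0 := by positivity
    field_simp
    ring
  -- Here `u = min c₁ r` and `u + u^P = min c₁ q`; below, likewise, `ℓ = r - min c₂ r` and `ℓ + ℓ^P
  -- = q - min c₂ q`.
  have hup : (upR a b e x B' (v₁ e) : ℝ) + (upP a b e x B' (v₁ e) : ℝ) / 2 =
      (min c₁ r + min c₁ q) / 2 := by
    have : 2 * upR a b e x B' (v₁ e) + upP a b e x B' (v₁ e) =
        min (chi a b (B' (v₁ e))) (onEdge e x.R) +
        min (chi a b (B' (v₁ e))) (onEdge e x.R + onEdge e x.P) := by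
      unfold upP upR
      omega
    have := congrArg (Nat.cast (R := ℝ)) this
    push_cast at this
    rw [h₁, hr, hq]
    linarith
  have hlow : (lowR a b e x B' (v₂ e) : ℝ) + (lowP a b e x B' (v₂ e) : ℝ) / 2 =
      (r + q) / 2 - (min c₂ r + min c₂ q) / 2 := by
    have : 2 * lowR a b e x B' (v₂ e) + lowP a b e x B' (v₂ e) +
        (min (chi a b (B' (v₂ e))) (onEdge e x.R) +
        min (chi a b (B' (v₂ e))) (onEdge e x.R + onEdge e x.P)) =
        2 * onEdge e x.R + onEdge e x.P := by
      unfold lowP lowR upR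
      omega
    have := congrArg (Nat.cast (R := ℝ)) this
    push_cast at this
    rw [h₂, hr, hq]
    linarith
  unfold theta
  rw [hmean, hup, hlow]
  rw [show (min c₁ r + min c₁ q) / 2 - (r + q) / 2 * (c₁ / (c₁ + c₂)) =
    (min c₁ r + min c₁ q - (r + q) * (c₁ / (c₁ + c₂))) / 2 by ring,
    show (min c₁ r + min c₁ q) / 2 - ((r + q) / 2 - (min c₂ r + min c₂ q) / 2) =
    ((min c₁ r + min c₂ r - r) + (min c₁ q + min c₂ q - q)) / 2 by ring,
    div_div_div_cancel_right₀ two_ne_zero]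

/-- This is the bound `min c₁ c₂ / (c₁ + c₂) ≤ θ` for a single colour class of size `t`, with
denominators cleared. Each side is linear on every piece cut out by the order of `c₁`, `c₂` and `t`.
-/
theorem min_mul_le {c₁ c₂ t : ℝ} (h₁ : 0 ≤ c₁) (h₂ : 0 ≤ c₂) (ht : 0 ≤ t) (htc : t ≤ c₁ + c₂) :
    min c₁ c₂ * (min c₁ t + min c₂ t - t) ≤ (c₁ + c₂) * min c₁ t - t * c₁ := by
  rcases le_total c₁ c₂ with h | h <;> rcases le_total c₁ t with h' | h' <;>
    rcases le_total c₂ t with h'' | h'' <;>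
    simp only [min_eq_left h, min_eq_right h, min_eq_left h', min_eq_right h', min_eq_left h'',
      min_eq_right h''] <;> nlinarith [mul_nonneg h₁ ht, mul_nonneg h₂ ht]

/-- Adding `min_mul_le` at `r` and at `q` bounds `θ` from below; with `c₁` and `c₂` exchanged, the
same sum bounds `1 - θ`. Positivity of the denominator excludes the case in which `θ` is a quotient
by zero. -/
theorem theta_bounds (ha : 0 < a) (hb : 0 < b) (h : MovedAlong e x.B B') {c₁ c₂ r q : ℝ}
    (h₁ : c₁ = chi a b (B' (v₁ e))) (h₂ : c₂ = chi a b (B' (v₂ e)))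
    (hr : r = onEdge e x.R) (hq : q = onEdge e x.R + onEdge e x.P)
    (hqc : q ≤ c₁ + c₂)
    (hpos : 0 < (min c₁ r + min c₂ r - r) + (min c₁ q + min c₂ q - q)) :
    min c₁ c₂ / (c₁ + c₂) ≤ theta a b e x B' ∧
      min c₁ c₂ / (c₁ + c₂) ≤ 1 - theta a b e x B' := by
  have hc₁ : 0 < c₁ := by
    rw [h₁]; unfold chi; push_cast
    have : (0 : ℝ) < b := by exact_mod_cast hb
    positivity
  have hc₂ : 0 < c₂ := by
    rw [h₂]; unfold chi; push_cast
    have : (0 : ℝ) < b := by exact_mod_cast hb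
    positivity
  have hr0 : 0 ≤ r := by rw [hr]; positivity
  have hrq : r ≤ q := by rw [hr, hq]; linarith [(onEdge e x.P).cast_nonneg (α := ℝ)]
  rw [theta_eq e ha hb h h₁ h₂ hr hq]
  have k1 := min_mul_le hc₁.le hc₂.le hr0 (hrq.trans hqc)
  have k2 := min_mul_le hc₁.le hc₂.le (hr0.trans hrq) hqc
  have k3 := min_mul_le hc₂.le hc₁.le hr0 (by linarith)
  have k4 := min_mul_le hc₂.le hc₁.le (hr0.trans hrq) (by linarith)
  rw [min_comm c₂ c₁] at k3 k4
  have hC : 0 < c₁ + c₂ := add_pos hc₁ hc₂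
  constructor
  · rw [div_le_div_iff₀ hC hpos]
    have : (r + q) * (c₁ / (c₁ + c₂)) * (c₁ + c₂) = (r + q) * c₁ := by
      field_simp
    nlinarith
  · rw [one_sub_div hpos.ne', div_le_div_iff₀ hC hpos]
    have : (r + q) * (c₁ / (c₁ + c₂)) * (c₁ + c₂) = (r + q) * c₁ := by
      field_simp
    nlinarith

end Valid

end Chameleon

namespace Chameleon

theorem bind_congr_support {α β : Type*} {p : PMF α} {F F' : α → PMF β}
    (hF : ∀ x ∈ p.support, F' x = F x) : p.bind F' = p.bind F :=
  bind_map_congr (g := id) (p.map_id).symm hF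

/-! ### The step of the process in stages -/

section Stages

variable {V : Type*} [Fintype V] [LinearOrder V] {K : ℕ} {G : WeightedGraph V}
  (a b : ℕ) (e : G.Edge) (x : State V K) (B' : V → ℕ)

open Classical in
/-- The labels that are lost when the red particles in `A` serve the lower bounds. -/
def pinkSet (A : Finset (Token K)) (fork : Bool) : Finset (Fin K) :=
  Finset.univ.filter fun i => fork = true ∧
    Sum.inl i ∈ ((pairedReds e x ∪ nonPairedReds e x) \ A) ∩ pairedReds e x

/-- The number of old pink particles put onto the first end-vertex. -/
def oldOnFst (k redV redW : ℕ) (c : Bool) : ℕ :=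
  max (onEdge e x.P + (redW + k) - chi a b (B' (v₂ e)))
    (min (if c = true then lowP a b e x B' (v₂ e) else upP a b e x B' (v₁ e))
      (chi a b (B' (v₁ e)) - (redV + k)))

/-- The new configuration when `k` pairs are pinkened and the particles in `onFst`, `oldV` old pink
particles and the white particles in `whiteOnV` are put onto the first end-vertex. -/
def outcome (pink : Finset (Fin K)) (onFst : Finset (Token K)) (oldV : ℕ)
    (whiteOnV : Finset (Token K)) : State V K where
  B := B'
  R := setEnds e x.R onFst.card (onEdge e x.R - pink.card - onFst.card)
  P := setEnds e x.P (pink.card + oldV) (pink.card + (onEdge e x.P - oldV))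
  LR := newLabels e x.LR pink onFst
  LW := newLabels e x.LW pink whiteOnV

/-- The white particles that do not become pink. -/
def whitesLeft (pink : Finset (Fin K)) : Finset (Token K) :=
  pool e x.LW (x.W a b) \ pink.disjSum ∅

/-- The law of the new configuration once the red particles have been placed. -/
def pinkWhiteLaw (pink : Finset (Fin K)) (onFst : Finset (Token K)) : PMF (State V K) :=
  (coin (theta a b e x B')).bind fun c =>
    (uniformSubset (whitesLeft a b e x pink) (chi a b (B' (v₁ e)) - (onFst.card + pink.card) -
      oldOnFst a b e x B' pink.card onFst.card
        (onEdge e x.R - pink.card - onFst.card) c)).map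
      (outcome e x B' pink onFst (oldOnFst a b e x B' pink.card onFst.card
        (onEdge e x.R - pink.card - onFst.card) c))

/-- The law of the red particles that go to the first end-vertex, beyond those in `A`. -/
def restLaw (A : Finset (Token K)) (fork : Bool) : PMF (Finset (Token K)) :=
  if fork = true then
    halfSubset (((pairedReds e x ∪ nonPairedReds e x) \ A) \ pairedReds e x)
  else if theta a b e x B' < 1 / 2 then PMF.pure ((pairedReds e x ∪ nonPairedReds e x) \ A)
  else PMF.pure ∅

/-- The law of the new configuration once the red particles that serve the lower
bounds have been chosen. -/
def afterLowLaw (A low : Finset (Token K)) : PMF (State V K) :=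
  (coin (2 * min (theta a b e x B') (1 - theta a b e x B'))).bind fun fork =>
    (restLaw a b e x B' A fork).bind fun restOnV =>
      pinkWhiteLaw a b e x B' (pinkSet e x A fork) (low ∪ restOnV)

theorem stepLaw_eq : stepLaw a b e x B' =
    (uniformSubset (nonPairedReds e x)
      (lowR a b e x B' (v₂ e) + lowR a b e x B' (v₁ e))).bind fun A₁ =>
    (uniformSubset (pairedReds e x)
      (lowR a b e x B' (v₂ e) + lowR a b e x B' (v₁ e) - (nonPairedReds e x).card)).bind fun A₂ =>
    (uniformSubset (A₁ ∪ A₂) (lowR a b e x B' (v₂ e))).bind fun low =>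
      afterLowLaw a b e x B' (A₁ ∪ A₂) low := rfl

end Stages

/-! ### Exchange of the end-vertices: admissible choices and single outcomes -/

section Symmetry

variable {V : Type*} [Fintype V] [LinearOrder V] {K : ℕ} {G : WeightedGraph V}
  {a b m : ℕ} (e : G.Edge) {x : State V K} {B' : V → ℕ}

/-- The red particles that remain and do not become pink. -/
def restFree (e : G.Edge) (x : State V K) (A : Finset (Token K)) (fork : Bool) :
    Finset (Token K) :=
  (redPool e x \ A) \ (pinkSet e x A fork).disjSum ∅

theorem pinkSet_false (A : Finset (Token K)) : pinkSet e x A false = ∅ := by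
  simp [pinkSet]

theorem pinkSet_disjSum (A : Finset (Token K)) :
    (pinkSet e x A true).disjSum ∅ = (redPool e x \ A) ∩ pairedReds e x := by
  ext t
  cases t with
  | inl i => simp [pinkSet, redPool]
  | inr j => simp [pairedReds]

theorem mem_pinkSet {A : Finset (Token K)} {fork : Bool} {i : Fin K} :
    i ∈ pinkSet e x A fork ↔
      fork = true ∧ Sum.inl i ∉ A ∧ OnEdge e x.LR i ∧ OnEdge e x.LW i := by
  unfold pinkSet
  simp only [Finset.mem_filter, Finset.mem_univ, true_and, Finset.mem_inter, Finset.mem_sdiff,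
    Finset.mem_union, inl_mem_pairedReds]
  tauto

theorem pinkSet_disjSum_subset (A : Finset (Token K)) (fork : Bool) :
    (pinkSet e x A fork).disjSum ∅ ⊆ redPool e x \ A := by
  cases fork with
  | false => simp [pinkSet_false]
  | true => rw [pinkSet_disjSum]; exact Finset.inter_subset_left

theorem restFree_false (A : Finset (Token K)) : restFree e x A false = redPool e x \ A := by
  simp [restFree, pinkSet_false]

theorem restFree_true (A : Finset (Token K)) :
    restFree e x A true = (redPool e x \ A) \ pairedReds e x := by
  rw [restFree, pinkSet_disjSum, Finset.sdiff_inter_self_left]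

theorem card_restFree (A : Finset (Token K)) (fork : Bool) :
    (restFree e x A fork).card + (pinkSet e x A fork).card = (redPool e x \ A).card := by
  have h := Finset.card_sdiff_of_subset (pinkSet_disjSum_subset e (x := x) A fork)
  have h' := Finset.card_le_card (pinkSet_disjSum_subset e (x := x) A fork)
  rw [Finset.card_disjSum, Finset.card_empty, add_zero] at h h'
  unfold restFree
  omega

theorem mem_support_restLaw {A : Finset (Token K)} {fork : Bool} {r : Finset (Token K)}
    (h : r ∈ (restLaw a b e x B' A fork).support) : r ⊆ restFree e x A fork := by
  cases fork with
  | true =>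
    rw [restFree_true]
    simp only [restLaw, if_true] at h
    exact mem_support_halfSubset.1 h
  | false =>
    rw [restFree_false]
    simp only [restLaw, Bool.false_eq_true, if_false] at h
    split_ifs at h
    · rw [PMF.mem_support_pure_iff] at h
      rw [h, redPool]
    · rw [PMF.mem_support_pure_iff] at h
      rw [h]
      exact Finset.empty_subset _

/-- The number of white particles suffices for the pairs that become pink. -/
theorem State.Valid.card_pink_le (hx : x.Valid a b m) {pink : Finset (Fin K)}
    (h : ∀ i ∈ pink, OnEdge e x.LW i) : pink.card ≤ onEdge e (x.W a b) := by
  rw [← card_pool e hx.white]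
  have : pink.disjSum (∅ : Finset ℕ) ⊆ pool e x.LW (x.W a b) := by
    intro t ht
    cases t with
    | inl i => exact (inl_mem_pool e).2 (h i (Finset.inl_mem_disjSum.1 ht))
    | inr j => simp at ht
  simpa using Finset.card_le_card this

theorem State.Valid.card_whitesLeft (hx : x.Valid a b m) {pink : Finset (Fin K)}
    (h : ∀ i ∈ pink, OnEdge e x.LW i) :
    (whitesLeft a b e x pink).card = onEdge e (x.W a b) - pink.card := by
  have : pink.disjSum (∅ : Finset ℕ) ⊆ pool e x.LW (x.W a b) := by
    intro t ht
    cases t with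
    | inl i => exact (inl_mem_pool e).2 (h i (Finset.inl_mem_disjSum.1 ht))
    | inr j => simp at ht
  rw [whitesLeft, Finset.card_sdiff_of_subset this, card_pool e hx.white]
  simp

/-- The set `A` may serve the lower bounds, `low` of it on the first end-vertex. -/
structure LowChoice (a b : ℕ) (e : G.Edge) (x : State V K) (B' : V → ℕ)
    (A low : Finset (Token K)) : Prop where
  subset : A ⊆ redPool e x
  card : A.card = lowR a b e x B' (v₂ e) + lowR a b e x B' (v₁ e)
  low_subset : low ⊆ A
  low_card : low.card = lowR a b e x B' (v₂ e)

/-- The pairs in `pink` may become pink, while the red particles in `onFst` go to the first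
end-vertex. -/
structure RedChoice (a b : ℕ) (e : G.Edge) (x : State V K) (B' : V → ℕ)
    (pink : Finset (Fin K)) (onFst : Finset (Token K)) : Prop where
  red : ∀ i ∈ pink, OnEdge e x.LR i
  white : ∀ i ∈ pink, OnEdge e x.LW i
  subset : onFst ⊆ redPool e x \ pink.disjSum ∅
  card_le : pink.card + onFst.card ≤ onEdge e x.R
  fst_le : onFst.card + pink.card ≤ chi a b (B' (v₁ e))
  snd_le : onEdge e x.R - pink.card - onFst.card + pink.card ≤ chi a b (B' (v₂ e))

/-- The lower bounds already reserve `R - χ` particles, if positive, for the opposite end-vertex. So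
even if all the others end up on one end-vertex, its capacity is not exceeded. -/
theorem LowChoice.redChoice (hx : x.Valid a b m) {A low : Finset (Token K)}
    (hA : LowChoice a b e x B' A low) {fork : Bool} {r : Finset (Token K)}
    (hr : r ⊆ restFree e x A fork) :
    RedChoice a b e x B' (pinkSet e x A fork) (low ∪ r) := by
  have h1 := card_restFree e (x := x) A fork
  have h2 := Finset.card_sdiff_of_subset hA.subset
  rw [hx.card_redPool] at h2
  have h2' := Finset.card_le_card hA.subset
  rw [hx.card_redPool] at h2'
  have h3 := Finset.card_le_card hr
  have hdisj : Disjoint low r := by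
    refine Finset.disjoint_left.2 fun t ht ht' => ?_
    have := hr ht'
    simp only [restFree, Finset.mem_sdiff] at this
    exact this.1.2 (hA.low_subset ht)
  have h4 := Finset.card_union_of_disjoint hdisj
  have h5 := hA.card
  have h6 := hA.low_card
  have h7 : lowR a b e x B' (v₂ e) = onEdge e x.R - chi a b (B' (v₂ e)) := rfl
  have h8 : lowR a b e x B' (v₁ e) = onEdge e x.R - chi a b (B' (v₁ e)) := rfl
  refine ⟨fun i hi => ((mem_pinkSet e).1 hi).2.2.1, fun i hi => ((mem_pinkSet e).1 hi).2.2.2, ?_,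
    by omega, by omega, by omega⟩
  intro t ht
  have hp := pinkSet_disjSum_subset e (x := x) A fork
  rcases Finset.mem_union.1 ht with ht | ht
  · refine Finset.mem_sdiff.2 ⟨hA.subset (hA.low_subset ht), fun h => ?_⟩
    exact (Finset.mem_sdiff.1 (hp h)).2 (hA.low_subset ht)
  · have := hr ht
    simp only [restFree, Finset.mem_sdiff] at this ⊢
    exact ⟨this.1.1, this.2⟩

/-- `uniformSubset` silently truncates the size of a draw. The two draws together still have the
required size: the capacities add up to at least `R`, so the two lower bounds add up to at most `R`,
and the paired particles can supply what the non-paired ones leave open. -/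
theorem lowChoice_of_mem (hx : x.Valid a b m) (hM : MovedAlong e x.B B')
    {A₁ A₂ : Finset (Token K)}
    (h₁ : A₁ ∈ (uniformSubset (nonPairedReds e x)
      (lowR a b e x B' (v₂ e) + lowR a b e x B' (v₁ e))).support)
    (h₂ : A₂ ∈ (uniformSubset (pairedReds e x)
      (lowR a b e x B' (v₂ e) + lowR a b e x B' (v₁ e) - (nonPairedReds e x).card)).support) :
    A₁ ∪ A₂ ⊆ redPool e x ∧
      (A₁ ∪ A₂).card = lowR a b e x B' (v₂ e) + lowR a b e x B' (v₁ e) := by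
  rw [mem_support_uniformSubset] at h₁ h₂
  refine ⟨Finset.union_subset (h₁.1.trans Finset.subset_union_right)
    (h₂.1.trans Finset.subset_union_left), ?_⟩
  have hd : Disjoint A₁ A₂ := Disjoint.mono h₁.1 h₂.1 Finset.sdiff_disjoint
  rw [Finset.card_union_of_disjoint hd, h₁.2, h₂.2]
  have h3 := card_pairedReds_add e (x := x)
  rw [hx.card_redPool] at h3
  have h4 := hx.onEdge_W e hM
  have h7 : lowR a b e x B' (v₂ e) = onEdge e x.R - chi a b (B' (v₂ e)) := rfl
  have h8 : lowR a b e x B' (v₁ e) = onEdge e x.R - chi a b (B' (v₁ e)) := rfl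
  omega

theorem LowChoice.of_mem (hx : x.Valid a b m) (hM : MovedAlong e x.B B')
    {A₁ A₂ low : Finset (Token K)}
    (h₁ : A₁ ∈ (uniformSubset (nonPairedReds e x)
      (lowR a b e x B' (v₂ e) + lowR a b e x B' (v₁ e))).support)
    (h₂ : A₂ ∈ (uniformSubset (pairedReds e x)
      (lowR a b e x B' (v₂ e) + lowR a b e x B' (v₁ e) - (nonPairedReds e x).card)).support)
    (h₃ : low ∈ (uniformSubset (A₁ ∪ A₂) (lowR a b e x B' (v₂ e))).support) :
    LowChoice a b e x B' (A₁ ∪ A₂) low := by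
  obtain ⟨h4, h5⟩ := lowChoice_of_mem e hx hM h₁ h₂
  rw [mem_support_uniformSubset, h5] at h₃
  exact ⟨h4, h5, h₃.1, by rw [h₃.2]; omega⟩

/-- The configuration with the end-vertices of `e` exchanged. -/
def swapState (e : G.Edge) (y : State V K) : State V K where
  B := y.B ∘ swapV e
  R := y.R ∘ swapV e
  P := y.P ∘ swapV e
  LR := fun i => (y.LR i).map (swapV e)
  LW := fun i => (y.LW i).map (swapV e)

theorem newLabels_swap {L : Fin K → Option V} {pink : Finset (Fin K)} {A A' : Finset (Token K)}
    (h : ∀ i, i ∉ pink → OnEdge e L i → (Sum.inl i ∈ A' ↔ Sum.inl i ∉ A)) (i : Fin K) :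
    newLabels e L pink A' i = (newLabels e L pink A i).map (swapV e) := by
  unfold newLabels
  by_cases hp : i ∈ pink
  · simp [hp]
  by_cases ho : OnEdge e L i
  · have := h i hp ho
    by_cases hA : Sum.inl i ∈ A
    · have hA' : Sum.inl i ∉ A' := fun h' => this.1 h' hA
      simp [hp, ho, hA, hA']
    · have hA' : Sum.inl i ∈ A' := this.2 hA
      simp [hp, ho, hA, hA']
  · simp only [hp, ho, if_false]
    cases hL : L i with
    | none => rfl
    | some z =>
      rw [Option.map_some, swapV_of_ne]
      · rintro rfl; exact ho (Or.inl hL)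
      · rintro rfl; exact ho (Or.inr hL)

theorem outcome_swap (hx : x.Valid a b m) {pink : Finset (Fin K)} {onFst : Finset (Token K)}
    (hR : RedChoice a b e x B' pink onFst) {oldV : ℕ} (hold : oldV ≤ onEdge e x.P)
    {wh : Finset (Token K)} :
    outcome e x (B' ∘ swapV e) pink ((redPool e x \ pink.disjSum ∅) \ onFst)
      (onEdge e x.P - oldV) (whitesLeft a b e x pink \ wh) =
      swapState e (outcome e x B' pink onFst oldV wh) := by
  have hcard : ((redPool e x \ pink.disjSum ∅) \ onFst).card =
      onEdge e x.R - pink.card - onFst.card := by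
    have hp : pink.disjSum (∅ : Finset ℕ) ⊆ redPool e x := by
      intro t ht
      rw [redPool_eq]
      cases t with
      | inl i => exact (inl_mem_pool e).2 (hR.red i (Finset.inl_mem_disjSum.1 ht))
      | inr j => simp at ht
    rw [Finset.card_sdiff_of_subset hR.subset, Finset.card_sdiff_of_subset hp, hx.card_redPool]
    simp
  have hle := hR.card_le
  unfold outcome swapState
  ext1
  · rfl
  · simp only [setEnds_comp_swapV, hcard]
    congr 1
    omega
  · simp only [setEnds_comp_swapV]
    congr 1
    omega
  · funext i
    refine newLabels_swap e (fun i hi ho => ?_) i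
    rw [Finset.mem_sdiff, Finset.mem_sdiff, redPool_eq, inl_mem_pool]
    simp [hi, ho]
  · funext i
    refine newLabels_swap e (fun i hi ho => ?_) i
    rw [Finset.mem_sdiff, whitesLeft, Finset.mem_sdiff, inl_mem_pool]
    simp [hi, ho]

/-- The cut-offs in `oldOnFst` are compatible: `P + redW + k - c₂ ≤ c₁ - redV - k` means `P + R + k
≤ c₁ + c₂`, which holds because the `k` pinkened white particles are among the white ones on the
edge. -/
theorem oldOnFst_le (hx : x.Valid a b m) (hM : MovedAlong e x.B B') {k redV redW : ℕ}
    (h : redV + redW + k = onEdge e x.R) (h₁ : redV + k ≤ chi a b (B' (v₁ e)))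
    (h₂ : redW + k ≤ chi a b (B' (v₂ e))) (hk : k ≤ onEdge e (x.W a b)) (c : Bool) :
    oldOnFst a b e x B' k redV redW c ≤ onEdge e x.P ∧
      redV + k + oldOnFst a b e x B' k redV redW c ≤ chi a b (B' (v₁ e)) ∧
      onEdge e x.P + (redW + k) ≤
        chi a b (B' (v₂ e)) + oldOnFst a b e x B' k redV redW c := by
  have hW := hx.onEdge_W e hM
  have hlowP : lowP a b e x B' (v₂ e) ≤ onEdge e x.P := by
    unfold lowP upR
    omega
  have hupP : upP a b e x B' (v₁ e) ≤ onEdge e x.P := by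
    unfold upP
    omega
  unfold oldOnFst
  cases c <;> simp only [Bool.false_eq_true, if_false, if_true] <;> omega

/-- The lower bound for pink at one end-vertex and the upper bound at the other add up to `P`, and
the two cut-offs complement each other likewise. So the exchange requires the coin to be flipped. -/
theorem oldOnFst_swap (hx : x.Valid a b m) (hM : MovedAlong e x.B B') {k redV redW : ℕ}
    (h : redV + redW + k = onEdge e x.R) (h₁ : redV + k ≤ chi a b (B' (v₁ e)))
    (h₂ : redW + k ≤ chi a b (B' (v₂ e))) (hk : k ≤ onEdge e (x.W a b)) (c : Bool) :
    oldOnFst a b e x (B' ∘ swapV e) k redW redV (!c) =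
      onEdge e x.P - oldOnFst a b e x B' k redV redW c := by
  have hW := hx.onEdge_W e hM
  unfold oldOnFst lowP upP upR
  simp only [Function.comp_apply, swapV_v₁, swapV_v₂]
  cases c <;> simp only [Bool.not_false, Bool.not_true, Bool.false_eq_true, if_false, if_true] <;>
    omega

end Symmetry

end Chameleon

namespace Chameleon

/-! ### Exchange of the end-vertices: the law of a step -/

section Symmetry

variable {V : Type*} [Fintype V] [LinearOrder V] {K : ℕ} {G : WeightedGraph V}
  {a b m : ℕ} (e : G.Edge) {x : State V K} {B' : V → ℕ}

/-- The exchange sends the mean ink to its complement and each upper bound to the complement of a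
lower one, so `θ` turns into `1 - θ`. When the bounds agree, division by zero makes both values `0`.
The equalities of the second alternative are kept, since they show that `θ` then has no effect. -/
theorem theta_swap (ha : 0 < a) (hb : 0 < b) (hx : x.Valid a b m) (hM : MovedAlong e x.B B') :
    theta a b e x (B' ∘ swapV e) = 1 - theta a b e x B' ∨
      (theta a b e x (B' ∘ swapV e) = 0 ∧ theta a b e x B' = 0 ∧
        min (chi a b (B' (v₁ e))) (onEdge e x.R) + min (chi a b (B' (v₂ e))) (onEdge e x.R) =
          onEdge e x.R ∧
        min (chi a b (B' (v₁ e))) (onEdge e x.R + onEdge e x.P) +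
          min (chi a b (B' (v₂ e))) (onEdge e x.R + onEdge e x.P) =
          onEdge e x.R + onEdge e x.P) := by
  have hW := hx.onEdge_W e hM
  rw [theta_eq e ha hb hM rfl rfl rfl rfl, theta_eq e ha hb hM.swap rfl rfl rfl rfl]
  simp only [Function.comp_apply, swapV_v₁, swapV_v₂]
  generalize chi a b (B' (v₁ e)) = c₁ at *
  generalize chi a b (B' (v₂ e)) = c₂ at *
  generalize onEdge e x.R = r at *
  generalize onEdge e x.P = q at *
  have hr : r ≤ min c₁ r + min c₂ r := by omega
  have hq : r + q ≤ min c₁ (r + q) + min c₂ (r + q) := by omega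
  by_cases hdeg : min c₁ r + min c₂ r = r ∧ min c₁ (r + q) + min c₂ (r + q) = r + q
  · right
    have h1 : (min (c₁ : ℝ) r + min (c₂ : ℝ) r) = r := by exact_mod_cast hdeg.1
    have h2 : (min (c₁ : ℝ) (r + q) + min (c₂ : ℝ) (r + q)) = r + q := by exact_mod_cast hdeg.2
    refine ⟨?_, ?_, hdeg⟩
    · rw [add_comm (min (c₂ : ℝ) r) (min (c₁ : ℝ) r),
        add_comm (min (c₂ : ℝ) (r + q)) (min (c₁ : ℝ) (r + q)), h1, h2]
      simp
    · rw [h1, h2]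
      simp
  · left
    have hpos : r + (r + q) < (min c₁ r + min c₂ r) + (min c₁ (r + q) + min c₂ (r + q)) := by
      omega
    have hpos' : (0 : ℝ) < (min (c₁ : ℝ) r + min (c₂ : ℝ) r - r) +
        (min (c₁ : ℝ) (r + q) + min (c₂ : ℝ) (r + q) - (r + q)) := by
      have : ((r + (r + q) : ℕ) : ℝ) <
        (((min c₁ r + min c₂ r) + (min c₁ (r + q) + min c₂ (r + q)) : ℕ) : ℝ) := by
        exact_mod_cast hpos
      push_cast at this
      linarith
    have hc : (0 : ℝ) < c₁ + c₂ := by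
      by_contra h
      have h' : ((c₁ + c₂ : ℕ) : ℝ) ≤ ((0 : ℕ) : ℝ) := by push_cast; linarith
      have h'' : c₁ + c₂ ≤ 0 := by exact_mod_cast h'
      omega
    rw [one_sub_div hpos'.ne', add_comm (c₂ : ℝ) c₁,
      add_comm (min (c₂ : ℝ) r) (min (c₁ : ℝ) r),
      add_comm (min (c₂ : ℝ) (r + q)) (min (c₁ : ℝ) (r + q))]
    congr 1
    field_simp
    ring

theorem pinkWhiteLaw_swap (ha : 0 < a) (hb : 0 < b) (hx : x.Valid a b m)
    (hM : MovedAlong e x.B B') {pink : Finset (Fin K)} {onFst : Finset (Token K)}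
    (hR : RedChoice a b e x B' pink onFst) :
    pinkWhiteLaw a b e x (B' ∘ swapV e) pink ((redPool e x \ pink.disjSum ∅) \ onFst) =
      (pinkWhiteLaw a b e x B' pink onFst).map (swapState e) := by
  have hcard : ((redPool e x \ pink.disjSum ∅) \ onFst).card =
      onEdge e x.R - pink.card - onFst.card := by
    have hp : pink.disjSum (∅ : Finset ℕ) ⊆ redPool e x := by
      intro t ht
      rw [redPool_eq]
      cases t with
      | inl i => exact (inl_mem_pool e).2 (hR.red i (Finset.inl_mem_disjSum.1 ht))
      | inr j => simp at ht
    rw [Finset.card_sdiff_of_subset hR.subset, Finset.card_sdiff_of_subset hp, hx.card_redPool]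
    simp
  have hle := hR.card_le
  have hk := hx.card_pink_le e hR.white
  have hwl := hx.card_whitesLeft e hR.white
  have hW := hx.onEdge_W e hM
  have hsum : onFst.card + (onEdge e x.R - pink.card - onFst.card) + pink.card =
      onEdge e x.R := by omega
  have key : ∀ c c', oldOnFst a b e x (B' ∘ swapV e) pink.card
      (onEdge e x.R - pink.card - onFst.card) onFst.card c' =
      onEdge e x.P - oldOnFst a b e x B' pink.card onFst.card
        (onEdge e x.R - pink.card - onFst.card) c →
      (uniformSubset (whitesLeft a b e x pink) (chi a b ((B' ∘ swapV e) (v₁ e)) -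
        (((redPool e x \ pink.disjSum ∅) \ onFst).card + pink.card) -
        oldOnFst a b e x (B' ∘ swapV e) pink.card ((redPool e x \ pink.disjSum ∅) \ onFst).card
        (onEdge e x.R - pink.card - ((redPool e x \ pink.disjSum ∅) \ onFst).card) c')).map
      (outcome e x (B' ∘ swapV e) pink ((redPool e x \ pink.disjSum ∅) \ onFst)
        (oldOnFst a b e x (B' ∘ swapV e) pink.card
          ((redPool e x \ pink.disjSum ∅) \ onFst).card
        (onEdge e x.R - pink.card - ((redPool e x \ pink.disjSum ∅) \ onFst).card) c')) =
      ((uniformSubset (whitesLeft a b e x pink) (chi a b (B' (v₁ e)) -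
        (onFst.card + pink.card) - oldOnFst a b e x B' pink.card onFst.card
        (onEdge e x.R - pink.card - onFst.card) c)).map
      (outcome e x B' pink onFst (oldOnFst a b e x B' pink.card onFst.card
        (onEdge e x.R - pink.card - onFst.card) c))).map (swapState e) := by
    intro c c' h
    obtain ⟨h1, h2, h3⟩ := oldOnFst_le e hx hM hsum hR.fst_le hR.snd_le hk c
    have hback : onEdge e x.R - pink.card - (onEdge e x.R - pink.card - onFst.card) =
        onFst.card := by omega
    rw [hcard, hback, h]
    have hsnd := hR.snd_le
    rw [uniformSubset_compl (j := chi a b (B' (v₁ e)) -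
        (onFst.card + pink.card) - oldOnFst a b e x B' pink.card onFst.card
        (onEdge e x.R - pink.card - onFst.card) c), PMF.map_comp, PMF.map_comp]
    · congr 1
      funext wh
      exact outcome_swap e hx hR h1
    · rw [hwl, Function.comp_apply, swapV_v₁]
      omega
  have hswap := fun c => oldOnFst_swap e hx hM hsum hR.fst_le hR.snd_le hk c
  unfold pinkWhiteLaw
  rw [PMF.map_bind]
  rcases theta_swap e ha hb hx hM with h | ⟨h, h', h1, h2⟩
  · rw [h]
    exact bind_map_congr (coin_one_sub _) fun c _ => key c (!c) (hswap c)
  -- If the bounds agree, the coin has the same bias on both sides and must not be flipped; but `ℓ^P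
  -- = u^P`, so its result does not matter.
  · rw [h, h']
    refine bind_congr_support fun c _ => key c c ?_
    rw [show oldOnFst a b e x (B' ∘ swapV e) pink.card
      (onEdge e x.R - pink.card - onFst.card) onFst.card c = oldOnFst a b e x (B' ∘ swapV e)
      pink.card (onEdge e x.R - pink.card - onFst.card) onFst.card (!c) from ?_, hswap c]
    have : lowP a b e x (B' ∘ swapV e) (v₂ e) = upP a b e x (B' ∘ swapV e) (v₁ e) := by
      unfold lowP upP upR
      simp only [Function.comp_apply, swapV_v₁, swapV_v₂]
      omega
    unfold oldOnFst
    rw [this]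
    simp only [ite_self]

theorem sdiff_union_sdiff_eq {α : Type*} [DecidableEq α] {U A L P S : Finset α} (hA : A ⊆ U)
    (hL : L ⊆ A) (hP : P ⊆ U \ A) (hS : S ⊆ (U \ A) \ P) :
    (A \ L) ∪ (((U \ A) \ P) \ S) = (U \ P) \ (L ∪ S) := by
  ext t
  have h1 := @hA t
  have h2 := @hL t
  have h3 := @hP t
  have h4 := @hS t
  simp only [Finset.mem_union, Finset.mem_sdiff] at *
  by_cases t ∈ A <;> by_cases t ∈ P <;> by_cases t ∈ S <;> by_cases t ∈ L <;>
    by_cases t ∈ U <;> simp_all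

/-- The probability of Step 3a is symmetric in `θ` and `1 - θ`. In Step 3a a uniform subset is
replaced by its complement, and in Step 3b all remaining red particles change sides. -/
theorem afterLowLaw_swap (ha : 0 < a) (hb : 0 < b) (hx : x.Valid a b m)
    (hM : MovedAlong e x.B B') {A low : Finset (Token K)}
    (hA : LowChoice a b e x B' A low) :
    afterLowLaw a b e x (B' ∘ swapV e) A (A \ low) =
      (afterLowLaw a b e x B' A low).map (swapState e) := by
  have hθ := theta_swap e ha hb hx hM
  have hcoin : 2 * min (theta a b e x (B' ∘ swapV e)) (1 - theta a b e x (B' ∘ swapV e)) =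
      2 * min (theta a b e x B') (1 - theta a b e x B') := by
    rcases hθ with h | ⟨h, h', _⟩
    · rw [h, min_comm]; ring_nf
    · rw [h, h']
  unfold afterLowLaw
  rw [PMF.map_bind, hcoin]
  refine bind_congr_support fun fork hfork => ?_
  rw [PMF.map_bind]
  refine bind_map_congr (g := (restFree e x A fork \ ·)) ?_ fun r hr => ?_
  · cases fork with
    | true =>
      rw [restFree_true]
      simp only [restLaw, if_true]
      exact halfSubset_compl _
    | false =>
      rw [restFree_false]
      simp only [restLaw, Bool.false_eq_true, if_false]
      rcases hθ with h | ⟨h, h', h1, _⟩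
      · have hne : theta a b e x B' ≠ 1 / 2 := by
          intro h2
          rw [PMF.mem_support_iff, coin_apply_false, h2] at hfork
          norm_num at hfork
        rcases lt_or_gt_of_ne hne with h3 | h3
        · rw [if_pos h3, if_neg (by linarith), PMF.pure_map, redPool, Finset.sdiff_self]
        · rw [if_neg h3.not_gt, if_pos (by linarith), PMF.pure_map, redPool, Finset.sdiff_empty]
      -- If the bounds for red agree, the lower bounds use up all red particles, and both sides
      -- place the empty set.
      · have hempty : redPool e x \ A = ∅ := by
          rw [← Finset.card_eq_zero, Finset.card_sdiff_of_subset hA.subset, hx.card_redPool,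
            hA.card]
          unfold lowR
          omega
        rw [h, h', if_pos (by norm_num), PMF.pure_map]
        simp only [redPool] at hempty ⊢
        rw [hempty]
        simp
  · have hr' := mem_support_restLaw e hr
    rw [← pinkWhiteLaw_swap e ha hb hx hM (hA.redChoice e hx hr')]
    congr 1
    exact sdiff_union_sdiff_eq hA.subset hA.low_subset
      (pinkSet_disjSum_subset e (x := x) A fork) hr'

theorem stepLaw_swap (ha : 0 < a) (hb : 0 < b) (hx : x.Valid a b m)
    (hM : MovedAlong e x.B B') :
    stepLaw a b e x (B' ∘ swapV e) = (stepLaw a b e x B').map (swapState e) := by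
  have h1 : lowR a b e x (B' ∘ swapV e) (v₁ e) = lowR a b e x B' (v₂ e) := by simp [lowR]
  have h2 : lowR a b e x (B' ∘ swapV e) (v₂ e) = lowR a b e x B' (v₁ e) := by simp [lowR]
  rw [stepLaw_eq, stepLaw_eq, PMF.map_bind, h1, h2, add_comm (lowR a b e x B' (v₁ e))]
  refine bind_congr_support fun A₁ hA₁ => ?_
  rw [PMF.map_bind]
  refine bind_congr_support fun A₂ hA₂ => ?_
  rw [PMF.map_bind]
  have hc := (lowChoice_of_mem e hx hM hA₁ hA₂).2
  have hlow := fun low hlow =>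
    afterLowLaw_swap e ha hb hx hM (LowChoice.of_mem e hx hM hA₁ hA₂ (low := low) hlow)
  generalize A₁ ∪ A₂ = A at hc hlow ⊢
  exact bind_map_congr (uniformSubset_compl hc) hlow

end Symmetry

/-! ### Conservation laws of the step -/

section Conservation

variable {V : Type*} [Fintype V] [LinearOrder V] {K : ℕ} {G : WeightedGraph V}
  {a b m : ℕ} (e : G.Edge) {x : State V K} {B' : V → ℕ}

theorem newLabels_eq_fst {L : Fin K → Option V} {pink : Finset (Fin K)} {A : Finset (Token K)}
    {i : Fin K} : newLabels e L pink A i = some (v₁ e) ↔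
      i ∉ pink ∧ OnEdge e L i ∧ Sum.inl i ∈ A := by
  have hne := v₁_ne_v₂ e
  unfold newLabels
  by_cases hp : i ∈ pink
  · simp [hp]
  by_cases ho : OnEdge e L i
  · by_cases hA : Sum.inl i ∈ A <;> simp [hp, ho, hA, hne.symm]
  · simp only [hp, ho, if_false]
    simp only [OnEdge, not_or] at ho
    simp [ho.1]

theorem newLabels_eq_snd {L : Fin K → Option V} {pink : Finset (Fin K)} {A : Finset (Token K)}
    {i : Fin K} : newLabels e L pink A i = some (v₂ e) ↔
      i ∉ pink ∧ OnEdge e L i ∧ Sum.inl i ∉ A := by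
  have hne := v₁_ne_v₂ e
  unfold newLabels
  by_cases hp : i ∈ pink
  · simp [hp]
  by_cases ho : OnEdge e L i
  · by_cases hA : Sum.inl i ∈ A <;> simp [hp, ho, hA, hne]
  · simp only [hp, ho, if_false]
    simp only [OnEdge, not_or] at ho
    simp [ho.2]

theorem newLabels_eq_none {L : Fin K → Option V} {pink : Finset (Fin K)} {A : Finset (Token K)}
    {i : Fin K} : newLabels e L pink A i = none ↔ i ∈ pink ∨ L i = none := by
  unfold newLabels
  by_cases hp : i ∈ pink
  · simp [hp]
  by_cases ho : OnEdge e L i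
  · have : L i ≠ none := by
      rcases ho with h | h <;> rw [h] <;> simp
    by_cases hA : Sum.inl i ∈ A <;> simp [hp, ho, hA, this]
  · simp [hp, ho]

theorem newLabels_off {L : Fin K → Option V} {pink : Finset (Fin K)} {A : Finset (Token K)}
    {i : Fin K} (hp : ∀ i ∈ pink, OnEdge e L i) (h : ¬ OnEdge e L i) :
    newLabels e L pink A i = L i := by
  unfold newLabels
  rw [if_neg fun hi => h (hp i hi), if_neg h]

theorem newLabels_onEdge {L : Fin K → Option V} {pink : Finset (Fin K)} {A : Finset (Token K)}
    {i : Fin K} (hp : i ∉ pink) (h : OnEdge e L i) : OnEdge e (newLabels e L pink A) i := by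
  by_cases hA : Sum.inl i ∈ A
  · exact Or.inl ((newLabels_eq_fst e).2 ⟨hp, h, hA⟩)
  · exact Or.inr ((newLabels_eq_snd e).2 ⟨hp, h, hA⟩)

theorem labelCount_newLabels_off {L : Fin K → Option V} {pink : Finset (Fin K)}
    {A : Finset (Token K)} (hp : ∀ i ∈ pink, OnEdge e L i) {z : V} (h1 : z ≠ v₁ e)
    (h2 : z ≠ v₂ e) : labelCount (newLabels e L pink A) z = labelCount L z := by
  unfold labelCount
  congr 1
  ext i
  simp only [Finset.mem_filter, Finset.mem_univ, true_and]
  by_cases ho : OnEdge e L i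
  · have hL : L i ≠ some z := by
      rintro h
      rcases ho with h' | h' <;> rw [h] at h'
      · exact h1 (Option.some_injective _ h')
      · exact h2 (Option.some_injective _ h')
    refine iff_of_false (fun h => ?_) hL
    by_cases hi : i ∈ pink
    · rw [(newLabels_eq_none e).2 (Or.inl hi)] at h
      exact absurd h (by simp)
    · rcases newLabels_onEdge e hi ho (A := A) with h' | h' <;> rw [h] at h'
      · exact h1 (Option.some_injective _ h')
      · exact h2 (Option.some_injective _ h')
  · rw [newLabels_off e hp ho]

theorem labelCount_newLabels_fst_le (L : Fin K → Option V) (pink : Finset (Fin K))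
    (A : Finset (Token K)) : labelCount (newLabels e L pink A) (v₁ e) ≤ A.card := by
  unfold labelCount
  refine Finset.card_le_card_of_injOn Sum.inl (fun i hi => ?_) Sum.inl_injective.injOn
  simp only [Finset.coe_filter, Finset.mem_univ, true_and, Set.mem_ofPred_eq,
    newLabels_eq_fst] at hi
  exact hi.2.2

theorem labelCount_newLabels_snd_le (L : Fin K → Option V) (S : V → ℕ) (pink : Finset (Fin K))
    (A : Finset (Token K)) : labelCount (newLabels e L pink A) (v₂ e) ≤
      ((pool e L S \ pink.disjSum ∅) \ A).card := by
  unfold labelCount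
  refine Finset.card_le_card_of_injOn Sum.inl (fun i hi => ?_) Sum.inl_injective.injOn
  simp only [Finset.coe_filter, Finset.mem_univ, true_and, Set.mem_ofPred_eq,
    newLabels_eq_snd] at hi
  simp [hi.1, hi.2.2, inl_mem_pool, hi.2.1]

theorem labelCount_newLabels_add {L : Fin K → Option V} {pink : Finset (Fin K)}
    (A : Finset (Token K)) (hp : ∀ i ∈ pink, OnEdge e L i) :
    labelCount (newLabels e L pink A) (v₁ e) + labelCount (newLabels e L pink A) (v₂ e) +
      pink.card = labelCount L (v₁ e) + labelCount L (v₂ e) := by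
  classical
  rw [← card_filter_onEdge, ← card_filter_onEdge, ← Finset.card_union_of_disjoint]
  · congr 1
    ext i
    simp only [Finset.mem_union, Finset.mem_filter, Finset.mem_univ, true_and]
    constructor
    · rintro (h | h)
      · rcases h with h | h
        · exact ((newLabels_eq_fst e).1 h).2.1
        · exact ((newLabels_eq_snd e).1 h).2.1
      · exact hp i h
    · intro h
      by_cases hi : i ∈ pink
      · exact Or.inr hi
      · exact Or.inl (newLabels_onEdge e hi h)
  · refine Finset.disjoint_left.2 fun i h hi => ?_
    rcases (Finset.mem_filter.1 h).2 with h | h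
    · exact ((newLabels_eq_fst e).1 h).1 hi
    · exact ((newLabels_eq_snd e).1 h).1 hi

theorem outcome_valid (hx : x.Valid a b m) (hM : MovedAlong e x.B B')
    {pink : Finset (Fin K)} {onFst : Finset (Token K)} (hR : RedChoice a b e x B' pink onFst)
    {oldV : ℕ} (h1 : oldV ≤ onEdge e x.P)
    (h2 : onFst.card + pink.card + oldV ≤ chi a b (B' (v₁ e)))
    (h3 : onEdge e x.P + (onEdge e x.R - pink.card - onFst.card + pink.card) ≤
        chi a b (B' (v₂ e)) + oldV)
    {wh : Finset (Token K)} (hwh : wh ⊆ whitesLeft a b e x pink)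
    (hwc : wh.card = chi a b (B' (v₁ e)) - (onFst.card + pink.card) - oldV) :
    (outcome e x B' pink onFst oldV wh).Valid a b m := by
  have hle := hR.card_le
  have hk := hx.card_pink_le e hR.white
  have hwl := hx.card_whitesLeft e hR.white
  have hW := hx.onEdge_W e hM
  have hwlR : (redPool e x \ pink.disjSum ∅).card = onEdge e x.R - pink.card := by
    have hp : pink.disjSum (∅ : Finset ℕ) ⊆ redPool e x := by
      intro t ht
      rw [redPool_eq]
      cases t with
      | inl i => exact (inl_mem_pool e).2 (hR.red i (Finset.inl_mem_disjSum.1 ht))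
      | inr j => simp at ht
    rw [Finset.card_sdiff_of_subset hp, hx.card_redPool]
    simp
  have hr1 := labelCount_newLabels_fst_le e x.LR pink onFst
  have hr2 := labelCount_newLabels_snd_le e x.LR x.R pink onFst
  rw [← redPool_eq, Finset.card_sdiff_of_subset hR.subset, hwlR] at hr2
  -- The numbers of red labels on the two ends are at most the numbers of red particles there, and
  -- both pairs of numbers have the same sum; hence equality holds at each end, and every red
  -- particle is still labelled.
  have hr3 := labelCount_newLabels_add e onFst hR.red
  rw [hx.red, hx.red] at hr3
  have hr4 : onEdge e x.R = x.R (v₁ e) + x.R (v₂ e) := rfl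
  have hw1 := labelCount_newLabels_fst_le e x.LW pink wh
  have hw2 := labelCount_newLabels_snd_le e x.LW (x.W a b) pink wh
  rw [← whitesLeft, Finset.card_sdiff_of_subset hwh, hwl] at hw2
  refine ⟨hM.sum_eq.trans hx.sumB, fun z => ?_, fun z => ?_, fun z => ?_, fun i => ?_⟩
  · simp only [outcome]
    by_cases hz1 : z = v₁ e
    · subst hz1
      rw [setEnds_v₁, setEnds_v₁]
      omega
    by_cases hz2 : z = v₂ e
    · subst hz2
      rw [setEnds_v₂, setEnds_v₂]
      omega
    · rw [setEnds_of_ne e _ _ _ hz1 hz2, setEnds_of_ne e _ _ _ hz1 hz2, hM.off z hz1 hz2]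
      exact hx.le z
  · simp only [outcome]
    by_cases hz1 : z = v₁ e
    · subst hz1
      rw [setEnds_v₁]
      omega
    by_cases hz2 : z = v₂ e
    · subst hz2
      rw [setEnds_v₂]
      omega
    · rw [setEnds_of_ne e _ _ _ hz1 hz2, labelCount_newLabels_off e hR.red hz1 hz2, hx.red]
  · simp only [outcome, State.W]
    by_cases hz1 : z = v₁ e
    · subst hz1
      rw [setEnds_v₁, setEnds_v₁]
      omega
    by_cases hz2 : z = v₂ e
    · subst hz2
      rw [setEnds_v₂, setEnds_v₂]
      omega
    · rw [setEnds_of_ne e _ _ _ hz1 hz2, setEnds_of_ne e _ _ _ hz1 hz2, hM.off z hz1 hz2,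
        labelCount_newLabels_off e hR.white hz1 hz2]
      exact hx.white z
  · simp only [outcome, newLabels_eq_none]
    rw [hx.none_iff i]

/-- What can be said about every possible outcome of a step. -/
theorem of_mem_support_stepLaw (hx : x.Valid a b m)
    (hM : MovedAlong e x.B B') {y : State V K} (hy : y ∈ (stepLaw a b e x B').support) :
    y.Valid a b m ∧ ∃ (pink : Finset (Fin K)) (A A' : Finset (Token K)),
      (∀ i ∈ pink, OnEdge e x.LR i ∧ OnEdge e x.LW i) ∧ y.LR = newLabels e x.LR pink A ∧
      y.LW = newLabels e x.LW pink A' := by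
  rw [stepLaw_eq] at hy
  obtain ⟨A₁, hA₁, hy⟩ := (PMF.mem_support_bind_iff _ _ _).1 hy
  obtain ⟨A₂, hA₂, hy⟩ := (PMF.mem_support_bind_iff _ _ _).1 hy
  obtain ⟨low, hlow, hy⟩ := (PMF.mem_support_bind_iff _ _ _).1 hy
  have hA := LowChoice.of_mem e hx hM hA₁ hA₂ hlow
  obtain ⟨fork, -, hy⟩ := (PMF.mem_support_bind_iff _ _ _).1 hy
  obtain ⟨r, hr, hy⟩ := (PMF.mem_support_bind_iff _ _ _).1 hy
  have hR := hA.redChoice e hx (mem_support_restLaw e hr)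
  obtain ⟨c, -, hy⟩ := (PMF.mem_support_bind_iff _ _ _).1 hy
  obtain ⟨wh, hwh, rfl⟩ := (PMF.mem_support_map_iff _ _ _).1 hy
  have hle := hR.card_le
  have hk := hx.card_pink_le e hR.white
  have hwl := hx.card_whitesLeft e hR.white
  have hW := hx.onEdge_W e hM
  obtain ⟨h1, h2, h3⟩ := oldOnFst_le e hx hM (k := (pinkSet e x (A₁ ∪ A₂) fork).card)
    (redV := (low ∪ r).card)
    (redW := onEdge e x.R - (pinkSet e x (A₁ ∪ A₂) fork).card - (low ∪ r).card)
    (by omega) hR.fst_le hR.snd_le hk c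
  rw [mem_support_uniformSubset] at hwh
  refine ⟨outcome_valid e hx hM hR h1 h2 h3 hwh.1 ?_, _, _, _,
    fun i hi => ⟨hR.red i hi, hR.white i hi⟩, rfl, rfl⟩
  rw [hwh.2, hwl]
  omega

end Conservation

end Chameleon

namespace Chameleon

/-! ### The movement of a pair in one step -/

section Movement

variable {V : Type*} [Fintype V] [LinearOrder V] {K : ℕ} {G : WeightedGraph V}
  {a b m : ℕ} (e : G.Edge) {x : State V K} {B' : V → ℕ}

/-- The vertex `z` is an end-vertex of `e`. -/
def IsEnd (e : G.Edge) (z : V) : Prop := z = v₁ e ∨ z = v₂ e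

theorem onEdge_iff {L : Fin K → Option V} {i : Fin K} {z : V} (h : L i = some z) :
    OnEdge e L i ↔ IsEnd e z := by
  unfold OnEdge IsEnd
  rw [h]
  simp

theorem swapV_of_not_isEnd {z : V} (h : ¬ IsEnd e z) : swapV e z = z := by
  simp only [IsEnd, not_or] at h
  exact swapV_of_ne e h.1 h.2

/-- Both sides are the sum of `φ` over the two end-vertices. -/
theorem isEnd_swap_sum (φ : V → ℝ≥0∞) {y z : V} (hy : IsEnd e y) (hz : IsEnd e z) :
    φ y + φ (swapV e y) = φ (swapV e z) + φ z := by
  rcases hy with rfl | rfl <;> rcases hz with rfl | rfl <;>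
    simp only [swapV_v₁, swapV_v₂] <;> first | rfl | exact add_comm _ _

/-- The expectation of `f` after a ring of `e`. -/
def stepMean (a b : ℕ) (e : G.Edge) (x : State V K) (f : State V K → ℝ≥0∞) : ℝ≥0∞ :=
  ∫⁻ u : I, pexp (stepLaw a b e x (mabb ((b : ℝ) / a) u e x.B)) f

theorem stepMean_eq (ha : 0 < a) (hb : 0 < b) (f : State V K → ℝ≥0∞) :
    stepMean a b e x f = ∑ k ∈ Finset.range (x.B (v₁ e) + x.B (v₂ e) + 1),
      ENNReal.ofReal (betaBin ((b : ℝ) / a) (x.B (v₁ e) + x.B (v₂ e)) k) *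
        pexp (stepLaw a b e x (setEnds e x.B k (x.B (v₁ e) + x.B (v₂ e) - k))) f := by
  have hs : (0 : ℝ) < (b : ℝ) / a := by positivity
  exact lintegral_splitCount hs _ fun k =>
    pexp (stepLaw a b e x (setEnds e x.B k (x.B (v₁ e) + x.B (v₂ e) - k))) f

theorem sum_ofReal_betaBin {s : ℝ} (hs : 0 < s) (N : ℕ) :
    ∑ k ∈ Finset.range (N + 1), ENNReal.ofReal (betaBin s N k) = 1 := by
  rw [← ENNReal.ofReal_sum_of_nonneg fun k hk =>
    (betaBin_pos hs (Nat.lt_succ_iff.1 (Finset.mem_range.1 hk))).le, sum_betaBin hs,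
    ENNReal.ofReal_one]

theorem stepMean_mono (hx : x.Valid a b m) {f g : State V K → ℝ≥0∞}
    (h : ∀ y : State V K, y.Valid a b m → (∀ i, x.LR i = none → y.LR i = none) → f y ≤ g y) :
    stepMean a b e x f ≤ stepMean a b e x g := by
  refine lintegral_mono fun u => pexp_mono fun y hy => ?_
  rw [mabb_eq] at hy
  obtain ⟨h1, pink, A, A', -, h2, -⟩ :=
    of_mem_support_stepLaw e hx (movedAlong_setEnds e x.B (splitCount_le _ _ _)) hy
  refine h y h1 fun i hi => ?_
  rw [h2]
  exact (newLabels_eq_none e).2 (Or.inr hi)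

theorem stepMean_const_mul (ha : 0 < a) (hb : 0 < b) (c : ℝ≥0∞) (f : State V K → ℝ≥0∞) :
    stepMean a b e x (fun y => c * f y) = c * stepMean a b e x f := by
  rw [stepMean_eq e ha hb, stepMean_eq e ha hb, Finset.mul_sum]
  refine Finset.sum_congr rfl fun k _ => ?_
  rw [mul_left_comm]
  congr 1
  unfold pexp
  rw [← ENNReal.tsum_mul_left]
  exact tsum_congr fun y => mul_left_comm _ _ _

/-- The laws of `k` and of `N - k` agree, and `stepLaw_swap` transfers this symmetry of the black
particles to whole configurations. -/
theorem stepMean_swap (ha : 0 < a) (hb : 0 < b) (hx : x.Valid a b m) (f : State V K → ℝ≥0∞) :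
    stepMean a b e x (f ∘ swapState e) = stepMean a b e x f := by
  have hs : (0 : ℝ) < (b : ℝ) / a := by positivity
  set N := x.B (v₁ e) + x.B (v₂ e) with hN
  have h := lintegral_splitCount_symm hs N fun k =>
    pexp (stepLaw a b e x (setEnds e x.B k (N - k))) f
  refine Eq.trans (lintegral_congr fun u => ?_) h
  have hk := splitCount_le ((b : ℝ) / a) N u
  rw [mabb_eq, ← hN]
  generalize splitCount ((b : ℝ) / a) N u = k at hk
  rw [Nat.sub_sub_self hk, ← setEnds_comp_swapV e x.B k (N - k), stepLaw_swap e ha hb hx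
    (movedAlong_setEnds e x.B hk), pexp_map]

theorem stepMean_const (c : ℝ≥0∞) :
    stepMean a b e x (fun _ => c) = c := by
  unfold stepMean
  simp [pexp_const]

theorem stepMean_add (ha : 0 < a) (hb : 0 < b) (f g : State V K → ℝ≥0∞) :
    stepMean a b e x (fun y => f y + g y) = stepMean a b e x f + stepMean a b e x g := by
  rw [stepMean_eq e ha hb, stepMean_eq e ha hb, stepMean_eq e ha hb, ← Finset.sum_add_distrib]
  exact Finset.sum_congr rfl fun k _ => by rw [pexp_add, mul_add]

theorem stepMean_congr {f g : State V K → ℝ≥0∞}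
    (h : ∀ k ≤ x.B (v₁ e) + x.B (v₂ e), ∀ y ∈ (stepLaw a b e x
      (setEnds e x.B k (x.B (v₁ e) + x.B (v₂ e) - k))).support, f y = g y) :
    stepMean a b e x f = stepMean a b e x g :=
  lintegral_congr fun _ => pexp_congr fun y hy => h _ (splitCount_le _ _ _) y hy

/-- As long as a pair is not on the ringing edge, its particles move like independent
random walks. -/
theorem stepMean_pair (ha : 0 < a) (hb : 0 < b) (hx : x.Valid a b m) {i : Fin K} {p q : V}
    (hp : x.LR i = some p) (hq : x.LW i = some q) (hpq : ¬ (IsEnd e p ∧ IsEnd e q))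
    (f : Option V → Option V → ℝ≥0∞) :
    stepMean a b e x (fun y => f (y.LR i) (y.LW i)) =
      2⁻¹ * f (some (swapV e p)) (some q) + 2⁻¹ * f (some p) (some (swapV e q)) := by
  set F : State V K → ℝ≥0∞ := fun y => f (y.LR i) (y.LW i) with hF
  -- By symmetry, twice the mean of `F` is the mean of `F + F ∘ swapState e`. This function is
  -- constant on the outcomes: whichever end-vertex the particle on `e` reaches, the sum runs over
  -- both.
  have hsum : stepMean a b e x F + stepMean a b e x F =
      f (some (swapV e p)) (some q) + f (some p) (some (swapV e q)) := by
    nth_rw 2 [← stepMean_swap e ha hb hx F]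
    rw [← stepMean_add e ha hb, ← stepMean_const e (x := x)
      (f (some (swapV e p)) (some q) + f (some p) (some (swapV e q)))]
    refine stepMean_congr e fun k hk y hy => ?_
    obtain ⟨-, pink, A, A', hpink, h1, h2⟩ :=
      of_mem_support_stepLaw e hx (movedAlong_setEnds e x.B hk) hy
    have hi : i ∉ pink := fun hi => hpq
      ⟨(onEdge_iff e hp).1 (hpink i hi).1, (onEdge_iff e hq).1 (hpink i hi).2⟩
    simp only [hF, Function.comp_apply, swapState, h1, h2]
    by_cases hpe : IsEnd e p
    · have hqe : ¬ IsEnd e q := fun h => hpq ⟨hpe, h⟩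
      have h3 : newLabels e x.LW pink A' i = some q := by
        rw [newLabels_off e (fun j hj => (hpink j hj).2) (mt (onEdge_iff e hq).1 hqe), hq]
      obtain ⟨y, hye, hy⟩ : ∃ y, IsEnd e y ∧ newLabels e x.LR pink A i = some y := by
        rcases newLabels_onEdge e hi ((onEdge_iff e hp).2 hpe) (A := A) with h | h
        · exact ⟨_, Or.inl rfl, h⟩
        · exact ⟨_, Or.inr rfl, h⟩
      rw [h3, hy, Option.map_some, Option.map_some, swapV_of_not_isEnd e hqe]
      exact isEnd_swap_sum e (fun z => f (some z) (some q)) hye hpe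
    · have h3 : newLabels e x.LR pink A i = some p := by
        rw [newLabels_off e (fun j hj => (hpink j hj).1) (mt (onEdge_iff e hp).1 hpe), hp]
      rw [swapV_of_not_isEnd e hpe]
      by_cases hqe : IsEnd e q
      · obtain ⟨y, hye, hy⟩ : ∃ y, IsEnd e y ∧ newLabels e x.LW pink A' i = some y := by
          rcases newLabels_onEdge e hi ((onEdge_iff e hq).2 hqe) (A := A') with h | h
          · exact ⟨_, Or.inl rfl, h⟩
          · exact ⟨_, Or.inr rfl, h⟩
        rw [h3, hy, Option.map_some, Option.map_some, swapV_of_not_isEnd e hpe]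
        rw [isEnd_swap_sum e (fun z => f (some p) (some z)) hye hqe, add_comm]
      · have h4 : newLabels e x.LW pink A' i = some q := by
          rw [newLabels_off e (fun j hj => (hpink j hj).2) (mt (onEdge_iff e hq).1 hqe), hq]
        rw [h3, h4, Option.map_some, Option.map_some, swapV_of_not_isEnd e hpe,
          swapV_of_not_isEnd e hqe]
  rw [← mul_add, ← hsum, ← two_mul, ← mul_assoc, ENNReal.inv_mul_cancel two_ne_zero
    (by simp), one_mul]

/-! ### The probability that a pair on the ringing edge becomes pink -/

theorem pexp_pinkWhiteLaw (pink : Finset (Fin K)) (onFst : Finset (Token K)) {i : Fin K}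
    (hi : x.LR i ≠ none) :
    pexp (pinkWhiteLaw a b e x B' pink onFst) (fun y => if y.LR i = none then 1 else 0) =
      if i ∈ pink then 1 else 0 := by
  unfold pinkWhiteLaw
  rw [pexp_bind]
  refine Eq.trans (pexp_congr fun c _ => ?_) (pexp_const _ _)
  rw [pexp_map]
  refine Eq.trans (pexp_congr fun wh _ => ?_) (pexp_const _ _)
  simp [outcome, newLabels_eq_none, hi]

theorem pexp_afterLowLaw (A low : Finset (Token K)) {i : Fin K} (hi : OnEdge e x.LR i)
    (hi' : OnEdge e x.LW i) :
    pexp (afterLowLaw a b e x B' A low) (fun y => if y.LR i = none then 1 else 0) =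
      if Sum.inl i ∈ A then 0
      else coin (2 * min (theta a b e x B') (1 - theta a b e x B')) true := by
  have hn : x.LR i ≠ none := by
    rcases hi with h | h <;> rw [h] <;> simp
  unfold afterLowLaw
  rw [pexp_bind]
  have : ∀ fork, pexp ((restLaw a b e x B' A fork).bind fun restOnV =>
      pinkWhiteLaw a b e x B' (pinkSet e x A fork) (low ∪ restOnV))
      (fun y => if y.LR i = none then 1 else 0) =
      if i ∈ pinkSet e x A fork then 1 else 0 := fun fork => by
    rw [pexp_bind]
    refine Eq.trans (pexp_congr fun r _ => ?_) (pexp_const _ _)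
    exact pexp_pinkWhiteLaw e _ _ hn
  simp only [this, mem_pinkSet, hi, hi', and_true]
  unfold pexp
  rw [tsum_fintype, Fintype.sum_bool]
  by_cases h : Sum.inl i ∈ A <;> simp [h]

/-- A label with both particles on the edge is lost exactly when its red particle is not drawn for
the lower bounds and Step 3a is chosen. Only the second draw `A₂` can contain it, since `A₁`
consists of non-paired particles, and the coin for Step 3a is independent of the draws. -/
theorem pexp_stepLaw_none {i : Fin K} (hi : OnEdge e x.LR i) (hi' : OnEdge e x.LW i)
    (hd : lowR a b e x B' (v₂ e) + lowR a b e x B' (v₁ e) - (nonPairedReds e x).card ≤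
      (pairedReds e x).card) :
    pexp (stepLaw a b e x B') (fun y => if y.LR i = none then 1 else 0) =
      ENNReal.ofReal ((((pairedReds e x).card : ℝ) - (lowR a b e x B' (v₂ e) +
        lowR a b e x B' (v₁ e) - (nonPairedReds e x).card : ℕ)) / (pairedReds e x).card) *
      coin (2 * min (theta a b e x B') (1 - theta a b e x B')) true := by
  have hp : (Sum.inl i : Token K) ∈ pairedReds e x := (inl_mem_pairedReds e).2 ⟨hi, hi'⟩
  rw [stepLaw_eq, pexp_bind]
  refine Eq.trans (pexp_congr fun A₁ hA₁ => ?_) (pexp_const _ _)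
  rw [mem_support_uniformSubset] at hA₁
  have hA₁i : (Sum.inl i : Token K) ∉ A₁ := fun h => (Finset.mem_sdiff.1 (hA₁.1 h)).2 hp
  rw [pexp_bind, ← pexp_uniformSubset_notMem hd hp]
  unfold pexp
  rw [← ENNReal.tsum_mul_right]
  refine tsum_congr fun A₂ => ?_
  rw [mul_assoc]
  congr 1
  change pexp _ _ = _
  rw [pexp_bind]
  refine Eq.trans (pexp_congr fun low _ => pexp_afterLowLaw e _ low hi hi') ?_
  rw [pexp_const]
  by_cases h : Sum.inl i ∈ A₂ <;> simp [h, hA₁i]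

/-- Each of the two factors in `pexp_stepLaw_none` is at least `2t`: the first one by counting, the
second one by `theta_bounds`. -/
theorem le_pexp_stepLaw_none (ha : 0 < a) (hb : 0 < b) (hx : x.Valid a b m)
    (hM : MovedAlong e x.B B') {i : Fin K} (hi : OnEdge e x.LR i) (hi' : OnEdge e x.LW i)
    {t : ℝ} (ht : 0 ≤ t) (ht₁ : t * ((chi a b (B' (v₁ e)) : ℝ) + chi a b (B' (v₂ e))) ≤
      chi a b (B' (v₁ e)))
    (ht₂ : t * ((chi a b (B' (v₁ e)) : ℝ) + chi a b (B' (v₂ e))) ≤ chi a b (B' (v₂ e))) :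
    ENNReal.ofReal (2 * t * (2 * t)) ≤
      pexp (stepLaw a b e x B') (fun y => if y.LR i = none then 1 else 0) := by
  have hW := hx.onEdge_W e hM
  have hp : (Sum.inl i : Token K) ∈ pairedReds e x := (inl_mem_pairedReds e).2 ⟨hi, hi'⟩
  have hn1 : 1 ≤ (pairedReds e x).card := Finset.card_pos.2 ⟨_, hp⟩
  have hnadd := card_pairedReds_add e (x := x)
  rw [hx.card_redPool] at hnadd
  have hnW : (pairedReds e x).card ≤ onEdge e (x.W a b) := by
    rw [← card_pool e hx.white]
    refine Finset.card_le_card fun t ht => ?_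
    cases t with
    | inl j => exact (inl_mem_pool e).2 ((inl_mem_pairedReds e).1 ht).2
    | inr j => simp [pairedReds] at ht
  have hc₁ : 1 ≤ chi a b (B' (v₁ e)) := by unfold chi; omega
  have hc₂ : 1 ≤ chi a b (B' (v₂ e)) := by unfold chi; omega
  have hl₂ : lowR a b e x B' (v₂ e) = onEdge e x.R - chi a b (B' (v₂ e)) := rfl
  have hl₁ : lowR a b e x B' (v₁ e) = onEdge e x.R - chi a b (B' (v₁ e)) := rfl
  have hd : lowR a b e x B' (v₂ e) + lowR a b e x B' (v₁ e) - (nonPairedReds e x).card ≤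
      (pairedReds e x).card := by omega
  rw [pexp_stepLaw_none e hi hi' hd]
  -- If paired particles have to serve the lower bounds, then the number left is `R` minus these
  -- bounds, that is `c₁`, `c₂` or `c₁ + c₂ - R`. The last value is at least the number of white
  -- particles, hence at least the number of pairs.
  have hkeep : min (pairedReds e x).card (min (chi a b (B' (v₁ e))) (chi a b (B' (v₂ e)))) ≤
      (pairedReds e x).card - (lowR a b e x B' (v₂ e) + lowR a b e x B' (v₁ e) -
        (nonPairedReds e x).card) := by omega
  have hn2 : 2 * (pairedReds e x).card ≤ chi a b (B' (v₁ e)) + chi a b (B' (v₂ e)) := by omega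
  have hθ := theta_bounds e ha hb hM rfl rfl rfl rfl
    (by exact_mod_cast (show onEdge e x.R + onEdge e x.P ≤
      chi a b (B' (v₁ e)) + chi a b (B' (v₂ e)) by omega))
    -- A pair on the edge means at least one red and one white particle there. So the capacities
    -- exceed the number of red ones, and the upper and lower bounds for red differ.
    (by
      have h1 : onEdge e x.R < min (chi a b (B' (v₁ e))) (onEdge e x.R) +
          min (chi a b (B' (v₂ e))) (onEdge e x.R) := by omega
      have h2 : onEdge e x.R + onEdge e x.P ≤
          min (chi a b (B' (v₁ e))) (onEdge e x.R + onEdge e x.P) +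
          min (chi a b (B' (v₂ e))) (onEdge e x.R + onEdge e x.P) := by omega
      have h1' := (Nat.cast_lt (α := ℝ)).2 h1
      have h2' := (Nat.cast_le (α := ℝ)).2 h2
      push_cast at h1' h2'
      linarith)
  rw [← Nat.cast_sub hd]
  generalize lowR a b e x B' (v₂ e) + lowR a b e x B' (v₁ e) - (nonPairedReds e x).card = d at *
  generalize (pairedReds e x).card - d = d' at *
  generalize (pairedReds e x).card = n at *
  generalize theta a b e x B' = θ at *
  generalize chi a b (B' (v₁ e)) = c₁ at *
  generalize chi a b (B' (v₂ e)) = c₂ at *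
  have hc₁' : (1 : ℝ) ≤ c₁ := by exact_mod_cast hc₁
  have hc₂' : (1 : ℝ) ≤ c₂ := by exact_mod_cast hc₂
  have hn1' : (1 : ℝ) ≤ n := by exact_mod_cast hn1
  have hn2' : 2 * (n : ℝ) ≤ c₁ + c₂ := by exact_mod_cast hn2
  have htmin : t ≤ min (c₁ : ℝ) c₂ / (c₁ + c₂) := by
    rw [le_div_iff₀ (by linarith)]
    exact le_min ht₁ ht₂
  have ht_half : 2 * t ≤ 1 := by nlinarith
  rw [ENNReal.ofReal_mul (by linarith)]
  refine mul_le_mul' (ENNReal.ofReal_le_ofReal ?_) ?_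
  · rw [le_div_iff₀ (by linarith)]
    have hkeep' : min (n : ℝ) (min (c₁ : ℝ) c₂) ≤ d' := by exact_mod_cast hkeep
    -- Every pair occupies two places, so `2 n ≤ c₁ + c₂`, and `2 t n ≤ t (c₁ + c₂)` is at most `c₁`
    -- and at most `c₂`.
    refine le_trans (le_min ?_ (le_min ?_ ?_)) hkeep'
    · nlinarith
    · nlinarith
    · nlinarith
  · rw [coin_apply_true]
    refine le_min (ENNReal.ofReal_le_ofReal ?_) ?_
    · have : t ≤ min θ (1 - θ) := le_min (htmin.trans hθ.1) (htmin.trans hθ.2)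
      linarith
    · rw [← ENNReal.ofReal_one]
      exact ENNReal.ofReal_le_ofReal ht_half

/-- For `N = 2` the only outcome between `N/3` and `2N/3` is `k = 1`. -/
theorem IsEvenSplitBound.le_div {s : ℝ} (hs : 0 < s) (hm : 2 ≤ m) {p : ℝ}
    (hp : IsEvenSplitBound s m p) : p ≤ s / (1 + 2 * s) := by
  have h := hp.near_even 2 le_rfl hm
  rw [show (Finset.range (2 + 1)).filter (fun k => 2 ≤ 3 * k ∧ 3 * k ≤ 2 * 2) = {1} by decide,
    Finset.sum_singleton, betaBin_two_one hs] at h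
  exact h

theorem le_stepMean_none (ha : 0 < a) (hb : 0 < b) (hm : 2 ≤ m) (hx : x.Valid a b m) {p : ℝ}
    (hp : IsEvenSplitBound ((b : ℝ) / a) m p) {i : Fin K} (hi : OnEdge e x.LR i)
    (hi' : OnEdge e x.LW i) :
    ENNReal.ofReal (p ^ 2 / (2 * a)) ≤
      stepMean a b e x (fun y => if y.LR i = none then 1 else 0) := by
  have ha' : (1 : ℝ) ≤ a := by exact_mod_cast ha
  have hb' : (1 : ℝ) ≤ b := by exact_mod_cast hb
  have hs : (0 : ℝ) < (b : ℝ) / a := by positivity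
  have hp0 := hp.pos
  have hp3 := hp.lt_third
  have hpa : p ^ 2 / (2 * a) ≤ p ^ 2 / 2 := by
    gcongr
    linarith
  rw [stepMean_eq e ha hb]
  set N := x.B (v₁ e) + x.B (v₂ e) with hN
  have hNm : N ≤ m := by
    have h1 : N ≤ ∑ z, x.B z := by
      rw [hN, ← Finset.sum_pair (v₁_ne_v₂ e)]
      exact Finset.sum_le_sum_of_subset (Finset.subset_univ _)
    have := hx.sumB
    omega
  have hchi : ∀ k ≤ N, (chi a b (setEnds e x.B k (N - k) (v₁ e)) : ℝ) = a * k + b ∧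
      (chi a b (setEnds e x.B k (N - k) (v₂ e)) : ℝ) = a * (N - k) + b := fun k hk => by
    rw [setEnds_v₁, setEnds_v₂]
    unfold chi
    push_cast [Nat.cast_sub hk]
    exact ⟨rfl, rfl⟩
  by_cases hN2 : 2 ≤ N
  -- Only nearly even splits are counted. They leave each end-vertex at least a third of the
  -- capacity, hence a pinkening probability of at least `4/9`.
  · have h := hp.near_even N hN2 hNm
    refine le_trans ?_ (Finset.sum_le_sum_of_subset (Finset.filter_subset
      (fun k => N ≤ 3 * k ∧ 3 * k ≤ 2 * N) (Finset.range (N + 1))))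
    have h49 : ∀ k ∈ (Finset.range (N + 1)).filter (fun k => N ≤ 3 * k ∧ 3 * k ≤ 2 * N),
        ENNReal.ofReal (betaBin ((b : ℝ) / a) N k) * ENNReal.ofReal (2 * (1 / 3) * (2 * (1 / 3))) ≤
        ENNReal.ofReal (betaBin ((b : ℝ) / a) N k) * pexp (stepLaw a b e x
          (setEnds e x.B k (N - k))) (fun y => if y.LR i = none then 1 else 0) := by
      intro k hk
      obtain ⟨hk1, hk2, hk3⟩ := Finset.mem_filter.1 hk
      have hkN := Nat.lt_succ_iff.1 (Finset.mem_range.1 hk1)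
      have hk2' : (N : ℝ) ≤ 3 * k := by exact_mod_cast hk2
      have hk3' : 3 * (k : ℝ) ≤ 2 * N := by exact_mod_cast hk3
      refine mul_le_mul_right (le_pexp_stepLaw_none e ha hb hx
        (movedAlong_setEnds e x.B hkN) hi hi' (by norm_num) ?_ ?_) _
      · rw [(hchi k hkN).1, (hchi k hkN).2]
        nlinarith
      · rw [(hchi k hkN).1, (hchi k hkN).2]
        nlinarith
    refine le_trans ?_ (Finset.sum_le_sum h49)
    rw [← Finset.sum_mul, ← ENNReal.ofReal_sum_of_nonneg fun k hk => (betaBin_pos hs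
      (Nat.lt_succ_iff.1 (Finset.mem_range.1 (Finset.mem_filter.1 hk).1))).le,
      ← ENNReal.ofReal_mul (hp0.le.trans h)]
    refine ENNReal.ofReal_le_ofReal ?_
    nlinarith
  -- With at most one black particle, the smaller capacity has a share of at least `b / (a + 2b)`,
  -- which is at least `p` by the case `N = 2` of the even-split bound. So `t = p` serves for every
  -- split.
  · have hle := hp.le_div hs hm
    rw [show (b : ℝ) / a / (1 + 2 * (b / a)) = b / (a + 2 * b) by field_simp,
      le_div_iff₀ (by positivity)] at hle
    have hk4 : ∀ k ∈ Finset.range (N + 1),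
        ENNReal.ofReal (betaBin ((b : ℝ) / a) N k) * ENNReal.ofReal (2 * p * (2 * p)) ≤
        ENNReal.ofReal (betaBin ((b : ℝ) / a) N k) * pexp (stepLaw a b e x
          (setEnds e x.B k (N - k))) (fun y => if y.LR i = none then 1 else 0) := by
      intro k hk
      have hkN := Nat.lt_succ_iff.1 (Finset.mem_range.1 hk)
      have hk' : (k : ℝ) ≤ N := by exact_mod_cast hkN
      have hN1 : (N : ℝ) ≤ 1 := by exact_mod_cast (show N ≤ 1 by omega)
      have hk0 : (0 : ℝ) ≤ k := k.cast_nonneg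
      refine mul_le_mul_right (le_pexp_stepLaw_none e ha hb hx
        (movedAlong_setEnds e x.B hkN) hi hi' hp0.le ?_ ?_) _
      · rw [(hchi k hkN).1, (hchi k hkN).2]
        nlinarith [mul_nonneg hp0.le (sub_nonneg.2 hN1), mul_nonneg (mul_nonneg hp0.le
          (sub_nonneg.2 hN1)) (zero_le_one.trans ha'), mul_nonneg hk0 (zero_le_one.trans ha')]
      · rw [(hchi k hkN).1, (hchi k hkN).2]
        nlinarith [mul_nonneg hp0.le (sub_nonneg.2 hN1), mul_nonneg (mul_nonneg hp0.le
          (sub_nonneg.2 hN1)) (zero_le_one.trans ha'), mul_nonneg (sub_nonneg.2 hk')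
          (zero_le_one.trans ha')]
    refine le_trans ?_ (Finset.sum_le_sum hk4)
    rw [← Finset.sum_mul, sum_ofReal_betaBin hs, one_mul]
    refine ENNReal.ofReal_le_ofReal ?_
    nlinarith

theorem stepMean_alive_le (ha : 0 < a) (hb : 0 < b) (hm : 2 ≤ m) (hx : x.Valid a b m) {p : ℝ}
    (hp : IsEvenSplitBound ((b : ℝ) / a) m p) {i : Fin K} (hi : OnEdge e x.LR i)
    (hi' : OnEdge e x.LW i) :
    stepMean a b e x (fun y => if y.LR i = none then 0 else 1) ≤
      1 - ENNReal.ofReal (p ^ 2 / (2 * a)) := by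
  have h := le_stepMean_none e ha hb hm hx hp hi hi'
  have hsum : stepMean a b e x (fun y => if y.LR i = none then 0 else 1) +
      stepMean a b e x (fun y => if y.LR i = none then 1 else 0) = 1 := by
    rw [← stepMean_add e ha hb]
    refine Eq.trans ?_ (stepMean_const e (a := a) (b := b) (x := x) 1)
    congr 1
    funext y
    split_ifs <;> simp
  exact ENNReal.le_sub_of_add_le_right ENNReal.ofReal_ne_top
    ((add_le_add le_rfl h).trans hsum.le)

end Movement

end Chameleon

namespace Chameleon

/-! ### The law of the rings -/

section Rings

variable {V : Type*} [Fintype V] [LinearOrder V] (G : WeightedGraph V)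

theorem WeightedGraph.nonempty_edge [Nontrivial V] : Nonempty G.Edge := by
  obtain ⟨x, y, hxy⟩ := exists_pair_ne V
  obtain ⟨z, hz⟩ := G.connected.preconnected.exists_adj_of_nontrivial x
  exact ⟨⟨s(x, z), hz⟩⟩

theorem WeightedGraph.totalRate_pos [Nontrivial V] : 0 < G.totalRate := by
  have := G.nonempty_edge
  exact Finset.sum_pos (fun e _ => G.rate_pos e) Finset.univ_nonempty

theorem WeightedGraph.sum_rate_div [Nontrivial V] :
    ∑ e : G.Edge, ENNReal.ofReal (G.rate e / G.totalRate) = 1 := by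
  have h := G.totalRate_pos
  rw [← ENNReal.ofReal_sum_of_nonneg fun e _ => (div_pos (G.rate_pos e) h).le, ← Finset.sum_div]
  rw [show ∑ e : G.Edge, G.rate e = G.totalRate from rfl, div_self h.ne', ENNReal.ofReal_one]

instance [Nontrivial V] : IsProbabilityMeasure G.edgeLaw := by
  refine ⟨?_⟩
  unfold WeightedGraph.edgeLaw
  simp only [Measure.coe_finsetSum, Measure.coe_smul, Finset.sum_apply, Pi.smul_apply,
    measure_univ, smul_eq_mul, mul_one]
  exact G.sum_rate_div

instance [Nontrivial V] : IsProbabilityMeasure G.ringLaw := by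
  have := ProbabilityTheory.isProbabilityMeasure_expMeasure G.totalRate_pos
  unfold WeightedGraph.ringLaw
  infer_instance

theorem lintegral_edgeLaw (f : G.Edge → ℝ≥0∞) :
    ∫⁻ e, f e ∂G.edgeLaw = ∑ e : G.Edge, ENNReal.ofReal (G.rate e / G.totalRate) * f e := by
  unfold WeightedGraph.edgeLaw
  rw [lintegral_finsetSum_measure]
  refine Finset.sum_congr rfl fun e _ => ?_
  rw [lintegral_smul_measure, lintegral_dirac, smul_eq_mul]

theorem ringLaw_ae_pos [Nontrivial V] : ∀ᵐ x ∂G.ringLaw, 0 < x.1 := by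
  have := ProbabilityTheory.isProbabilityMeasure_expMeasure G.totalRate_pos
  exact Measure.quasiMeasurePreserving_fst.ae (expMeasure_ae_pos G.totalRate)

end Rings

/-! ### First-step analysis of the meeting time -/

section Meeting

variable {V : Type*} [Fintype V] [LinearOrder V] {G : WeightedGraph V}

theorem walkPos_succ (i : V) (ω : ℕ → ℝ × G.Edge) (k : ℕ) :
    walkPos i ω (k + 1) = swapV (ω k).2 (walkPos i ω k) := by
  simp only [walkPos, swapV, Equiv.swap_apply_def]

theorem walkPos_tail (i : V) (ω : ℕ → ℝ × G.Edge) (k : ℕ) :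
    walkPos i ω (k + 1) = walkPos (swapV (ω 0).2 i) (fun n => ω (n + 1)) k := by
  induction k with
  | zero => rw [walkPos_succ]; rfl
  | succ k ih => rw [walkPos_succ, ih, walkPos_succ]

theorem walkPos_congr (i : V) {ω ω' : ℕ → ℝ × G.Edge} (h : ∀ n, (ω n).2 = (ω' n).2) (k : ℕ) :
    walkPos i ω k = walkPos i ω' k := by
  induction k with
  | zero => rfl
  | succ k ih => rw [walkPos_succ, walkPos_succ, ih, h]

/-- The ring sequence seen from time `g`, before its first ring. -/
def waitFor (g : ℝ) (ω : ℕ → ℝ × G.Edge) : ℕ → ℝ × G.Edge :=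
  consSeq ((ω 0).1 - g, (ω 0).2) fun n => ω (n + 1)

theorem waitFor_snd (g : ℝ) (ω : ℕ → ℝ × G.Edge) (n : ℕ) : (ω n).2 = (waitFor g ω n).2 := by
  cases n <;> rfl

theorem ringTime_waitFor (g : ℝ) (ω : ℕ → ℝ × G.Edge) (k : ℕ) :
    ringTime (fun l => (waitFor g ω l).1) (k + 1) = ringTime (fun l => (ω l).1) (k + 1) - g := by
  rw [ringTime_succ, ringTime_succ]
  simp only [waitFor, consSeq_zero, consSeq_succ]
  ring

theorem walkBefore_waitFor (i : V) (g t : ℝ) (ω : ℕ → ℝ × G.Edge) :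
    walkBefore i ω t = walkBefore i (waitFor g ω) (t - g) := by
  unfold walkBefore ringsBefore
  simp only [ringTime_waitFor, sub_le_sub_iff_right]
  exact walkPos_congr i (waitFor_snd g ω) _

theorem ringTime_nonneg {g : ℕ → ℝ} (h : ∀ k, 0 < g k) (k : ℕ) : 0 ≤ ringTime g k :=
  Finset.sum_nonneg fun l _ => (h l).le

/-- Before its own first ring, which comes later, the second walk is still at `j`. So a meeting at
the very first ring happens on the edge between `i` and `j`; any later one is a meeting for the
process restarted at that ring. -/
theorem MeetsAt.first {i j : V} {ω ω' : ℕ → ℝ × G.Edge} {t : ℝ}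
    (hω : GoodGaps fun l => (ω l).1) (hlt : (ω 0).1 < (ω' 0).1) (h : MeetsAt i j ω ω' t) :
    (ω 0).1 ≤ t ∧ (((ω 0).2 : Sym2 V) = s(i, j) ∨
      MeetsAt (swapV (ω 0).2 i) j (fun n => ω (n + 1)) (waitFor (ω 0).1 ω') (t - (ω 0).1)) := by
  obtain ⟨k, rfl, hk⟩ := h
  rw [ringTime_succ] at hk ⊢
  refine ⟨le_add_of_nonneg_right (ringTime_nonneg hω.tail.1 k), ?_⟩
  cases k with
  | zero =>
    left
    rw [hk]
    congr 2
    unfold walkBefore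
    rw [ringsBefore_eq_zero]
    · rfl
    · simpa [ringTime] using hlt.le
  | succ k =>
    right
    refine ⟨k, by ring, ?_⟩
    rw [← walkPos_tail, ← walkBefore_waitFor]
    exact hk

theorem MeetsAt.second {i j : V} {ω ω' : ℕ → ℝ × G.Edge} {t : ℝ}
    (hω : GoodGaps fun l => (ω l).1) (hω' : GoodGaps fun l => (ω' l).1)
    (hlt : (ω 0).1 < (ω' 0).1) (h : MeetsAt j i ω' ω t) :
    (ω 0).1 ≤ t ∧
      MeetsAt j (swapV (ω 0).2 i) (waitFor (ω 0).1 ω') (fun n => ω (n + 1)) (t - (ω 0).1) := by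
  obtain ⟨k, rfl, hk⟩ := h
  have hgt : (ω 0).1 < ringTime (fun l => (ω' l).1) (k + 1) := by
    rw [ringTime_succ]
    have := ringTime_nonneg hω'.tail.1 k
    linarith
  refine ⟨hgt.le, k, (ringTime_waitFor _ _ _).symm, ?_⟩
  have hb : walkBefore i ω (ringTime (fun l => (ω' l).1) (k + 1)) =
      walkBefore (swapV (ω 0).2 i) (fun n => ω (n + 1))
        (ringTime (fun l => (ω' l).1) (k + 1) - (ω 0).1) := by
    unfold walkBefore
    rw [ringsBefore_succ hω hgt, walkPos_tail]
  rw [← waitFor_snd, ← walkPos_congr j (waitFor_snd _ ω'), hk, hb]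

theorem meetTime_comm (i j : V) (ω ω' : ℕ → ℝ × G.Edge) :
    meetTime i j ω ω' = meetTime j i ω' ω := by
  unfold meetTime
  simp only [eq_comm (a := i), or_comm]

theorem isEnd_and_isEnd (e : G.Edge) {i j : V} (hij : i ≠ j) :
    IsEnd e i ∧ IsEnd e j ↔ (e : Sym2 V) = s(i, j) := by
  rw [edge_eq e, Sym2.eq_iff]
  unfold IsEnd
  constructor
  · rintro ⟨rfl | rfl, rfl | rfl⟩
    · exact absurd rfl hij
    · exact Or.inl ⟨rfl, rfl⟩
    · exact Or.inr ⟨rfl, rfl⟩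
    · exact absurd rfl hij
  · rintro (⟨rfl, rfl⟩ | ⟨rfl, rfl⟩)
    · exact ⟨Or.inl rfl, Or.inr rfl⟩
    · exact ⟨Or.inr rfl, Or.inl rfl⟩

theorem swapV_ne_of (e : G.Edge) {i j : V} (hij : i ≠ j) (h : ¬ (IsEnd e i ∧ IsEnd e j)) :
    swapV e i ≠ j := by
  rintro rfl
  by_cases hi : IsEnd e i
  · refine h ⟨hi, ?_⟩
    rcases hi with rfl | rfl
    · rw [swapV_v₁]; exact Or.inr rfl
    · rw [swapV_v₂]; exact Or.inl rfl
  · exact hij (swapV_of_not_isEnd e hi).symm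

open Classical in
-- Only this inequality is needed, since the meeting times serve as upper bounds. Unless the first
-- ring joins the walks, they are still on different vertices after it, so the convention of meeting
-- time `0` at a common vertex does not interfere.
theorem le_meetTime {i j : V} (hij : i ≠ j) {ω ω' : ℕ → ℝ × G.Edge}
    (hω : GoodGaps fun l => (ω l).1) (hω' : GoodGaps fun l => (ω' l).1)
    (hlt : (ω 0).1 < (ω' 0).1) :
    ENNReal.ofReal (ω 0).1 + (if IsEnd (ω 0).2 i ∧ IsEnd (ω 0).2 j then 0 else
      meetTime (swapV (ω 0).2 i) j (fun n => ω (n + 1)) (waitFor (ω 0).1 ω')) ≤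
      meetTime i j ω ω' := by
  conv_rhs => rw [meetTime, if_neg hij]
  refine le_sInf ?_
  rintro _ ⟨t, ht, rfl⟩
  have hge : (ω 0).1 ≤ t := by
    rcases ht with ht | ht
    · exact (ht.first hω hlt).1
    · exact (ht.second hω hω' hlt).1
  split_ifs with he
  · rw [add_zero]
    exact ENNReal.ofReal_le_ofReal hge
  · have hmt : MeetsAt (swapV (ω 0).2 i) j (fun n => ω (n + 1)) (waitFor (ω 0).1 ω')
        (t - (ω 0).1) ∨ MeetsAt j (swapV (ω 0).2 i) (waitFor (ω 0).1 ω') (fun n => ω (n + 1))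
        (t - (ω 0).1) := by
      rcases ht with ht | ht
      · rcases (ht.first hω hlt).2 with h | h
        · exact absurd ((isEnd_and_isEnd _ hij).2 h) he
        · exact Or.inl h
      · exact Or.inr (ht.second hω hω' hlt).2
    rw [meetTime, if_neg (swapV_ne_of _ hij he)]
    calc ENNReal.ofReal (ω 0).1 + _ ≤ ENNReal.ofReal (ω 0).1 + ENNReal.ofReal (t - (ω 0).1) := by
          gcongr
          exact sInf_le ⟨_, hmt, rfl⟩
      _ = ENNReal.ofReal t := by
          rw [← ENNReal.ofReal_add (hω.1 0).le (sub_nonneg.2 hge)]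
          ring_nf

/-! ### Expected meeting times: integration over the first ring -/

variable [Nontrivial V]

/-- The law of the sequence of rings. -/
abbrev WeightedGraph.ringsLaw (G : WeightedGraph V) : Measure (ℕ → ℝ × G.Edge) :=
  Measure.infinitePi fun _ : ℕ => G.ringLaw

theorem measurable_waitFor : Measurable fun p : ℝ × (ℕ → ℝ × G.Edge) => waitFor p.1 p.2 := by
  refine measurable_consSeq.comp (Measurable.prodMk (Measurable.prodMk ?_ ?_) ?_)
  · exact (measurable_fst.comp ((measurable_pi_apply 0).comp measurable_snd)).sub measurable_fst
  · exact measurable_snd.comp ((measurable_pi_apply 0).comp measurable_snd)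
  · exact measurable_pi_lambda _ fun n => (measurable_pi_apply (n + 1)).comp measurable_snd

/-- The memoryless property of the rings. -/
theorem lintegral_waitFor {f : ℝ → (ℕ → ℝ × G.Edge) → ℝ≥0∞}
    (hf : Measurable (Function.uncurry f)) :
    ∫⁻ g, ∫⁻ ω, (if g < (ω 0).1 then f g (waitFor g ω) else 0) ∂G.ringsLaw
        ∂(ProbabilityTheory.expMeasure G.totalRate) =
      2⁻¹ * ∫⁻ g, ∫⁻ ω, f g ω ∂G.ringsLaw
        ∂(ProbabilityTheory.expMeasure (2 * G.totalRate)) := by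
  have := ProbabilityTheory.isProbabilityMeasure_expMeasure G.totalRate_pos
  set φ : ℝ → ℝ → ℝ≥0∞ := fun g d => ∫⁻ e, ∫⁻ s, f g (consSeq (d, e) s) ∂G.ringsLaw ∂G.edgeLaw
    with hφ
  have hcons : Measurable fun p : ((ℝ × ℝ) × G.Edge) × (ℕ → ℝ × G.Edge) =>
      f p.1.1.1 (consSeq (p.1.1.2, p.1.2) p.2) := by
    have h1 : Measurable fun p : ((ℝ × ℝ) × G.Edge) × (ℕ → ℝ × G.Edge) => p.1.1 :=
      measurable_fst.fst
    have h2 : Measurable fun p : ((ℝ × ℝ) × G.Edge) × (ℕ → ℝ × G.Edge) => p.1.2 :=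
      measurable_fst.snd
    exact hf.comp (h1.fst.prodMk
      (measurable_consSeq.comp ((h1.snd.prodMk h2).prodMk measurable_snd)))
  have hφm : Measurable (Function.uncurry φ) := by
    refine Measurable.lintegral_prod_right' (f := fun p : (ℝ × ℝ) × G.Edge =>
      ∫⁻ s, f p.1.1 (consSeq (p.1.2, p.2) s) ∂G.ringsLaw) ?_
    exact Measurable.lintegral_prod_right' hcons
  have hin : ∀ g : ℝ, ∀ F : (ℕ → ℝ × G.Edge) → ℝ≥0∞, Measurable F →
      ∫⁻ ω, F ω ∂G.ringsLaw = ∫⁻ d, ∫⁻ e, ∫⁻ s, F (consSeq (d, e) s) ∂G.ringsLaw ∂G.edgeLaw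
        ∂(ProbabilityTheory.expMeasure G.totalRate) := by
    intro g F hF
    rw [lintegral_consSeq _ hF]
    have hm : Measurable fun a : ℝ × G.Edge => ∫⁻ s, F (consSeq a s) ∂G.ringsLaw :=
      Measurable.lintegral_prod_right' (f := fun p : (ℝ × G.Edge) × (ℕ → ℝ × G.Edge) =>
        F (consSeq p.1 p.2)) (hF.comp measurable_consSeq)
    exact lintegral_prod _ hm.aemeasurable
  rw [show (∫⁻ g, ∫⁻ ω, f g ω ∂G.ringsLaw ∂(ProbabilityTheory.expMeasure (2 * G.totalRate))) =
    ∫⁻ g, ∫⁻ d, φ g d ∂(ProbabilityTheory.expMeasure G.totalRate)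
      ∂(ProbabilityTheory.expMeasure (2 * G.totalRate)) from
      lintegral_congr fun g => hin g _ hf.of_uncurry_left,
    ← lintegral_expMeasure_lt G.totalRate_pos hφm]
  refine lintegral_congr fun g => ?_
  rw [hin g]
  · refine lintegral_congr fun d => ?_
    by_cases hgd : g < d
    · rw [if_pos hgd]
      exact lintegral_congr fun e => lintegral_congr fun s => if_pos hgd
    · rw [if_neg hgd]
      refine (lintegral_congr fun e => lintegral_congr fun s => if_neg hgd).trans ?_
      simp
  · refine Measurable.ite ?_ (hf.comp (measurable_const.prodMk
      (measurable_waitFor.comp measurable_prodMk_left))) measurable_const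
    exact measurableSet_lt measurable_const (measurable_fst.comp (measurable_pi_apply 0))

/-- The first waiting time becomes the innermost variable, which is the form needed for the
memoryless property with the rest of the sequence and the first edge fixed. -/
theorem lintegral_rings {F : (ℕ → ℝ × G.Edge) → ℝ≥0∞} (hF : Measurable F) :
    ∫⁻ ω, F ω ∂G.ringsLaw = ∫⁻ s, ∫⁻ e, ∫⁻ g, F (consSeq (g, e) s)
      ∂(ProbabilityTheory.expMeasure G.totalRate) ∂G.edgeLaw ∂G.ringsLaw := by
  have := ProbabilityTheory.isProbabilityMeasure_expMeasure G.totalRate_pos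
  have hm := hF.comp (measurable_consSeq (X := ℝ × G.Edge))
  conv_lhs =>
    change ∫⁻ ω, F ω ∂(Measure.infinitePi fun _ : ℕ => G.ringLaw)
    rw [← map_consSeq G.ringLaw]
  rw [lintegral_map hF measurable_consSeq]
  refine (lintegral_prod_symm _ hm.aemeasurable).trans ?_
  refine lintegral_congr fun s => ?_
  exact lintegral_prod_symm _ (hm.comp measurable_prodMk_right).aemeasurable

open Classical in
/-- The contribution of the event that the first walk has the first ring. -/
theorem lintegral_first_ring {φ : V → (ℕ → ℝ × G.Edge) × (ℕ → ℝ × G.Edge) → ℝ≥0∞}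
    (hφ : ∀ z, Measurable (φ z)) (i j : V) :
    ∫⁻ ω, ∫⁻ ω', (if (ω 0).1 < (ω' 0).1 then ENNReal.ofReal (ω 0).1 +
        (if IsEnd (ω 0).2 i ∧ IsEnd (ω 0).2 j then 0 else
          φ (swapV (ω 0).2 i) (fun n => ω (n + 1), waitFor (ω 0).1 ω')) else 0)
        ∂G.ringsLaw ∂G.ringsLaw =
      2⁻¹ * (∫⁻ g, ENNReal.ofReal g ∂(ProbabilityTheory.expMeasure (2 * G.totalRate)) +
        ∑ e : G.Edge, ENNReal.ofReal (G.rate e / G.totalRate) *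
          (if IsEnd e i ∧ IsEnd e j then 0 else
            ∫⁻ p, φ (swapV e i) p ∂(G.ringsLaw.prod G.ringsLaw))) := by
  have := ProbabilityTheory.isProbabilityMeasure_expMeasure G.totalRate_pos
  have := ProbabilityTheory.isProbabilityMeasure_expMeasure
    (show 0 < 2 * G.totalRate from mul_pos two_pos G.totalRate_pos)
  have hψ : ∀ e : G.Edge, Measurable fun p : ((ℕ → ℝ × G.Edge) × ℝ) × (ℕ → ℝ × G.Edge) =>
      ENNReal.ofReal p.1.2 + (if IsEnd e i ∧ IsEnd e j then 0 else
        φ (swapV e i) (p.1.1, p.2)) := by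
    intro e
    refine Measurable.add measurable_fst.snd.ennreal_ofReal ?_
    split_ifs
    · exact measurable_const
    · exact (hφ _).comp (measurable_fst.fst.prodMk measurable_snd)
  have hmain : Measurable fun p : (ℕ → ℝ × G.Edge) × (ℕ → ℝ × G.Edge) =>
      (if (p.1 0).1 < (p.2 0).1 then ENNReal.ofReal (p.1 0).1 +
        (if IsEnd (p.1 0).2 i ∧ IsEnd (p.1 0).2 j then 0 else
          φ (swapV (p.1 0).2 i) (fun n => p.1 (n + 1), waitFor (p.1 0).1 p.2)) else 0) := by
    have h0 : Measurable fun p : (ℕ → ℝ × G.Edge) × (ℕ → ℝ × G.Edge) => p.1 0 :=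
      (measurable_pi_apply 0).comp measurable_fst
    have h0' : Measurable fun p : (ℕ → ℝ × G.Edge) × (ℕ → ℝ × G.Edge) => p.2 0 :=
      (measurable_pi_apply 0).comp measurable_snd
    refine Measurable.ite (measurableSet_lt h0.fst h0'.fst)
      (h0.fst.ennreal_ofReal.add ?_) measurable_const
    have hq : Measurable fun q : G.Edge × ((ℕ → ℝ × G.Edge) × (ℕ → ℝ × G.Edge)) =>
        if IsEnd q.1 i ∧ IsEnd q.1 j then 0 else φ (swapV q.1 i) q.2 := by
      refine measurable_from_prod_countable_right fun e => ?_
      by_cases he : IsEnd e i ∧ IsEnd e j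
      · simp only [he, and_self, if_true]; exact measurable_const
      · simp only [he, if_false]; exact hφ _
    refine hq.comp (h0.snd.prodMk (Measurable.prodMk ?_ ?_))
    · exact measurable_pi_lambda _ fun n => (measurable_pi_apply (n + 1)).comp measurable_fst
    · exact measurable_waitFor.comp (h0.fst.prodMk measurable_snd)
  rw [lintegral_rings hmain.lintegral_prod_right']
  have hinner : ∀ (s : ℕ → ℝ × G.Edge) (e : G.Edge),
      ∫⁻ g, ∫⁻ ω', (if g < (ω' 0).1 then ENNReal.ofReal g +
        (if IsEnd e i ∧ IsEnd e j then 0 else φ (swapV e i) (s, waitFor g ω')) else 0)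
        ∂G.ringsLaw ∂(ProbabilityTheory.expMeasure G.totalRate) =
      2⁻¹ * (∫⁻ g, ENNReal.ofReal g ∂(ProbabilityTheory.expMeasure (2 * G.totalRate)) +
        (if IsEnd e i ∧ IsEnd e j then 0 else ∫⁻ ω', φ (swapV e i) (s, ω') ∂G.ringsLaw)) := by
    intro s e
    rw [lintegral_waitFor (f := fun g ω' => ENNReal.ofReal g +
      (if IsEnd e i ∧ IsEnd e j then 0 else φ (swapV e i) (s, ω')))]
    · congr 1
      have : ∀ g : ℝ, ∫⁻ ω', (ENNReal.ofReal g +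
          (if IsEnd e i ∧ IsEnd e j then 0 else φ (swapV e i) (s, ω'))) ∂G.ringsLaw =
          ENNReal.ofReal g + (if IsEnd e i ∧ IsEnd e j then 0 else
            ∫⁻ ω', φ (swapV e i) (s, ω') ∂G.ringsLaw) := fun g => by
        rw [lintegral_add_left measurable_const, lintegral_const, measure_univ, mul_one]
        split_ifs <;> simp
      simp only [this]
      rw [lintegral_add_left ENNReal.measurable_ofReal, lintegral_const, measure_univ, mul_one]
    · exact (hψ e).comp (f := fun q : ℝ × (ℕ → ℝ × G.Edge) => ((s, q.1), q.2)) (by fun_prop)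
  have hm2 : ∀ e : G.Edge, Measurable fun s : ℕ → ℝ × G.Edge =>
      (if IsEnd e i ∧ IsEnd e j then 0 else ∫⁻ ω', φ (swapV e i) (s, ω') ∂G.ringsLaw) := by
    intro e
    split_ifs
    · exact measurable_const
    · exact (hφ _).lintegral_prod_right'
  simp only [consSeq_zero, consSeq_succ]
  refine Eq.trans (lintegral_congr fun s => lintegral_congr fun e => hinner s e) ?_
  simp only [lintegral_edgeLaw]
  rw [lintegral_finsetSum _ fun e _ => by
    exact ((measurable_const.add (hm2 e)).const_mul _).const_mul _]
  have hterm : ∀ e : G.Edge, ∫⁻ s, ENNReal.ofReal (G.rate e / G.totalRate) *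
      (2⁻¹ * (∫⁻ g, ENNReal.ofReal g ∂(ProbabilityTheory.expMeasure (2 * G.totalRate)) +
        (if IsEnd e i ∧ IsEnd e j then 0 else ∫⁻ ω', φ (swapV e i) (s, ω') ∂G.ringsLaw)))
        ∂G.ringsLaw =
      2⁻¹ * (ENNReal.ofReal (G.rate e / G.totalRate) *
        ∫⁻ g, ENNReal.ofReal g ∂(ProbabilityTheory.expMeasure (2 * G.totalRate)) +
        ENNReal.ofReal (G.rate e / G.totalRate) * (if IsEnd e i ∧ IsEnd e j then 0 else
            ∫⁻ p, φ (swapV e i) p ∂(G.ringsLaw.prod G.ringsLaw))) := by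
    intro e
    rw [lintegral_const_mul _ (by exact (measurable_const.add (hm2 e)).const_mul _),
      lintegral_const_mul _ (by exact measurable_const.add (hm2 e)),
      lintegral_add_left measurable_const, lintegral_const, measure_univ, mul_one,
      mul_left_comm, mul_add]
    congr 3
    split_ifs
    · simp
    · exact (lintegral_prod _ (hφ _).aemeasurable).symm
  rw [Finset.sum_congr rfl fun e _ => hterm e, ← Finset.mul_sum, Finset.sum_add_distrib,
    ← Finset.sum_mul, G.sum_rate_div, one_mul]

open Classical in
-- The two terms correspond to the events that the first or the second walk has the earlier first
-- ring. On each of them `le_meetTime` applies, and `lintegral_first_ring` evaluates the bound.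
theorem le_expectedMeetTime {i j : V} (hij : i ≠ j) :
    2⁻¹ * (∫⁻ g, ENNReal.ofReal g ∂(ProbabilityTheory.expMeasure (2 * G.totalRate)) +
        ∑ e : G.Edge, ENNReal.ofReal (G.rate e / G.totalRate) *
          (if IsEnd e i ∧ IsEnd e j then 0 else G.expectedMeetTime (swapV e i) j)) +
    2⁻¹ * (∫⁻ g, ENNReal.ofReal g ∂(ProbabilityTheory.expMeasure (2 * G.totalRate)) +
        ∑ e : G.Edge, ENNReal.ofReal (G.rate e / G.totalRate) *
          (if IsEnd e j ∧ IsEnd e i then 0 else G.expectedMeetTime (swapV e j) i)) ≤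
      G.expectedMeetTime i j := by
  -- Exchanging integrals requires measurable integrands. Each meeting time is therefore replaced by
  -- a measurable function below it that has the same lower integral.
  have hex : ∀ z w : V, ∃ φ : (ℕ → ℝ × G.Edge) × (ℕ → ℝ × G.Edge) → ℝ≥0∞, Measurable φ ∧
      (∀ p, φ p ≤ meetTime z w p.1 p.2) ∧ G.expectedMeetTime z w =
        ∫⁻ p, φ p ∂(G.ringsLaw.prod G.ringsLaw) := fun z w => by
    obtain ⟨φ, h1, h2, h3⟩ := exists_measurable_le_lintegral_eq (G.ringsLaw.prod G.ringsLaw)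
      fun p => meetTime z w p.1 p.2
    exact ⟨φ, h1, h2, h3⟩
  choose φ hφm hφle hφeq using hex
  simp only [hφeq _ j, hφeq _ i]
  rw [← lintegral_first_ring (fun z => hφm z j) i j, ← lintegral_first_ring (fun z => hφm z i) j i]
  set Λ : V → V → (ℕ → ℝ × G.Edge) → (ℕ → ℝ × G.Edge) → ℝ≥0∞ := fun i j ω ω' =>
    (if (ω 0).1 < (ω' 0).1 then ENNReal.ofReal (ω 0).1 +
        (if IsEnd (ω 0).2 i ∧ IsEnd (ω 0).2 j then 0 else
          φ (swapV (ω 0).2 i) j (fun n => ω (n + 1), waitFor (ω 0).1 ω')) else 0) with hΛ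
  have hΛm : ∀ i j, Measurable fun p : (ℕ → ℝ × G.Edge) × (ℕ → ℝ × G.Edge) =>
      Λ i j p.1 p.2 := by
    intro i j
    have h0 : Measurable fun p : (ℕ → ℝ × G.Edge) × (ℕ → ℝ × G.Edge) => p.1 0 :=
      (measurable_pi_apply 0).comp measurable_fst
    have h0' : Measurable fun p : (ℕ → ℝ × G.Edge) × (ℕ → ℝ × G.Edge) => p.2 0 :=
      (measurable_pi_apply 0).comp measurable_snd
    refine Measurable.ite (measurableSet_lt h0.fst h0'.fst)
      (h0.fst.ennreal_ofReal.add ?_) measurable_const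
    have hq : Measurable fun q : G.Edge × ((ℕ → ℝ × G.Edge) × (ℕ → ℝ × G.Edge)) =>
        if IsEnd q.1 i ∧ IsEnd q.1 j then 0 else φ (swapV q.1 i) j q.2 := by
      refine measurable_from_prod_countable_right fun e => ?_
      by_cases he : IsEnd e i ∧ IsEnd e j
      · simp only [he, and_self, if_true]; exact measurable_const
      · simp only [he, if_false]; exact hφm _ _
    refine hq.comp (h0.snd.prodMk (Measurable.prodMk ?_ ?_))
    · exact measurable_pi_lambda _ fun n => (measurable_pi_apply (n + 1)).comp measurable_fst
    · exact measurable_waitFor.comp (h0.fst.prodMk measurable_snd)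
  have hle : ∀ i j, i ≠ j → ∀ ω ω', GoodGaps (fun l => (ω l).1) →
      GoodGaps (fun l => (ω' l).1) → Λ i j ω ω' ≤ meetTime i j ω ω' := by
    intro i j hij ω ω' hω hω'
    simp only [hΛ]
    split_ifs with h1 h2
    · have := le_meetTime hij hω hω' h1
      rwa [if_pos h2] at this
    · have := le_meetTime hij hω hω' h1
      rw [if_neg h2] at this
      refine le_trans ?_ this
      gcongr
      exact hφle _ _ _
    · exact zero_le
  have hswap : ∫⁻ ω, ∫⁻ ω', Λ j i ω ω' ∂G.ringsLaw ∂G.ringsLaw =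
      ∫⁻ ω, ∫⁻ ω', Λ j i ω' ω ∂G.ringsLaw ∂G.ringsLaw :=
    lintegral_lintegral_swap (hΛm j i).aemeasurable
  change ∫⁻ ω, ∫⁻ ω', Λ i j ω ω' ∂G.ringsLaw ∂G.ringsLaw +
    ∫⁻ ω, ∫⁻ ω', Λ j i ω ω' ∂G.ringsLaw ∂G.ringsLaw ≤ _
  rw [hswap, ← lintegral_prod (fun p => Λ i j p.1 p.2) (hΛm i j).aemeasurable,
    ← lintegral_prod (fun p => Λ j i p.2 p.1) ((hΛm j i).comp measurable_swap).aemeasurable,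
    ← lintegral_add_left (hΛm i j), ← hφeq]
  unfold WeightedGraph.expectedMeetTime
  refine lintegral_mono_ae ?_
  have hgood := ae_goodGaps G.ringLaw measurable_fst (ringLaw_ae_pos G)
  filter_upwards [Measure.quasiMeasurePreserving_fst.ae hgood,
    Measure.quasiMeasurePreserving_snd.ae hgood] with p hp1 hp2
  -- At most one of the two terms is nonzero, and on a tie both vanish, so ties need not be shown to
  -- be null.
  rcases lt_or_ge (p.1 0).1 (p.2 0).1 with h | h
  · have : Λ j i p.2 p.1 = 0 := if_neg h.not_gt
    rw [this, add_zero]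
    exact hle i j hij _ _ hp1 hp2
  · have : Λ i j p.1 p.2 = 0 := if_neg h.not_gt
    rw [this, zero_add, meetTime_comm]
    exact hle j i hij.symm _ _ hp2 hp1

theorem expectedMeetTime_comm (i j : V) : G.expectedMeetTime i j = G.expectedMeetTime j i := by
  unfold WeightedGraph.expectedMeetTime
  conv_lhs => rw [← Measure.prod_swap]
  refine (lintegral_map_equiv (fun p => meetTime i j p.1 p.2) MeasurableEquiv.prodComm).trans ?_
  exact lintegral_congr fun p => meetTime_comm _ _ _ _

end Meeting

/-! ### The expected time until a pair is on the ringing edge -/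

section PairTime

variable {V : Type*} [Fintype V] [LinearOrder V] [Nontrivial V] (G : WeightedGraph V)

open Classical in
/-- A bound on the expected time until a pair that starts from `p` and `q` is on a ringing edge. -/
def pairTime (p q : V) : ℝ≥0∞ :=
  if p = q then ⨅ j, ⨅ _ : j ≠ p, G.half.expectedMeetTime p j else G.half.expectedMeetTime p q

open Classical in
/-- The mean of `pairTime` after a ring of `e`, and `0` if both particles are on `e`. -/
def nextPairTime (e : G.Edge) (p q : V) : ℝ≥0∞ :=
  if IsEnd e p ∧ IsEnd e q then 0
  else 2⁻¹ * pairTime G (swapV e p) q + 2⁻¹ * pairTime G p (swapV e q)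

/-- The mean waiting time between two rings. -/
def meanGap : ℝ≥0∞ := ∫⁻ g, ENNReal.ofReal g ∂(ProbabilityTheory.expMeasure G.totalRate)

/-- Needed to see that `T` is positive, so that the final inequality can be divided by it. -/
theorem meanGap_pos : 0 < meanGap G := by
  have := ProbabilityTheory.isProbabilityMeasure_expMeasure G.totalRate_pos
  rw [pos_iff_ne_zero, meanGap, Ne, lintegral_eq_zero_iff ENNReal.measurable_ofReal]
  intro h
  have : ∀ᵐ x ∂(ProbabilityTheory.expMeasure G.totalRate), False := by
    filter_upwards [h, expMeasure_ae_pos G.totalRate] with x hx hx'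
    simp only [Pi.zero_apply, ENNReal.ofReal_eq_zero] at hx
    linarith
  rw [Filter.eventually_false_iff_eq_bot, ae_eq_bot] at this
  exact IsProbabilityMeasure.ne_zero _ this

theorem totalRate_half : 2 * G.half.totalRate = G.totalRate := by
  change 2 * ∑ e : G.Edge, G.rate e / 2 = _
  rw [← Finset.sum_div, mul_div_cancel₀ _ two_ne_zero]
  rfl

theorem half_rate_div (e : G.Edge) :
    G.half.rate e / G.half.totalRate = G.rate e / G.totalRate := by
  rw [← totalRate_half G]
  change G.rate e / 2 / _ = _
  rw [div_div]

/-- At halved rates the earlier of the two first rings has the full rate `∑ r`, and it belongs to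
either walk with probability 1/2. This matches the movement of a pair in `stepMean_pair`. -/
theorem le_pairTime_of_ne {p q : V} (hpq : p ≠ q) :
    meanGap G + ∑ e : G.Edge, ENNReal.ofReal (G.rate e / G.totalRate) * nextPairTime G e p q ≤
      pairTime G p q := by
  classical
  have h := le_expectedMeetTime (G := G.half) hpq
  rw [totalRate_half] at h
  rw [pairTime, if_neg hpq]
  refine le_trans (le_of_eq ?_) h
  have key : ∀ e : G.Edge, ENNReal.ofReal (G.rate e / G.totalRate) * nextPairTime G e p q =
      2⁻¹ * (ENNReal.ofReal (G.half.rate e / G.half.totalRate) *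
        (if IsEnd (G := G.half) e p ∧ IsEnd (G := G.half) e q then 0 else
          G.half.expectedMeetTime (swapV (G := G.half) e p) q)) +
      2⁻¹ * (ENNReal.ofReal (G.half.rate e / G.half.totalRate) *
        (if IsEnd (G := G.half) e q ∧ IsEnd (G := G.half) e p then 0 else
          G.half.expectedMeetTime (swapV (G := G.half) e q) p)) := by
    intro e
    rw [half_rate_div, mul_left_comm, mul_left_comm (2⁻¹ : ℝ≥0∞), ← mul_add]
    congr 1
    change nextPairTime G e p q = 2⁻¹ * (if IsEnd e p ∧ IsEnd e q then 0 else
          G.half.expectedMeetTime (swapV e p) q) + 2⁻¹ * (if IsEnd e q ∧ IsEnd e p then 0 else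
          G.half.expectedMeetTime (swapV e q) p)
    unfold nextPairTime
    by_cases he : IsEnd e p ∧ IsEnd e q
    · rw [if_pos he, if_pos he, if_pos he.symm]; simp
    · have he' : ¬ (IsEnd e q ∧ IsEnd e p) := fun h => he h.symm
      rw [if_neg he, if_neg he, if_neg he', pairTime, if_neg (swapV_ne_of e hpq he),
        pairTime, if_neg (swapV_ne_of e hpq.symm he').symm, expectedMeetTime_comm p]
  rw [Finset.sum_congr rfl fun e _ => key e, Finset.sum_add_distrib, ← Finset.mul_sum,
    ← Finset.mul_sum, mul_add, mul_add, add_add_add_comm, ← add_mul, ENNReal.inv_two_add_inv_two,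
    one_mul]
  rfl

/-- A red particle and its partner may share a vertex `p`, where the meeting time is `0` although no
ring has occurred. Such a pair is compared with walks from `p` and any `j ≠ p`: a ring next to `p`
hits both particles, and any other ring leaves them at `p`, where `pairTime` is at most its value
for `p` and any other vertex. -/
theorem le_pairTime (p q : V) :
    meanGap G + ∑ e : G.Edge, ENNReal.ofReal (G.rate e / G.totalRate) * nextPairTime G e p q ≤
      pairTime G p q := by
  by_cases hpq : p = q
  · subst hpq
    conv_rhs => rw [pairTime, if_pos rfl]
    refine le_iInf₂ fun j hj => ?_
    have h := le_pairTime_of_ne G hj.symm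
    rw [pairTime, if_neg hj.symm] at h
    refine le_trans ?_ h
    gcongr with e
    unfold nextPairTime
    by_cases he : IsEnd e p
    · rw [if_pos ⟨he, he⟩]
      exact zero_le
    · rw [if_neg fun h => he h.1, if_neg fun h => he h.1, swapV_of_not_isEnd e he]
      have hle : ∀ k, k ≠ p → pairTime G p p ≤ pairTime G p k := fun k hk => by
        rw [pairTime, if_pos rfl, pairTime, if_neg hk.symm]
        exact iInf₂_le k hk
      gcongr
      · exact hle j hj
      · exact hle _ (swapV_ne_of e hj fun h => he h.2)
  · exact le_pairTime_of_ne G hpq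

theorem pairTime_le (p q : V) :
    pairTime G p q ≤ ⨆ i, ⨆ j, G.half.expectedMeetTime i j := by
  unfold pairTime
  split_ifs with h
  · obtain ⟨j, hj⟩ := exists_ne p
    exact (iInf₂_le j hj).trans (le_iSup₂ (f := fun i j => G.half.expectedMeetTime i j) p j)
  · exact le_iSup₂ (f := fun i j => G.half.expectedMeetTime i j) p q

end PairTime

end Chameleon

namespace Chameleon

/-! ### The labels at the start of a round -/

section Start

variable {V : Type*} [Fintype V] [LinearOrder V] {K : ℕ}

open Classical in
theorem sum_labelCount (L : Fin K → Option V) :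
    ∑ z, labelCount L z = (Finset.univ.filter fun i => L i ≠ none).card := by
  unfold labelCount
  rw [← Finset.card_biUnion]
  · congr 1
    ext i
    simp only [Finset.mem_biUnion, Finset.mem_filter, Finset.mem_univ, true_and]
    rw [Option.ne_none_iff_exists']
  · intro y _ z _ hyz
    refine Finset.disjoint_filter.2 fun i _ h1 h2 => hyz ?_
    exact Option.some_injective _ (h1.symm.trans h2)

/-- The partial sums of `S` in increasing vertex order cut the ranks into consecutive intervals, and
`vertexOfRank` picks the interval that contains `j`. -/
theorem vertexOfRank_spec (S : V → ℕ) {j : ℕ} (hj : j < ∑ z, S z) :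
    ∃ z, vertexOfRank S j = some z ∧ ∑ y ∈ Finset.univ.filter (· < z), S y ≤ j ∧
      j < ∑ y ∈ Finset.univ.filter (· ≤ z), S y := by
  classical
  have hne : (Finset.univ.filter fun v => j < ∑ z ∈ Finset.univ.filter (· ≤ v), S z).Nonempty := by
    have hV : (Finset.univ : Finset V).Nonempty := by
      rw [Finset.nonempty_iff_ne_empty]
      intro h
      rw [h, Finset.sum_empty] at hj
      omega
    refine ⟨Finset.univ.max' hV, ?_⟩
    rw [Finset.mem_filter, Finset.filter_true_of_mem fun z hz => Finset.le_max' _ z hz]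
    exact ⟨Finset.mem_univ _, hj⟩
  refine ⟨Finset.min' _ hne, ?_, ?_, ?_⟩
  · unfold vertexOfRank
    rw [dif_pos]
  · by_contra hlt
    rw [not_le] at hlt
    have hpos : (Finset.univ.filter fun y => y < Finset.min' _ hne).Nonempty := by
      rw [Finset.nonempty_iff_ne_empty]
      intro h
      rw [h, Finset.sum_empty] at hlt
      omega
    set w := Finset.max' _ hpos with hw
    have hw1 : w < Finset.min' _ hne := (Finset.mem_filter.1 (Finset.max'_mem _ hpos)).2
    refine absurd (Finset.min'_le _ w ?_) hw1.not_ge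
    refine Finset.mem_filter.2 ⟨Finset.mem_univ _, hlt.trans_le ?_⟩
    refine Finset.sum_le_sum_of_subset fun y hy => ?_
    exact Finset.mem_filter.2 ⟨Finset.mem_univ _, Finset.le_max' _ y hy⟩
  · exact (Finset.mem_filter.1 (Finset.min'_mem _ hne)).2

theorem initialLabels_eq_none {N : ℕ} {S : V → ℕ} (hN : N ≤ ∑ z, S z) (i : Fin K) :
    initialLabels K N S i = none ↔ ¬ (i : ℕ) < N := by
  unfold initialLabels
  by_cases h : (i : ℕ) < N
  · obtain ⟨z, hz, -⟩ := vertexOfRank_spec S (h.trans_le hN)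
    simp [h, hz]
  · simp [h]

theorem labelCount_initialLabels_le {N : ℕ} {S : V → ℕ} (hN : N ≤ ∑ z, S z) (z : V) :
    labelCount (initialLabels K N S) z ≤ S z := by
  classical
  have hsplit : ∑ y ∈ Finset.univ.filter (· ≤ z), S y =
      ∑ y ∈ Finset.univ.filter (· < z), S y + S z := by
    rw [add_comm, ← Finset.sum_insert (by simp)]
    refine Finset.sum_congr ?_ fun _ _ => rfl
    ext y
    simp [le_iff_eq_or_lt]
  have hcard : (Finset.Ico (∑ y ∈ Finset.univ.filter (· < z), S y)
      (∑ y ∈ Finset.univ.filter (· ≤ z), S y)).card = S z := by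
    rw [Nat.card_Ico, hsplit]
    omega
  rw [← hcard]
  refine Finset.card_le_card_of_injOn (fun i : Fin K => (i : ℕ)) (fun i hi => ?_)
    Fin.val_injective.injOn
  have hi' : initialLabels K N S i = some z := (Finset.mem_filter.1 hi).2
  unfold initialLabels at hi'
  split_ifs at hi' with h
  obtain ⟨y, hy, h1, h2⟩ := vertexOfRank_spec S (h.trans_le hN)
  rw [hy] at hi'
  obtain rfl := Option.some_injective _ hi'
  exact Finset.mem_coe.2 (Finset.mem_Ico.2 ⟨h1, h2⟩)

theorem startState_valid {a b m : ℕ} (hK : K = a * (m - 1) + b * Fintype.card V) {B R W : V → ℕ}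
    (hB : ∑ v, B v = m - 1) (hRW : ∀ v, R v + W v ≤ chi a b (B v))
    (hle : ∑ v, R v ≤ ∑ v, W v) : (startState a b K B R W).Valid a b m := by
  classical
  have hmin : min (∑ v, R v) (∑ v, W v) = ∑ v, R v := min_eq_left hle
  have hRK : ∑ v, R v ≤ K := by
    calc ∑ v, R v ≤ ∑ v, chi a b (B v) :=
          Finset.sum_le_sum fun v _ => (Nat.le_add_right _ _).trans (hRW v)
      _ = K := by
        unfold chi
        rw [Finset.sum_add_distrib, ← Finset.mul_sum, hB, hK]
        simp [mul_comm]
  refine ⟨hB, fun z => ?_, ?_, fun z => ?_, fun i => ?_⟩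
  · have := hRW z
    simp only [startState]
    omega
  · have hsum : ∑ z, labelCount (startState a b K B R W).LR z =
        ∑ z, (startState a b K B R W).R z := by
      rw [sum_labelCount]
      simp only [startState, hmin, ne_eq, initialLabels_eq_none le_rfl, not_not]
      rw [Fin.card_filter_val_lt]
      exact min_eq_right hRK
    -- At every vertex there are at most as many labels as red particles, and the totals agree
    -- because `K` labels suffice for all of them; hence equality at every vertex.
    have hz := (Finset.sum_eq_sum_iff_of_le (s := Finset.univ) fun z _ => by
      simp only [startState, hmin]
      exact labelCount_initialLabels_le le_rfl z).1 hsum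
    exact fun z => hz z (Finset.mem_univ z)
  · have h1 := hRW z
    have h2 := labelCount_initialLabels_le (K := K) (N := ∑ v, R v) (S := W) hle z
    simp only [startState, State.W, hmin]
    omega
  · simp only [startState, hmin, initialLabels_eq_none le_rfl, initialLabels_eq_none hle]

end Start

/-! ### The process up to a given number of rings -/

section Rings

variable {V : Type*} [Fintype V] [LinearOrder V] {K : ℕ} {G : WeightedGraph V}
  {a b m : ℕ} {C : I → I → G.Edge → State V K → State V K}

instance : Countable (State V K) := by
  refine Function.Injective.countable (f := fun x : State V K => (x.B, x.R, x.P, x.LR, x.LW)) ?_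
  intro x y h
  simp only [Prod.mk.injEq] at h
  exact State.ext h.1 h.2.1 h.2.2.1 h.2.2.2.1 h.2.2.2.2

instance : DiscreteMeasurableSpace (State V K) := ⟨fun _ => trivial⟩

/-- Integrating out the second uniform variable first turns the abstract update function into the
explicit law of the step. From here on only this law matters. -/
theorem lintegral_update (hC : IsModifiedUpdate G a b C) (e : G.Edge) (x : State V K)
    (f : State V K → ℝ≥0∞) :
    ∫⁻ q : I × I, f (C q.1 q.2 e x) = stepMean a b e x f := by
  have hm : Measurable fun q : I × I => f (C q.1 q.2 e x) :=
    (measurable_of_countable f).comp (hC.measurable e x)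
  rw [Measure.volume_eq_prod, lintegral_prod _ hm.aemeasurable]
  refine lintegral_congr fun u => ?_
  rw [← lintegral_toMeasure, ← hC.law]
  exact (lintegral_map (measurable_of_countable f)
    ((hC.measurable e x).comp measurable_prodMk_left)).symm

/-- The value of `f` just before time `T`, and `0` if there are `n` rings or more before `T`. -/
def valueUpTo (C : I → I → G.Edge → State V K → State V K) (f : State V K → ℝ≥0∞) :
    ℕ → State V K → ℝ → Driving G → ℝ≥0∞
  | 0, _, _, _ => 0
  | n + 1, x, T, ω =>
    if T ≤ (ω 0).1.1 then f x
    else valueUpTo C f n (C (ω 0).2.1 (ω 0).2.2 (ω 0).1.2 x) (T - (ω 0).1.1) fun k => ω (k + 1)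

theorem measurable_update (hC : IsModifiedUpdate G a b C) :
    Measurable fun p : ((ℝ × G.Edge) × (I × I)) × State V K =>
      C p.1.2.1 p.1.2.2 p.1.1.2 p.2 := by
  have h : Measurable fun q : (G.Edge × State V K) × (I × I) => C q.2.1 q.2.2 q.1.1 q.1.2 :=
    measurable_from_prod_countable_right fun q => hC.measurable q.1 q.2
  exact h.comp ((measurable_fst.fst.snd.prodMk measurable_snd).prodMk measurable_fst.snd)

theorem measurable_valueUpTo (hC : IsModifiedUpdate G a b C) (f : State V K → ℝ≥0∞) (n : ℕ) :
    Measurable fun p : (State V K × ℝ) × Driving G => valueUpTo C f n p.1.1 p.1.2 p.2 := by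
  induction n with
  | zero => exact measurable_const
  | succ n ih =>
    have h0 : Measurable fun p : (State V K × ℝ) × Driving G => p.2 0 :=
      (measurable_pi_apply 0).comp measurable_snd
    refine Measurable.ite (measurableSet_le measurable_fst.snd h0.fst.fst)
      ((measurable_of_countable f).comp measurable_fst.fst) (ih.comp (Measurable.prodMk
        (Measurable.prodMk ?_ (measurable_fst.snd.sub h0.fst.fst)) ?_))
    · exact (measurable_update hC).comp (h0.prodMk measurable_fst.fst)
    · exact measurable_pi_lambda _ fun k => (measurable_pi_apply (k + 1)).comp measurable_snd

theorem measurable_valueUpTo_right (hC : IsModifiedUpdate G a b C) (f : State V K → ℝ≥0∞) (n : ℕ)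
    (x : State V K) (T : ℝ) : Measurable fun ω : Driving G => valueUpTo C f n x T ω :=
  (measurable_valueUpTo hC f n).comp
    (measurable_prodMk_left (x := ((x, T) : State V K × ℝ)))

/-- The expectation of `valueUpTo`. -/
def meanUpTo (C : I → I → G.Edge → State V K → State V K) (f : State V K → ℝ≥0∞) (n : ℕ)
    (x : State V K) (T : ℝ) : ℝ≥0∞ := ∫⁻ ω, valueUpTo C f n x T ω ∂(drivingLaw G)

theorem valueUpTo_sum {ι : Type*} (s : Finset ι) (f : ι → State V K → ℝ≥0∞) (n : ℕ)
    (x : State V K) (T : ℝ) (ω : Driving G) :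
    valueUpTo C (fun y => ∑ i ∈ s, f i y) n x T ω = ∑ i ∈ s, valueUpTo C (f i) n x T ω := by
  induction n generalizing x T ω with
  | zero => simp [valueUpTo]
  | succ n ih =>
    simp only [valueUpTo]
    split_ifs
    · rfl
    · exact ih _ _ _

theorem meanUpTo_sum (hC : IsModifiedUpdate G a b C) {ι : Type*} (s : Finset ι)
    (f : ι → State V K → ℝ≥0∞) (n : ℕ) (x : State V K) (T : ℝ) :
    meanUpTo C (fun y => ∑ i ∈ s, f i y) n x T = ∑ i ∈ s, meanUpTo C (f i) n x T := by
  unfold meanUpTo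
  simp only [valueUpTo_sum]
  exact lintegral_finsetSum _ fun i _ => measurable_valueUpTo_right hC (f i) n x T

theorem afterRings_succ_tail (x : State V K) (ω : Driving G) (k : ℕ) :
    afterRings C x ω (k + 1) =
      afterRings C (C (ω 0).2.1 (ω 0).2.2 (ω 0).1.2 x) (fun l => ω (l + 1)) k := by
  induction k with
  | zero => rfl
  | succ k ih =>
    rw [afterRings, ih]
    rfl

theorem valueUpTo_eq (f : State V K → ℝ≥0∞) (n : ℕ) (x : State V K) (T : ℝ) (ω : Driving G)
    (hω : GoodGaps fun l => (ω l).1.1) (hn : ringsBefore (fun l => (ω l).1.1) T < n) :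
    valueUpTo C f n x T ω = f (stateBefore C x T ω) := by
  induction n generalizing x T ω with
  | zero => omega
  | succ n ih =>
    simp only [valueUpTo]
    unfold stateBefore
    split_ifs with h
    · rw [ringsBefore_eq_zero h]
      rfl
    · rw [ringsBefore_succ hω (not_le.1 h)] at hn ⊢
      rw [ih _ _ _ hω.tail (by omega), afterRings_succ_tail]
      rfl

/-! ### The survival of a single pair -/

variable [Nontrivial V]

instance : IsProbabilityMeasure (drivingLaw G) := by
  unfold drivingLaw
  infer_instance

theorem ae_goodGaps_driving : ∀ᵐ ω ∂(drivingLaw G), GoodGaps fun l => (ω l).1.1 :=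
  ae_goodGaps (G.ringLaw.prod volume) measurable_fst.fst
    (Measure.quasiMeasurePreserving_fst.ae (ringLaw_ae_pos G))

theorem meanUpTo_succ (hC : IsModifiedUpdate G a b C) (f : State V K → ℝ≥0∞) (n : ℕ)
    (x : State V K) (T : ℝ) :
    meanUpTo C f (n + 1) x T = ∫⁻ d, (if T ≤ d.1 then f x else
      stepMean a b d.2 x fun y => meanUpTo C f n y (T - d.1)) ∂G.ringLaw := by
  have hm : Measurable fun ω : Driving G => valueUpTo C f (n + 1) x T ω :=
    measurable_valueUpTo_right hC f (n + 1) x T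
  have hm' : Measurable fun d : (ℝ × G.Edge) × (I × I) => ∫⁻ s, valueUpTo C f (n + 1) x T
      (consSeq d s) ∂(drivingLaw G) :=
    (hm.comp measurable_consSeq).lintegral_prod_right'
  unfold meanUpTo
  unfold drivingLaw at hm' ⊢
  rw [lintegral_consSeq _ hm, lintegral_prod _ hm'.aemeasurable]
  refine lintegral_congr fun d => ?_
  simp only [valueUpTo, consSeq_zero, consSeq_succ]
  by_cases h : T ≤ d.1
  · simp [h]
  · simp only [h, if_false]
    exact lintegral_update hC d.2 x fun y => meanUpTo C f n y (T - d.1)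

/-- The comparison is needed only on a class `S` of valid configurations that no step leaves; lost
labels never reappear, so the absence of a given label defines such a class. -/
theorem meanUpTo_mono (hC : IsModifiedUpdate G a b C) {f g : State V K → ℝ≥0∞}
    {S : State V K → Prop} (hS : ∀ x, S x → x.Valid a b m)
    (hstep : ∀ x y, S x → y.Valid a b m → (∀ i, x.LR i = none → y.LR i = none) → S y)
    (hfg : ∀ x, S x → f x ≤ g x) (n : ℕ) {x : State V K} (hx : S x) (T : ℝ) :
    meanUpTo C f n x T ≤ meanUpTo C g n x T := by
  induction n generalizing x T with
  | zero => simp [meanUpTo, valueUpTo]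
  | succ n ih =>
    rw [meanUpTo_succ hC, meanUpTo_succ hC]
    refine lintegral_mono fun d => ?_
    dsimp only
    split_ifs
    · exact hfg x hx
    · exact stepMean_mono d.2 (hS x hx) fun y hy hxy => ih (hstep x y hx hy hxy) _

/-- Whether the pair `i` still exists. -/
def alive (i : Fin K) (x : State V K) : ℝ≥0∞ := if x.LR i = none then 0 else 1

theorem meanUpTo_const_zero (n : ℕ) (x : State V K) (T : ℝ) :
    meanUpTo C (fun _ => 0) n x T = 0 := by
  have := fun ω : Driving G => valueUpTo_sum (C := C) (∅ : Finset ℕ) (fun _ _ => 0) n x T ω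
  simp only [Finset.sum_empty] at this
  simp [meanUpTo, this]

theorem meanUpTo_alive_of_none (hC : IsModifiedUpdate G a b C) {i : Fin K} (n : ℕ)
    {x : State V K} (hx : x.Valid a b m) (hi : x.LR i = none) (T : ℝ) :
    meanUpTo C (alive i) n x T = 0 := by
  refine le_antisymm ?_ zero_le
  rw [← meanUpTo_const_zero (C := C) n x T]
  refine meanUpTo_mono (m := m) hC (S := fun y => y.Valid a b m ∧ y.LR i = none)
    (fun y hy => hy.1) (fun y z hy hz hyz => ⟨hz, hyz i hy.2⟩) (fun y hy => ?_) n ⟨hx, hi⟩ T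
  simp [alive, hy.2]

theorem meanUpTo_alive_le (hC : IsModifiedUpdate G a b C) (i : Fin K) (n : ℕ)
    {x : State V K} (hx : x.Valid a b m) (T : ℝ) :
    meanUpTo C (alive i) n x T ≤ alive i x := by
  by_cases hi : x.LR i = none
  · rw [meanUpTo_alive_of_none hC n hx hi]
    exact zero_le
  · rw [alive, if_neg hi]
    have hle : ∀ n x T (ω : Driving G), valueUpTo C (alive i) n x T ω ≤ 1 := by
      intro n
      induction n with
      | zero => exact fun x T ω => zero_le
      | succ n ih =>
        intro x T ω
        simp only [valueUpTo]
        split_ifs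
        · unfold alive
          split_ifs <;> simp
        · exact ih _ _ _
    refine (lintegral_mono fun ω => hle n x T ω).trans ?_
    simp

/-- The expected time until the positions in a pair of labels are on the ringing edge. -/
def optPairTime (G : WeightedGraph V) : Option V → Option V → ℝ≥0∞
  | some p, some q => pairTime G p q
  | _, _ => 0

theorem State.Valid.exists_pos {x : State V K} (hx : x.Valid a b m) {i : Fin K}
    (hi : x.LR i ≠ none) : ∃ p q, x.LR i = some p ∧ x.LW i = some q := by
  obtain ⟨p, hp⟩ := Option.ne_none_iff_exists'.1 hi
  obtain ⟨q, hq⟩ := Option.ne_none_iff_exists'.1 (mt (hx.none_iff i).2 hi)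
  exact ⟨p, q, hp, hq⟩

/-- This is Markov's inequality for the first time that a ringing edge carries both particles of the
pair, proved by conditioning on the first ring. Multiplication by `T` makes both sides affine, so
the elapsed time can be split off additively. -/
theorem mul_meanUpTo_alive_le (ha : 0 < a) (hb : 0 < b) (hm : 2 ≤ m) {p : ℝ}
    (hp : IsEvenSplitBound ((b : ℝ) / a) m p) (hC : IsModifiedUpdate G a b C)
    {κ δ : ℝ≥0∞} (hδ : δ = ENNReal.ofReal (p ^ 2 / (2 * a))) (hκ : κ + δ = 1) (i : Fin K) (n : ℕ)
    {x : State V K} (hx : x.Valid a b m) {y z : V} (hy : x.LR i = some y) (hz : x.LW i = some z)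
    (T : ℝ) :
    ENNReal.ofReal T * meanUpTo C (alive i) n x T ≤
      κ * ENNReal.ofReal T + δ * pairTime G y z := by
  have hκδ : ∀ t : ℝ≥0∞, κ * t + δ * t = t := fun t => by rw [← add_mul, hκ, one_mul]
  induction n generalizing x y z T with
  | zero => simp [meanUpTo, valueUpTo]
  | succ n ih =>
    have hxa : alive i x = 1 := by simp [alive, hy]
    have hbound : ∀ᵐ d ∂G.ringLaw, ENNReal.ofReal T * (if T ≤ d.1 then alive i x else
        stepMean a b d.2 x fun y => meanUpTo C (alive i) n y (T - d.1)) ≤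
        κ * ENNReal.ofReal T + δ * (ENNReal.ofReal d.1 + nextPairTime G d.2 y z) := by
      filter_upwards [ringLaw_ae_pos G] with d hd
      obtain ⟨g, e⟩ := d
      simp only at hd ⊢
      split_ifs with h
      -- No ring before `T`: the elapsed time `T` is at most the first waiting time, which pays for
      -- the share `δ T`.
      · rw [hxa, mul_one]
        calc ENNReal.ofReal T = κ * ENNReal.ofReal T + δ * ENNReal.ofReal T := (hκδ _).symm
          _ ≤ _ := by
            gcongr
            exact (ENNReal.ofReal_le_ofReal h).trans (le_add_of_nonneg_right zero_le)
      · have hTg : ENNReal.ofReal T = ENNReal.ofReal (T - g) + ENNReal.ofReal g := by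
          rw [← ENNReal.ofReal_add (by linarith) hd.le, sub_add_cancel]
        by_cases he : IsEnd e y ∧ IsEnd e z
        · have h1 : stepMean a b e x (fun y => meanUpTo C (alive i) n y (T - g)) ≤ κ := by
            refine (stepMean_mono e hx (g := alive i)
              fun w hw _ => meanUpTo_alive_le hC i n hw _).trans ?_
            refine (stepMean_alive_le e ha hb hm hx hp ((onEdge_iff e hy).2 he.1)
              ((onEdge_iff e hz).2 he.2)).trans ?_
            rw [← hδ, ← hκ]
            exact (ENNReal.add_sub_cancel_right (hδ ▸ ENNReal.ofReal_ne_top)).le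
          calc _ ≤ ENNReal.ofReal T * κ := by gcongr
            _ = κ * ENNReal.ofReal T := mul_comm _ _
            _ ≤ _ := le_add_of_nonneg_right zero_le
        · rw [← stepMean_const_mul e ha hb]
          calc _ ≤ stepMean a b e x (fun w => (κ * ENNReal.ofReal T + δ * ENNReal.ofReal g) +
                δ * optPairTime G (w.LR i) (w.LW i)) := by
                refine stepMean_mono e hx fun w hw _ => ?_
                by_cases hi : w.LR i = none
                · rw [meanUpTo_alive_of_none hC n hw hi, mul_zero]
                  exact zero_le
                · obtain ⟨y', z', hy', hz'⟩ := hw.exists_pos hi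
                  rw [hy', hz', optPairTime, hTg, add_mul]
                  calc _ ≤ (κ * ENNReal.ofReal (T - g) + δ * pairTime G y' z') +
                        ENNReal.ofReal g * 1 := by
                        refine add_le_add (ih hw hy' hz' (T - g)) ?_
                        gcongr
                        refine (meanUpTo_alive_le hC i n hw _).trans ?_
                        rw [alive, if_neg hi]
                    _ = _ := by
                      rw [mul_one, add_right_comm, mul_add, add_assoc (κ * _) (κ * _), hκδ]
            _ = (κ * ENNReal.ofReal T + δ * ENNReal.ofReal g) + δ * nextPairTime G e y z := by
                rw [stepMean_add e ha hb, stepMean_const,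
                  stepMean_pair e ha hb hx hy hz he (fun L L' => δ * optPairTime G L L'),
                  nextPairTime, if_neg he]
                simp only [optPairTime]
                ring
            _ = _ := by rw [mul_add, add_assoc]
    have hmean : ∫⁻ d, (κ * ENNReal.ofReal T +
        δ * (ENNReal.ofReal d.1 + nextPairTime G d.2 y z)) ∂G.ringLaw =
        κ * ENNReal.ofReal T + δ * (meanGap G + ∑ e : G.Edge,
          ENNReal.ofReal (G.rate e / G.totalRate) * nextPairTime G e y z) := by
      have := ProbabilityTheory.isProbabilityMeasure_expMeasure G.totalRate_pos
      have hn : Measurable fun d : ℝ × G.Edge => nextPairTime G d.2 y z :=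
        (measurable_from_top (f := fun e : G.Edge => nextPairTime G e y z)).comp measurable_snd
      have hg : Measurable fun d : ℝ × G.Edge => ENNReal.ofReal d.1 :=
        measurable_fst.ennreal_ofReal
      rw [lintegral_add_left measurable_const, lintegral_const, measure_univ, mul_one,
        lintegral_const_mul _ (by exact hg.add hn), lintegral_add_left hg]
      congr 3
      · unfold WeightedGraph.ringLaw meanGap
        rw [lintegral_prod _ hg.aemeasurable]
        simp
      · unfold WeightedGraph.ringLaw
        rw [lintegral_prod _ hn.aemeasurable, ← lintegral_edgeLaw]
        simp
    have hmeas : Measurable fun d : ℝ × G.Edge => if T ≤ d.1 then alive i x else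
        stepMean a b d.2 x fun y => meanUpTo C (alive i) n y (T - d.1) := by
      have h1 : Measurable fun p : State V K × ℝ => meanUpTo C (alive i) n p.1 p.2 :=
        (measurable_valueUpTo hC (alive i) n).lintegral_prod_right'
      have h2 : Measurable fun q : G.Edge × ℝ =>
          ∫⁻ r : I × I, meanUpTo C (alive i) n (C r.1 r.2 q.1 x) (T - q.2) := by
        refine measurable_from_prod_countable_right fun e => ?_
        refine Measurable.lintegral_prod_right' (f := fun p : ℝ × (I × I) =>
          meanUpTo C (alive i) n (C p.2.1 p.2.2 e x) (T - p.1)) ?_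
        exact h1.comp (((hC.measurable e x).comp measurable_snd).prodMk
          (measurable_const.sub measurable_fst))
      refine Measurable.ite (measurableSet_le measurable_const measurable_fst) measurable_const ?_
      simp only [← lintegral_update hC]
      exact h2.comp measurable_swap
    rw [meanUpTo_succ hC, ← lintegral_const_mul _ hmeas]
    refine (lintegral_mono_ae hbound).trans ?_
    rw [hmean]
    gcongr
    exact le_pairTime G y z

end Rings

end Chameleon

namespace Chameleon

/-! ### The expected number of red particles at the end of a round -/

section Red

variable {V : Type*} [Fintype V] [LinearOrder V] {K : ℕ} {G : WeightedGraph V}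
  {a b m : ℕ} {C : I → I → G.Edge → State V K → State V K}

/-- The number of red particles. -/
def redCount (x : State V K) : ℝ≥0∞ := ((∑ v, x.R v : ℕ) : ℝ≥0∞)

/-- Every red particle of a valid configuration carries a label, so linearity of expectation reduces
the count to single pairs. -/
theorem State.Valid.redCount_eq {x : State V K} (hx : x.Valid a b m) :
    redCount x = ∑ i, alive i x := by
  classical
  have h : ∑ v, x.R v = (Finset.univ.filter fun i => x.LR i ≠ none).card := by
    rw [← sum_labelCount]
    exact Finset.sum_congr rfl fun z _ => (hx.red z).symm
  rw [redCount, h, Finset.card_filter, Nat.cast_sum]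
  refine Finset.sum_congr rfl fun i _ => ?_
  unfold alive
  split_ifs <;> simp_all

variable [Nontrivial V]

theorem meanUpTo_alive_le_of_meetTime (ha : 0 < a) (hb : 0 < b) (hm : 2 ≤ m) {p : ℝ}
    (hp : IsEvenSplitBound ((b : ℝ) / a) m p) (hC : IsModifiedUpdate G a b C) {T : ℝ}
    (hT : 2 * (⨆ i, ⨆ j, G.half.expectedMeetTime i j) ≤ ENNReal.ofReal T) (i : Fin K) (n : ℕ)
    {x : State V K} (hx : x.Valid a b m) :
    meanUpTo C (alive i) n x T ≤ ENNReal.ofReal (1 - p ^ 2 / (4 * a)) * alive i x := by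
  by_cases hi : x.LR i = none
  · rw [meanUpTo_alive_of_none hC n hx hi]
    exact zero_le
  obtain ⟨y, z, hy, hz⟩ := hx.exists_pos hi
  have ha' : (1 : ℝ) ≤ a := by exact_mod_cast ha
  have hpos := hp.pos
  have hp3 := hp.lt_third
  have hq0 : 0 ≤ p ^ 2 / (4 * a) := by positivity
  have hq1 : p ^ 2 / (2 * a) ≤ 1 := by
    rw [div_le_one (by positivity)]
    nlinarith
  have hq2 : p ^ 2 / (2 * a) = p ^ 2 / (4 * a) + p ^ 2 / (4 * a) := by
    field_simp
    ring
  set q := p ^ 2 / (4 * a) with hq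
  have hκ : ENNReal.ofReal (1 - p ^ 2 / (2 * a)) + ENNReal.ofReal (p ^ 2 / (2 * a)) = 1 := by
    rw [← ENNReal.ofReal_add (by linarith) (by positivity)]
    simp
  have hpair : 2 * pairTime G y z ≤ ENNReal.ofReal T := by
    refine le_trans ?_ hT
    gcongr
    exact pairTime_le G y z
  -- Only now is `T` known to be positive: its lower bound is at least twice `pairTime`, which is at
  -- least the mean waiting time for a ring.
  have hTpos : 0 < ENNReal.ofReal T := by
    refine lt_of_lt_of_le ?_ hpair
    have : 0 < pairTime G y z := (meanGap_pos G).trans_le (le_self_add.trans (le_pairTime G y z))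
    exact ENNReal.mul_pos (by simp) this.ne'
  have hmain := mul_meanUpTo_alive_le ha hb hm hp hC rfl hκ i n hx hy hz T
  have hxa : alive i x = 1 := by simp [alive, hy]
  rw [hxa, mul_one, ← ENNReal.mul_le_mul_iff_right hTpos.ne' ENNReal.ofReal_ne_top]
  refine hmain.trans ?_
  have h2 : ENNReal.ofReal (p ^ 2 / (2 * a)) = ENNReal.ofReal q * 2 := by
    rw [hq2, ENNReal.ofReal_add hq0 hq0, mul_two]
  calc _ = ENNReal.ofReal (1 - p ^ 2 / (2 * a)) * ENNReal.ofReal T +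
        ENNReal.ofReal q * (2 * pairTime G y z) := by rw [h2, mul_assoc (ENNReal.ofReal q)]
    _ ≤ ENNReal.ofReal (1 - p ^ 2 / (2 * a)) * ENNReal.ofReal T +
        ENNReal.ofReal q * ENNReal.ofReal T := by gcongr
    _ = ENNReal.ofReal T * ENNReal.ofReal (1 - q) := by
      rw [← add_mul, ← ENNReal.ofReal_add (by linarith) hq0, mul_comm, hq2]
      congr 2
      ring

theorem meanUpTo_redCount_le (ha : 0 < a) (hb : 0 < b) (hm : 2 ≤ m) {p : ℝ}
    (hp : IsEvenSplitBound ((b : ℝ) / a) m p) (hC : IsModifiedUpdate G a b C) {T : ℝ}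
    (hT : 2 * (⨆ i, ⨆ j, G.half.expectedMeetTime i j) ≤ ENNReal.ofReal T) (n : ℕ)
    {x : State V K} (hx : x.Valid a b m) :
    meanUpTo C redCount n x T ≤ ENNReal.ofReal (1 - p ^ 2 / (4 * a)) * redCount x :=
  calc meanUpTo C redCount n x T ≤ meanUpTo C (fun y => ∑ i, alive i y) n x T :=
        meanUpTo_mono hC (S := fun y => y.Valid a b m) (fun _ h => h) (fun _ _ _ h _ => h)
          (fun _ h => h.redCount_eq.le) n hx T
    _ = ∑ i, meanUpTo C (alive i) n x T := meanUpTo_sum hC _ _ n x T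
    _ ≤ ∑ i, ENNReal.ofReal (1 - p ^ 2 / (4 * a)) * alive i x :=
        Finset.sum_le_sum fun i _ => meanUpTo_alive_le_of_meetTime ha hb hm hp hC hT i n hx
    _ = _ := by rw [← Finset.mul_sum, hx.redCount_eq]

/-- Almost surely only finitely many rings precede `T`, so the truncated values are eventually equal
to the true one, and Fatou's lemma passes the uniform bound to the limit. -/
theorem lintegral_stateBefore_le (hC : IsModifiedUpdate G a b C) (f : State V K → ℝ≥0∞)
    (x : State V K) (T : ℝ) {c : ℝ≥0∞} (hc : ∀ n, meanUpTo C f n x T ≤ c) :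
    ∫⁻ ω, f (stateBefore C x T ω) ∂(drivingLaw G) ≤ c :=
  calc ∫⁻ ω, f (stateBefore C x T ω) ∂(drivingLaw G) ≤
        ∫⁻ ω, Filter.liminf (fun n => valueUpTo C f n x T ω) Filter.atTop ∂(drivingLaw G) := by
        refine lintegral_mono_ae ?_
        filter_upwards [ae_goodGaps_driving (G := G)] with ω hω
        refine (Filter.Tendsto.liminf_eq (tendsto_const_nhds.congr' ?_)).ge
        filter_upwards [Filter.eventually_gt_atTop (ringsBefore (fun l => (ω l).1.1) T)] with n hn
        exact (valueUpTo_eq f n x T ω hω hn).symm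
    _ ≤ Filter.liminf (fun n => meanUpTo C f n x T) Filter.atTop :=
        lintegral_liminf_le fun n => measurable_valueUpTo_right hC f n x T
    _ ≤ Filter.liminf (fun _ : ℕ => c) Filter.atTop :=
        Filter.liminf_le_liminf (Filter.Eventually.of_forall hc)
    _ = c := Filter.liminf_const c

end Red

end Chameleon

end

theorem propositionP {V : Type*} [Fintype V] [LinearOrder V] [Nontrivial V]
    (G : Chameleon.WeightedGraph V) (a b m : ℕ) (ha : 0 < a) (hb : 0 < b) (hab : a.Coprime b)
    (hm : 2 ≤ m) (p : ℝ) (hp : Chameleon.IsEvenSplitBound ((b : ℝ) / a) m p)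
    (C : I → I → G.Edge → Chameleon.State V (a * (m - 1) + b * Fintype.card V) →
      Chameleon.State V (a * (m - 1) + b * Fintype.card V))
    (hC : Chameleon.IsModifiedUpdate G a b C)
    (B R W : V → ℕ) (hB : ∑ v, B v = m - 1)
    (hRW : ∀ v, R v + W v ≤ Chameleon.chi a b (B v))
    (hle : ∑ v, R v ≤ ∑ v, W v)
    (T : ℝ) (hT : 2 * (⨆ i, ⨆ j, G.half.expectedMeetTime i j) ≤ ENNReal.ofReal T) :
    ∫⁻ ω, ((∑ v, (Chameleon.stateBefore C
        (Chameleon.startState a b (a * (m - 1) + b * Fintype.card V) B R W) T ω).R v : ℕ) : ℝ≥0∞)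
      ∂(Chameleon.drivingLaw G) ≤
    ENNReal.ofReal ((1 - p ^ 2 / (4 * a)) * ((∑ v, R v : ℕ) : ℝ)) := by
  have hx := Chameleon.startState_valid (a := a) (b := b) (m := m) rfl hB hRW hle
  refine (Chameleon.lintegral_stateBefore_le hC Chameleon.redCount _ T fun n =>
    Chameleon.meanUpTo_redCount_le ha hb hm hp hC hT n hx).trans ?_
  have hp0 := hp.pos
  have hp3 := hp.lt_third
  have ha' : (1 : ℝ) ≤ a := by exact_mod_cast ha
  have hc : 0 ≤ 1 - p ^ 2 / (4 * a) := by
    rw [sub_nonneg, div_le_one (by positivity)]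
    nlinarith
  rw [ENNReal.ofReal_mul hc, ENNReal.ofReal_natCast]
  exact le_rfl
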